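/- Let $q\ge 3$ be an integer and $0\le\beta<1$ a real number. For a finite simple graph $G=(V,E)$ let $Z_G=\sum_{\sigma\in[q]^V}\beta^{\#\mathrm{mon}(\sigma)}$ be the partition function of the $q$-state Potts model with activity $\beta$, where $\#\mathrm{mon}(\sigma)$ is the number of edges $uv\in E$ with $\sigma(u)=\sigma(v)$ (and $0^0=1$). Put $$\delta(d)=\frac{2(1-\beta)}{q-1-(1-\beta)d}\ \text{ if } d\le\frac{q-1}{1-\beta}-2,\qquad \delta(d)=1\ \text{ otherwise.}$$ Call a vertex $v$ of $G$ low-degree if $\deg v<\frac{q-1}{1-\beta}-2$, call a set $B\subseteq V$ a permissive block if every vertex outside $B$ that has a neighbour in $B$ is low-degree, and let $B(S)$ be the smallest permissive block containing $S\subseteq V$. Let $\mathcal G$ be a family of finite simple graphs such that 1. ($\delta$ is a contraction function for $\mathcal G$) there are constants $C>0$ and $0<\gamma<1$ such that for every $G=(V,E)\in\mathcal G$, $v\in V$ and $\ell\ge1$, $$\sum_{(v,v_1,\dots,v_\ell)}\ \prod_{i=1}^{\ell}\delta(\deg v_i)<|V|^{C}\gamma^{\ell},$$ where the sum is over all self-avoiding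 walks of length $\ell$ in $G$ starting at $v$; 2. if $\beta=0$, every graph in $\mathcal G$ is $q$-colorable; 3. (local sparsity) there is a constant $C>0$ such that $|B(P)|\le C(\ell+\log|V|)$ for every $G=(V,E)\in\mathcal G$ and every path $P$ in $G$ of length $\ell\ge1$. Then there is an FPTAS for the partition function of the $q$-state Potts model with activity $\beta$ on $\mathcal G$: a deterministic algorithm that, for every $G\in\mathcal G$ and every $\varepsilon>0$, outputs a rational number $\hat Z$ with $(1-\varepsilon)Z_G\le\hat Z\le(1+\varepsilon)Z_G$ in time (bit complexity) polynomial in $|V|$ and $1/\varepsilon$. The algorithm and the polynomial may depend on $\mathcal G,q,\beta$ only; since $\beta$ is an arbitrary real number, the algorithm is given $G$, $\lceil 1/\varepsilon\rceil$ and an arbitrary integer $a$ with $|a2^{-k}-\beta|\le2^{-k}$ for a precision $k$ that is polynomial in $|V|$ and $1/\varepsilon$. In particular, for every integer $\Delta\ge0$ with $q>3(1-\beta)\Delta+1$, there is such an FPTAS on the family of all finite simple graphs of maximum degree at most $\Delta$. -/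

import Mathlib

/-! ### The Potts model -/

section Potts

variable {V : Type*}

/-- The number of monochromatic (undirected) edges of `G` in the configuration `σ`. -/
noncomputable def monoEdges (G : SimpleGraph V) {q : ℕ} (σ : V → Fin q) : ℕ :=
  {e : Sym2 V | e ∈ G.edgeSet ∧ (e.map σ).IsDiag}.ncard

/-- The weight `β ^ #mon(σ)` of a configuration (with `0 ^ 0 = 1`). -/
noncomputable def pottsWeight (G : SimpleGraph V) {q : ℕ} (β : ℝ) (σ : V → Fin q) : ℝ :=
  β ^ monoEdges G σ

/-- The partition function of the `q`-state Potts model with activity `β` on `G`. -/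
noncomputable def pottsZ [Fintype V] (G : SimpleGraph V) (q : ℕ) (β : ℝ) : ℝ :=
  open Classical in ∑ σ : V → Fin q, pottsWeight G β σ

/-- The degree of a vertex. -/
noncomputable def vdeg [Fintype V] (G : SimpleGraph V) (v : V) : ℕ :=
  open Classical in G.degree v

/-! ### Families of graphs, contraction functions, local sparsity -/

/-- A family of finite graphs; the graphs are labelled, with vertex sets `{0, …, n - 1}`. -/
abbrev GraphFamily : Type := (n : ℕ) → Set (SimpleGraph (Fin n))

open Classical in
/-- `ℰ_δ(v, ℓ)`: the sum over all self-avoiding walks `(v, v₁, …, v_ℓ)` of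
`∏ i, δ (deg vᵢ)`. The list `p.support` is `[v, v₁, …, v_ℓ]`. -/
noncomputable def sawSum [Fintype V] (G : SimpleGraph V) (δ : ℕ → ℝ) (v : V) (ℓ : ℕ) : ℝ :=
  ∑ u : V, ∑ p ∈ G.finsetWalkLength ℓ v u with p.IsPath,
    (p.support.tail.map (fun w => δ (vdeg G w))).prod

/-- `δ` is a contraction function for the family `𝒢`. -/
def IsContractionFunction (δ : ℕ → ℝ) (𝒢 : GraphFamily) : Prop :=
  ∃ C γ : ℝ, 0 < C ∧ 0 < γ ∧ γ < 1 ∧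
    ∀ (n : ℕ) (G : SimpleGraph (Fin n)), G ∈ 𝒢 n → ∀ (v : Fin n) (ℓ : ℕ), 1 ≤ ℓ →
      sawSum G δ v ℓ < (n : ℝ) ^ C * γ ^ ℓ

/-- The function `δ` attached to the `q`-state Potts model with activity `β`. -/
noncomputable def pottsDelta (q : ℕ) (β : ℝ) (d : ℕ) : ℝ :=
  open Classical in
  if (d : ℝ) ≤ ((q : ℝ) - 1) / (1 - β) - 2 then 2 * (1 - β) / ((q : ℝ) - 1 - (1 - β) * d)
  else 1

/-- Low-degree vertices; all other vertices are high-degree vertices. -/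
def IsLowDegree [Fintype V] (q : ℕ) (β : ℝ) (G : SimpleGraph V) (v : V) : Prop :=
  (vdeg G v : ℝ) < ((q : ℝ) - 1) / (1 - β) - 2

/-- `B` is a permissive block: every vertex outside `B` with a neighbour in `B` has low
degree. -/
def IsPermissiveBlock [Fintype V] (q : ℕ) (β : ℝ) (G : SimpleGraph V) (B : Set V) : Prop :=
  ∀ u, u ∉ B → (∃ w ∈ B, G.Adj u w) → IsLowDegree q β G u

/-- `B(S)`: the minimal permissive block containing `S`. -/
def permissiveBlock [Fintype V] (q : ℕ) (β : ℝ) (G : SimpleGraph V) (S : Set V) : Set V :=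
  ⋂₀ {B : Set V | S ⊆ B ∧ IsPermissiveBlock q β G B}

/-- `permissiveBlock` is indeed the smallest permissive block containing `S`. -/
theorem permissiveBlock_isLeast [Fintype V] (q : ℕ) (β : ℝ) (G : SimpleGraph V) (S : Set V) :
    IsLeast {B : Set V | S ⊆ B ∧ IsPermissiveBlock q β G B} (permissiveBlock q β G S) := by
  refine ⟨⟨Set.subset_sInter fun B hB => hB.1, ?_⟩, fun B hB => Set.sInter_subset_of_mem hB⟩
  rintro u hu ⟨w, hw, huw⟩
  simp only [permissiveBlock, Set.mem_sInter, not_forall] at hu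
  obtain ⟨B, hB, huB⟩ := hu
  exact hB.2 u huB ⟨w, Set.mem_sInter.1 hw B hB, huw⟩

/-- Local sparsity of a family of graphs: `|B(P)| ≤ C (ℓ + log |V|)` for all paths `P` of length
`ℓ`. Paths have at least one edge: for `ℓ = 0` and `|V| = 1` the right-hand side would be `0`, and
in all other cases the bound for `ℓ = 0` follows, for another `C`, from the bound for `ℓ = 1`. -/
def LocallySparse (q : ℕ) (β : ℝ) (𝒢 : GraphFamily) : Prop :=
  ∃ C : ℝ, 0 < C ∧ ∀ (n : ℕ) (G : SimpleGraph (Fin n)), G ∈ 𝒢 n →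
    ∀ (u v : Fin n) (P : G.Walk u v), P.IsPath → 1 ≤ P.length →
      ((permissiveBlock q β G {w | w ∈ P.support}).ncard : ℝ) ≤ C * (P.length + Real.log n)

end Potts

/-! ### A model of computation with a step count

Programs are pure first-order LISP programs on binary trees with call-by-value recursion. Every
elementary operation costs one step. As the elementary operations only copy pointers, create one
cell or inspect one cell, the number of steps agrees up to a polynomial with the running time of a
Turing machine; in particular there is no arithmetic on numbers in one step. -/

namespace Lisp

/-- The data on which programs work: binary trees. -/
inductive Data : Type
  | nil : Data
  | cons (a b : Data) : Data

/-- Program expressions. Variables are de Bruijn indices. -/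
inductive Code : Type
  /-- the value of a variable -/
  | var (i : ℕ) : Code
  /-- the empty tree -/
  | nil : Code
  /-- a new cell -/
  | cons (e₁ e₂ : Code) : Code
  /-- inspect the value of `e`: if it is `nil` go on with `e₀`, if it is `cons a b` go on with
  `e₁`, in which `a` is variable 0 and `b` is variable 1 -/
  | cond (e e₀ e₁ : Code) : Code
  /-- evaluate `e₁`, and then `e₂`, in which variable 0 is the value of `e₁` -/
  | bind (e₁ e₂ : Code) : Code
  /-- call the function number `f` of the program with the value of `e` as its argument -/
  | call (f : ℕ) (e : Code) : Code

/-- A program is a finite list of function bodies. In a body, variable 0 is the argument. -/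
abbrev Program : Type := List Code

/-- `Eval P env e v t`: in the program `P`, with the values `env` of the variables, the
evaluation of `e` terminates with value `v` after `t` steps. -/
inductive Eval (P : Program) : List Data → Code → Data → ℕ → Prop
  | var {env : List Data} {i : ℕ} {v : Data} (h : env[i]? = some v) : Eval P env (Code.var i) v 1
  | nil {env : List Data} : Eval P env Code.nil Data.nil 1
  | cons {env : List Data} {e₁ e₂ : Code} {v₁ v₂ : Data} {t₁ t₂ : ℕ}
      (h₁ : Eval P env e₁ v₁ t₁) (h₂ : Eval P env e₂ v₂ t₂) :
      Eval P env (Code.cons e₁ e₂) (Data.cons v₁ v₂) (t₁ + t₂ + 1)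
  | condNil {env : List Data} {e e₀ e₁ : Code} {v : Data} {t t₀ : ℕ}
      (h : Eval P env e Data.nil t) (h₀ : Eval P env e₀ v t₀) :
      Eval P env (Code.cond e e₀ e₁) v (t + t₀ + 1)
  | condCons {env : List Data} {e e₀ e₁ : Code} {a b v : Data} {t t₁ : ℕ}
      (h : Eval P env e (Data.cons a b) t) (h₁ : Eval P (a :: b :: env) e₁ v t₁) :
      Eval P env (Code.cond e e₀ e₁) v (t + t₁ + 1)
  | bind {env : List Data} {e₁ e₂ : Code} {v₁ v₂ : Data} {t₁ t₂ : ℕ}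
      (h₁ : Eval P env e₁ v₁ t₁) (h₂ : Eval P (v₁ :: env) e₂ v₂ t₂) :
      Eval P env (Code.bind e₁ e₂) v₂ (t₁ + t₂ + 1)
  | call {env : List Data} {f : ℕ} {e body : Code} {a v : Data} {t t' : ℕ}
      (h : Eval P env e a t) (hf : P[f]? = some body) (h' : Eval P [a] body v t') :
      Eval P env (Code.call f e) v (t + t' + 1)

/-- The program `P` (its function number 0) outputs `v` on the input `x` after `t` steps. -/
def Outputs (P : Program) (x v : Data) (t : ℕ) : Prop :=
  Eval P [x] (Code.call 0 (Code.var 0)) v t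

/-- Lists, as right combs. -/
def Data.ofList : List Data → Data
  | [] => Data.nil
  | a :: l => Data.cons a (Data.ofList l)

/-- Bits: `nil` is `0` and `cons nil nil` is `1`. -/
def Data.ofBool (b : Bool) : Data := bif b then Data.cons Data.nil Data.nil else Data.nil

/-- Numbers in unary. -/
def Data.unary (n : ℕ) : Data := Data.ofList (List.replicate n Data.nil)

/-- Numbers in binary, the least significant bit first. -/
def Data.binary (n : ℕ) : Data := Data.ofList (n.bits.map Data.ofBool)

/-- A graph, as its adjacency matrix. -/
noncomputable def Data.ofGraph {n : ℕ} (G : SimpleGraph (Fin n)) : Data :=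
  open Classical in
  Data.ofList ((List.finRange n).map fun i =>
    Data.ofList ((List.finRange n).map fun j => Data.ofBool (decide (G.Adj i j))))

/-- The number written in binary, the least significant bit first, by a tree that is read as a
list; an entry other than `nil` is the bit `1`, and leading zeros are allowed. -/
def Data.toNat : Data → ℕ
  | Data.nil => 0
  | Data.cons Data.nil d => 2 * Data.toNat d
  | Data.cons (Data.cons _ _) d => 2 * Data.toNat d + 1

end Lisp

/-- There is an FPTAS for the partition function of the `q`-state Potts model with activity `β` on
the graphs of the family `𝒢`: a program which, for every `G` in `𝒢` and every `ε > 0`, outputs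
a rational number `num / den` that is within a factor `1 ± ε` of the partition function, in time
polynomial in the number `n` of vertices and in `1 / ε`.

The program and the polynomials may depend on `𝒢`, `q`, `β`, but not on `G` and `ε`. The
tolerance is passed to the program as `N = ⌈1 / ε⌉` in unary. As `β` is an arbitrary
real number, the program cannot contain it; the input provides an approximation `a / 2 ^ k` with
error at most `2 ^ (-k)`, where `k` is polynomial in `n` and `1 / ε`. (If `β` is rational, such an
approximation is computed in polynomial time, and the input is just `G` and `N`.) -/
def HasFPTAS (q : ℕ) (β : ℝ) (𝒢 : GraphFamily) : Prop :=
  ∃ (prog : Lisp.Program) (prec time : Polynomial ℕ),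
    ∀ (n : ℕ) (G : SimpleGraph (Fin n)), G ∈ 𝒢 n → ∀ ε : ℝ, 0 < ε →
      ∀ N k : ℕ, N = ⌈1 / ε⌉₊ → k = prec.eval (n + N) →
        ∀ a : ℕ, |(a : ℝ) - β * 2 ^ k| ≤ 1 →
          ∃ (num den : Lisp.Data) (t : ℕ),
            Lisp.Outputs prog
              (Lisp.Data.ofList
                [Lisp.Data.ofGraph G, Lisp.Data.unary N, Lisp.Data.unary k, Lisp.Data.binary a])
              (Lisp.Data.cons num den) t ∧
            t ≤ time.eval (n + N) ∧
            0 < den.toNat ∧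
            (1 - ε) * pottsZ G q β ≤ (num.toNat : ℝ) / den.toNat ∧
            (num.toNat : ℝ) / den.toNat ≤ (1 + ε) * pottsZ G q β

/-- The family of all graphs of maximum degree at most `Δ`. -/
def maxDegreeFamily (Δ : ℕ) : GraphFamily := fun _ => {G | ∀ v, vdeg G v ≤ Δ}

/-! The proof is a correlation decay argument for a recursion that eliminates whole blocks of
high-degree vertices. Let Z(R, F) be the partition function after deletion of R, where F counts
coloured boundary edges (`fieldZ`). Then Z is a telescoping product of quotients Z(R) / Z(R ∪ {v}),
and each quotient is approximated separately. Reveal the colour of v, then the colours of its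
high-degree neighbours, and so on. The revealed vertices form a block whose remaining neighbours
have low degree, and a colouring of the block leaves behind the outside graph with new coloured
boundary edges. Adding these edges one at a time produces ratios Z(R, F + p) / Z(R, F) with p at a
low-degree vertex w. Each of them is computed by exploring the block of w, with recursion depth
decreased by one (`levelSum`, `approxRatio`).

Decay. At a low-degree vertex no colour is too likely (`fieldZ_color_le`), so the true ratio is at
least a constant ρ depending on the degree, and estimates are clipped at ρ. In the range above ρ the
logarithm of the ratio is a (1 - ρ)-Lipschitz function of the log-odds of the colour, and the
log-odds carry at most twice the error of their two ingredients. One step therefore contracts by 2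
(1 - ρ) ≤ δ(deg w) (`RelClose.max_ratio`). High-degree vertices stay inside blocks and transmit
errors with factor 1, the value of δ there. Unrolling, the error at depth d is at most a constant
times the weight of all self-avoiding walks longer than d (`approxRatio_close`). By the contraction
hypothesis a depth logarithmic in n + 1/ε suffices (`factorProd_relClose`).

Cost. Every vertex met by the recursion ends a path from the root with at most as many low-degree
vertices as the depth allows. As δ is 1 at high degrees and bounded below at low degrees, the
contraction hypothesis forces such a path to have logarithmic length (`path_length_le`), and local
sparsity then makes the set of vertices coloured along one branch logarithmic (`exists_blockBound`).
Enumerating colours costs q to that power. The remaining branching is bounded by κ to the depth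
times a sum of walk weights. Both are polynomial (`recCost_le`, `exists_cost_bound`).

Implementation. The program computes with unreduced fractions. Lengths of numerators and
denominators essentially add under each operation, so the bit length is at most the number of nodes
times a polynomial (`ratioSpec`). The truncations ρ are rationals in a finite table, chosen with
enough room to work also for an activity b near β. Replacing β > 0 by b changes Z by a factor close
to 1 (`exists_precision`); for β = 0 the activity is exactly 0. In the bounded degree case with Δ ≥
1 all vertices have low degree and every set is its own permissive block, while Δ δ(Δ) < 1 gives the
contraction. -/

/-! ### The Potts model with external fields on induced subgraphs -/

section PottsField

open scoped Classical

variable {n q : ℕ}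

/-- External fields, counted with multiplicity: `F v c` boundary edges penalise colour `c` at
`v`. -/
abbrev ColorField (n q : ℕ) : Type := Fin n → Fin q → ℕ

/-- The graph of the monochromatic edges of `G` outside `R`. -/
def monoGraph (G : SimpleGraph (Fin n)) (R : Finset (Fin n)) (σ : Fin n → Fin q) :
    SimpleGraph (Fin n) where
  Adj u v := G.Adj u v ∧ u ∉ R ∧ v ∉ R ∧ σ u = σ v
  symm := ⟨fun _ _ h => ⟨h.1.symm, h.2.2.1, h.2.1, h.2.2.2.symm⟩⟩
  loopless := ⟨fun _ h => h.1.ne rfl⟩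

/-- The exponent of the weight of `σ` on the graph `G - R` with the field `F`. -/
noncomputable def fieldExponent (G : SimpleGraph (Fin n)) (R : Finset (Fin n))
    (F : ColorField n q) (σ : Fin n → Fin q) : ℕ :=
  (monoGraph G R σ).edgeSet.ncard + ∑ v ∈ Rᶜ, F v (σ v)

/-- The partition function of `G - R` with the field `F`. -/
noncomputable def fieldZ (G : SimpleGraph (Fin n)) (b : ℝ) (R : Finset (Fin n))
    (F : ColorField n q) : ℝ :=
  (q : ℝ)⁻¹ ^ R.card * ∑ σ : Fin n → Fin q, b ^ fieldExponent G R F σ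

/-- The neighbours of `s` outside `R`. -/
noncomputable def remNbrs (G : SimpleGraph (Fin n)) (R : Finset (Fin n)) (s : Fin n) :
    Finset (Fin n) :=
  Finset.univ.filter fun w => G.Adj s w ∧ w ∉ R

theorem mem_remNbrs {G : SimpleGraph (Fin n)} {R : Finset (Fin n)} {s w : Fin n} :
    w ∈ remNbrs G R s ↔ G.Adj s w ∧ w ∉ R := by
  simp [remNbrs]

/-- The field `F` together with one boundary edge of colour `c` at every vertex of `N`. -/
def addNbrs (F : ColorField n q) (N : Finset (Fin n)) (c : Fin q) : ColorField n q :=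
  fun v c' => F v c' + if v ∈ N ∧ c' = c then 1 else 0

theorem ncard_edgeSet_monoGraph (G : SimpleGraph (Fin n)) (R : Finset (Fin n))
    (σ : Fin n → Fin q) {s : Fin n} (hs : s ∉ R) :
    (monoGraph G R σ).edgeSet.ncard =
      ((remNbrs G (insert s R) s).filter fun w => σ w = σ s).card +
        (monoGraph G (insert s R) σ).edgeSet.ncard := by
  have hdel : monoGraph G (insert s R) σ = (monoGraph G R σ).deleteIncidenceSet s := by
    ext u v
    simp only [monoGraph, SimpleGraph.deleteIncidenceSet_adj, Finset.mem_insert]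
    tauto
  have hdeg : (monoGraph G R σ).degree s =
      ((remNbrs G (insert s R) s).filter fun w => σ w = σ s).card := by
    rw [← SimpleGraph.card_neighborFinset_eq_degree]
    congr 1
    ext w
    rw [SimpleGraph.mem_neighborFinset]
    simp only [monoGraph, Finset.mem_filter, mem_remNbrs, Finset.mem_insert]
    constructor
    · rintro ⟨h1, h2, h3, h4⟩
      exact ⟨⟨h1, by rintro (h | h); exacts [h1.ne h.symm, h3 h]⟩, h4.symm⟩
    · rintro ⟨⟨h1, h2⟩, h3⟩
      exact ⟨h1, hs, fun h => h2 (Or.inr h), h3.symm⟩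
  have h1 := (monoGraph G R σ).card_edgeFinset_deleteIncidenceSet s
  have h2 : (monoGraph G R σ).degree s ≤ (monoGraph G R σ).edgeFinset.card := by
    rw [← SimpleGraph.card_incidenceFinset_eq_degree]
    exact Finset.card_le_card (SimpleGraph.incidenceFinset_subset _ _)
  rw [hdel, ← SimpleGraph.coe_edgeFinset, ← SimpleGraph.coe_edgeFinset, Set.ncard_coe_finset,
    Set.ncard_coe_finset, h1, ← hdeg]
  omega

theorem monoGraph_update (G : SimpleGraph (Fin n)) (R : Finset (Fin n))
    (σ : Fin n → Fin q) {s : Fin n} (hs : s ∈ R) (c : Fin q) :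
    monoGraph G R (Function.update σ s c) = monoGraph G R σ := by
  ext u v
  simp only [monoGraph]
  constructor <;>
  · rintro ⟨h1, h2, h3, h4⟩
    have hu : u ≠ s := fun h => h2 (h ▸ hs)
    have hv : v ≠ s := fun h => h3 (h ▸ hs)
    simp_all [Function.update_of_ne]

theorem sum_sum_update (f : (Fin n → Fin q) → ℝ) (s : Fin n) :
    ∑ σ, ∑ c, f (Function.update σ s c) = q * ∑ σ, f σ := by
  -- Exchanging the colour at `s` with the fresh colour is an involution on pairs, so summing over
  -- resampled configurations counts each configuration `q` times.
  have hinv : Function.Involutive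
      (fun x : (Fin n → Fin q) × Fin q => (Function.update x.1 s x.2, x.1 s)) := by
    rintro ⟨σ, c⟩
    simp
  have h := Equiv.sum_comp hinv.toPerm (fun x : (Fin n → Fin q) × Fin q => f x.1)
  rw [Fintype.sum_prod_type, Fintype.sum_prod_type] at h
  simpa [Finset.mul_sum] using h

theorem fieldExponent_update (G : SimpleGraph (Fin n)) {R : Finset (Fin n)}
    (F : ColorField n q) (σ : Fin n → Fin q) {s : Fin n} (hs : s ∉ R) (c : Fin q) :
    fieldExponent G R F (Function.update σ s c) =
      F s c + fieldExponent G (insert s R) (addNbrs F (remNbrs G (insert s R) s) c) σ := by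
  unfold fieldExponent
  rw [ncard_edgeSet_monoGraph G R _ hs, monoGraph_update G _ σ (Finset.mem_insert_self s R)]
  have hc : Rᶜ = insert s (insert s R)ᶜ := by
    ext v
    by_cases h : v = s <;> simp_all
  have hns : s ∉ (insert s R)ᶜ := by simp
  have h1 : ∑ v ∈ Rᶜ, F v (Function.update σ s c v) =
      F s c + ∑ v ∈ (insert s R)ᶜ, F v (σ v) := by
    rw [hc, Finset.sum_insert hns]
    congr 1
    · simp
    · refine Finset.sum_congr rfl fun v hv => ?_
      rw [Function.update_of_ne]
      rintro rfl
      exact hns hv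
  have h2 : ∑ v ∈ (insert s R)ᶜ, addNbrs F (remNbrs G (insert s R) s) c v (σ v) =
      ∑ v ∈ (insert s R)ᶜ, F v (σ v) +
        ((remNbrs G (insert s R) s).filter fun w => σ w = c).card := by
    simp only [addNbrs, Finset.sum_add_distrib]
    congr 1
    rw [Finset.sum_boole, Nat.cast_id]
    congr 1
    ext w
    simp only [Finset.mem_filter, Finset.mem_compl, mem_remNbrs]
    tauto
  have h3 : ((remNbrs G (insert s R) s).filter fun w =>
      Function.update σ s c w = Function.update σ s c s) =
      (remNbrs G (insert s R) s).filter fun w => σ w = c := by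
    refine Finset.filter_congr fun w hw => ?_
    have : w ≠ s := by
      rintro rfl
      exact (mem_remNbrs.1 hw).1.ne rfl
    simp [Function.update_of_ne this]
  rw [h1, h2, h3]
  omega

/-- Resampling the colour of `s` turns the sum over configurations into an average over that colour.
The factor `1 / q` is absorbed by the normalisation, since one more vertex is removed, and the
monochromatic edges at `s` reappear as field at its neighbours. -/
theorem fieldZ_elim (G : SimpleGraph (Fin n)) (b : ℝ) (hq : 0 < q) {R : Finset (Fin n)}
    (F : ColorField n q) {s : Fin n} (hs : s ∉ R) :
    fieldZ G b R F =
      ∑ c, b ^ F s c * fieldZ G b (insert s R) (addNbrs F (remNbrs G (insert s R) s) c) := by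
  have hq' : (q : ℝ) ≠ 0 := by positivity
  unfold fieldZ
  have h := sum_sum_update (fun σ => b ^ fieldExponent G R F σ) s
  have h' : ∑ σ : Fin n → Fin q, b ^ fieldExponent G R F σ =
      (q : ℝ)⁻¹ * ∑ σ : Fin n → Fin q, ∑ c, b ^ fieldExponent G R F (Function.update σ s c) := by
    rw [h]; field_simp
  rw [h', Finset.sum_comm, Finset.card_insert_of_notMem hs, pow_succ, ← mul_assoc, Finset.mul_sum]
  refine Finset.sum_congr rfl fun c _ => ?_
  simp_rw [fieldExponent_update G F _ hs c, pow_add, ← Finset.mul_sum]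
  ring

theorem fieldZ_congr (G : SimpleGraph (Fin n)) (b : ℝ) {R : Finset (Fin n)}
    {F F' : ColorField n q} (h : ∀ v ∉ R, F v = F' v) : fieldZ G b R F = fieldZ G b R F' := by
  unfold fieldZ fieldExponent
  congr 1
  refine Finset.sum_congr rfl fun σ _ => ?_
  congr 2
  exact Finset.sum_congr rfl fun v hv => by rw [h v (Finset.mem_compl.1 hv)]

theorem fieldZ_nonneg (G : SimpleGraph (Fin n)) {b : ℝ} (hb : 0 ≤ b) (R : Finset (Fin n))
    (F : ColorField n q) : 0 ≤ fieldZ G b R F := by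
  unfold fieldZ; positivity

/-- Deleting vertices only removes penalties, and smaller powers of a number in `[0, 1]` are larger.
For `b = 0` this is how feasibility passes to subgraphs. -/
theorem fieldZ_pos_of_subset (G : SimpleGraph (Fin n)) {b : ℝ} (hb : 0 ≤ b) (hb1 : b ≤ 1)
    (hq : 0 < q) {R R' : Finset (Fin n)} (hR : R ⊆ R') {F : ColorField n q}
    (h : 0 < fieldZ G b R F) : 0 < fieldZ G b R' F := by
  have hq' : (0 : ℝ) < (q : ℝ)⁻¹ := by positivity
  unfold fieldZ at h ⊢
  refine mul_pos (pow_pos hq' _) ((pos_of_mul_pos_right h (pow_pos hq' _).le).trans_le ?_)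
  refine Finset.sum_le_sum fun σ _ => pow_le_pow_of_le_one hb hb1 ?_
  unfold fieldExponent
  refine add_le_add (Set.ncard_le_ncard (SimpleGraph.edgeSet_subset_edgeSet.2 ?_)
    (Set.toFinite _)) (Finset.sum_le_sum_of_subset (Finset.compl_subset_compl.2 hR))
  rintro u v ⟨h1, h2, h3, h4⟩
  exact ⟨h1, fun h => h2 (hR h), fun h => h3 (hR h), h4⟩

theorem fieldZ_univ (G : SimpleGraph (Fin n)) (b : ℝ) (hq : 0 < q) (F : ColorField n q) :
    fieldZ G b Finset.univ F = 1 := by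
  have hq' : (q : ℝ) ≠ 0 := by positivity
  have h : ∀ σ : Fin n → Fin q, fieldExponent G Finset.univ F σ = 0 := by
    intro σ
    have : (monoGraph G Finset.univ σ).edgeSet = ∅ := by
      ext e
      induction e with | _ u v => simp [monoGraph]
    simp [fieldExponent, this]
  simp [fieldZ, h, hq']

theorem fieldZ_empty_zero (G : SimpleGraph (Fin n)) (b : ℝ) :
    fieldZ (q := q) G b ∅ 0 = pottsZ G q b := by
  unfold fieldZ pottsZ pottsWeight
  simp only [Finset.card_empty, pow_zero, one_mul]
  refine Finset.sum_congr (by ext; simp) fun σ _ => ?_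
  congr 1
  unfold fieldExponent monoEdges
  simp only [Pi.zero_apply, Finset.sum_const_zero, add_zero]
  congr 1
  ext e
  induction e with | _ u v => simp [monoGraph]

/-- The number of boundary edges at `v`. -/
def fieldDeg (F : ColorField n q) (v : Fin n) : ℕ := ∑ c, F v c

/-- The field `F` with one more boundary edge, of colour `c` at `w`. -/
def addOne (F : ColorField n q) (p : Fin n × Fin q) : ColorField n q :=
  fun v c' => F v c' + if v = p.1 ∧ c' = p.2 then 1 else 0

/-- The conditional distribution at `w`, given the rest, bounds the probability of a colour. -/
theorem fieldZ_color_le (G : SimpleGraph (Fin n)) {b : ℝ} (hb : 0 ≤ b) (hb1 : b ≤ 1)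
    (hq : 0 < q) {R : Finset (Fin n)} (F : ColorField n q) {w : Fin n} (hw : w ∉ R) (c : Fin q) :
    b ^ F w c * fieldZ G b (insert w R) (addNbrs F (remNbrs G (insert w R) w) c) *
        (q - (1 - b) * (fieldDeg F w + (remNbrs G (insert w R) w).card : ℕ)) ≤
      fieldZ G b R F := by
  rw [fieldZ_elim G b hq F hw]
  set N := remNbrs G (insert w R) w
  have hexp : ∀ (c : Fin q) (σ : Fin n → Fin q), fieldExponent G (insert w R) (addNbrs F N c) σ =
      fieldExponent G (insert w R) F σ + (N.filter fun v => σ v = c).card := by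
    intro c σ
    unfold fieldExponent
    rw [add_assoc]
    congr 1
    simp only [addNbrs, Finset.sum_add_distrib]
    congr 1
    rw [Finset.sum_boole, Nat.cast_id]
    congr 1
    ext v
    simp only [Finset.mem_filter, Finset.mem_compl, N, mem_remNbrs]
    tauto
  unfold fieldZ
  have hterm : ∀ c : Fin q, b ^ F w c * ((q : ℝ)⁻¹ ^ (insert w R).card * ∑ σ : Fin n → Fin q,
      b ^ fieldExponent G (insert w R) (addNbrs F N c) σ) =
      (q : ℝ)⁻¹ ^ (insert w R).card * ∑ σ : Fin n → Fin q,
        b ^ fieldExponent G (insert w R) F σ *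
          b ^ (F w c + (N.filter fun v => σ v = c).card) := by
    intro c
    simp_rw [hexp c, pow_add, Finset.mul_sum]
    exact Finset.sum_congr rfl fun σ _ => by ring
  simp_rw [hterm]
  rw [← Finset.mul_sum, mul_assoc]
  refine mul_le_mul_of_nonneg_left ?_ (by positivity)
  rw [Finset.sum_comm, Finset.sum_mul]
  refine Finset.sum_le_sum fun σ _ => ?_
  rw [← Finset.mul_sum, mul_assoc]
  refine mul_le_mul_of_nonneg_left ?_ (by positivity)
  -- Bernoulli's inequality linearises the weight of a colour. Every boundary edge and every
  -- neighbour penalises exactly one colour, so the total over all colours loses at most `1 - b` per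
  -- edge.
  have hpow : ∀ k : ℕ, 1 - (1 - b) * k ≤ b ^ k := by
    intro k
    have := one_add_mul_le_pow (a := b - 1) (by linarith) k
    have h2 : (1 + (b - 1)) ^ k = b ^ k := by ring
    linarith
  have hsum : (q : ℝ) - (1 - b) * (fieldDeg F w + N.card : ℕ) ≤
      ∑ c' : Fin q, b ^ (F w c' + (N.filter fun v => σ v = c').card) := by
    calc (q : ℝ) - (1 - b) * (fieldDeg F w + N.card : ℕ)
        = ∑ c' : Fin q, (1 - (1 - b) * ((F w c' + (N.filter fun v => σ v = c').card : ℕ) : ℝ)) := by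
          rw [Finset.sum_sub_distrib, ← Finset.mul_sum, ← Nat.cast_sum, Finset.sum_add_distrib]
          have : ∑ c' : Fin q, (N.filter fun v => σ v = c').card = N.card :=
            (Finset.card_eq_sum_card_fiberwise (fun _ _ => Finset.mem_univ _)).symm
          rw [this, fieldDeg]
          simp
      _ ≤ _ := Finset.sum_le_sum fun c' _ => hpow _
  have hle1 := pow_le_one₀ hb hb1 (n := F w c + (N.filter fun v => σ v = c).card)
  have h0 : 0 ≤ b ^ (F w c + (N.filter fun v => σ v = c).card) := by positivity
  have hS : 0 ≤ ∑ c' : Fin q, b ^ (F w c' + (N.filter fun v => σ v = c').card) := by positivity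
  rcases le_or_gt 0 ((q : ℝ) - (1 - b) * (fieldDeg F w + N.card : ℕ)) with h | h <;> nlinarith

theorem addNbrs_addOne_congr (G : SimpleGraph (Fin n)) (b : ℝ) {R : Finset (Fin n)}
    (F : ColorField n q) (w : Fin n) (N : Finset (Fin n)) (c c' : Fin q) :
    fieldZ G b (insert w R) (addNbrs (addOne F (w, c)) N c') =
      fieldZ G b (insert w R) (addNbrs F N c') := by
  refine fieldZ_congr G b fun v hv => ?_
  ext c''
  have : v ≠ w := by rintro rfl; simp at hv
  simp [addNbrs, addOne, this]

/-- Only the term with colour `c` at `w` feels the new edge, and it is multiplied by `b`. -/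
theorem fieldZ_addOne (G : SimpleGraph (Fin n)) (b : ℝ)
    (hq : 0 < q) {R : Finset (Fin n)} (F : ColorField n q) {w : Fin n} (hw : w ∉ R) (c : Fin q) :
    fieldZ G b R (addOne F (w, c)) = fieldZ G b R F -
      (1 - b) * (b ^ F w c *
        fieldZ G b (insert w R) (addNbrs F (remNbrs G (insert w R) w) c)) := by
  rw [fieldZ_elim G b hq _ hw, fieldZ_elim G b hq F hw]
  simp_rw [addNbrs_addOne_congr]
  rw [← Finset.add_sum_erase _ _ (Finset.mem_univ c), ← Finset.add_sum_erase (a := c) _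
    (fun c' => b ^ F w c' * _) (Finset.mem_univ c)]
  have : ∀ c' ∈ Finset.univ.erase c, b ^ addOne F (w, c) w c' *
      fieldZ G b (insert w R) (addNbrs F (remNbrs G (insert w R) w) c') = b ^ F w c' *
      fieldZ G b (insert w R) (addNbrs F (remNbrs G (insert w R) w) c') := by
    intro c' hc'
    have : c' ≠ c := Finset.ne_of_mem_erase hc'
    simp [addOne, this]
  rw [Finset.sum_congr rfl this]
  have h2 : addOne F (w, c) w c = F w c + 1 := by simp [addOne]
  rw [h2, pow_succ]
  ring

theorem fieldZ_addOne_le (G : SimpleGraph (Fin n)) {b : ℝ} (hb : 0 ≤ b) (hb1 : b ≤ 1)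
    (hq : 0 < q) {R : Finset (Fin n)} (F : ColorField n q) {w : Fin n} (hw : w ∉ R) (c : Fin q) :
    fieldZ G b R (addOne F (w, c)) ≤ fieldZ G b R F := by
  rw [fieldZ_addOne G b hq F hw]
  have := fieldZ_nonneg G hb (insert w R) (addNbrs F (remNbrs G (insert w R) w) c)
  have h2 : 0 ≤ (1 - b) * (b ^ F w c *
      fieldZ G b (insert w R) (addNbrs F (remNbrs G (insert w R) w) c)) :=
    mul_nonneg (by linarith) (by positivity)
  linarith

/-- A marginal bound. -/
theorem le_fieldZ_addOne (G : SimpleGraph (Fin n)) {b : ℝ} (hb : 0 ≤ b) (hb1 : b ≤ 1)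
    (hq : 0 < q) {R : Finset (Fin n)} (F : ColorField n q) {w : Fin n} (hw : w ∉ R) (c : Fin q)
    {ρ : ℝ} {m : ℕ} (hm : fieldDeg F w + (remNbrs G (insert w R) w).card ≤ m) (hρ1 : ρ ≤ 1)
    (hρ : 1 - b ≤ (1 - ρ) * (q - (1 - b) * m)) :
    ρ * fieldZ G b R F ≤ fieldZ G b R (addOne F (w, c)) := by
  rw [fieldZ_addOne G b hq F hw]
  have h1 := fieldZ_color_le G hb hb1 hq F hw c
  set X := b ^ F w c * fieldZ G b (insert w R) (addNbrs F (remNbrs G (insert w R) w) c) with hX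
  have hX0 : 0 ≤ X := by
    have := fieldZ_nonneg G hb (insert w R) (addNbrs F (remNbrs G (insert w R) w) c)
    positivity
  have hm' : ((fieldDeg F w + (remNbrs G (insert w R) w).card : ℕ) : ℝ) ≤ m := by exact_mod_cast hm
  set y := (q : ℝ) - (1 - b) * (fieldDeg F w + (remNbrs G (insert w R) w).card : ℕ)
  have hy : (q : ℝ) - (1 - b) * m ≤ y := by
    have := mul_le_mul_of_nonneg_left hm' (sub_nonneg.2 hb1)
    simp only [y]; linarith
  have h2 : (1 - b) * X ≤ (1 - ρ) * (X * y) := by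
    calc (1 - b) * X ≤ ((1 - ρ) * (q - (1 - b) * m)) * X := mul_le_mul_of_nonneg_right hρ hX0
      _ ≤ ((1 - ρ) * y) * X := by
        apply mul_le_mul_of_nonneg_right _ hX0
        exact mul_le_mul_of_nonneg_left hy (by linarith)
      _ = _ := by ring
  have h3 := mul_le_mul_of_nonneg_left h1 (sub_nonneg.2 hρ1)
  linarith

end PottsField

/-! ### Relative closeness and the contraction of one recursion step -/

section Closeness

/-- `x` and `y` agree up to a factor `exp E`. -/
def RelClose (E x y : ℝ) : Prop := x ≤ Real.exp E * y ∧ y ≤ Real.exp E * x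

theorem RelClose.mono {E E' x y : ℝ} (h : RelClose E x y) (hE : E ≤ E') (hx : 0 ≤ x)
    (hy : 0 ≤ y) : RelClose E' x y :=
  ⟨h.1.trans (mul_le_mul_of_nonneg_right (Real.exp_le_exp.2 hE) hy),
    h.2.trans (mul_le_mul_of_nonneg_right (Real.exp_le_exp.2 hE) hx)⟩

theorem RelClose.refl {E : ℝ} (hE : 0 ≤ E) {x : ℝ} (hx : 0 ≤ x) : RelClose E x x := by
  have := le_mul_of_one_le_left hx (Real.one_le_exp hE)
  exact ⟨this, this⟩

theorem RelClose.symm {E x y : ℝ} (h : RelClose E x y) : RelClose E y x := ⟨h.2, h.1⟩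

theorem RelClose.trans {E E' x y z : ℝ} (h : RelClose E x y) (h' : RelClose E' y z) :
    RelClose (E + E') x z := by
  constructor
  · rw [Real.exp_add, mul_assoc]
    exact h.1.trans (mul_le_mul_of_nonneg_left h'.1 (Real.exp_pos _).le)
  · rw [add_comm E, Real.exp_add, mul_assoc]
    exact h'.2.trans (mul_le_mul_of_nonneg_left h.2 (Real.exp_pos _).le)

theorem RelClose.mul_left {E x y a : ℝ} (h : RelClose E x y) (ha : 0 ≤ a) :
    RelClose E (a * x) (a * y) := by
  constructor
  · have := mul_le_mul_of_nonneg_left h.1 ha; linarith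
  · have := mul_le_mul_of_nonneg_left h.2 ha; linarith

theorem RelClose.sum {ι : Type*} (s : Finset ι) {E : ℝ} {f g : ι → ℝ}
    (h : ∀ i ∈ s, RelClose E (f i) (g i)) : RelClose E (∑ i ∈ s, f i) (∑ i ∈ s, g i) := by
  constructor
  · rw [Finset.mul_sum]; exact Finset.sum_le_sum fun i hi => (h i hi).1
  · rw [Finset.mul_sum]; exact Finset.sum_le_sum fun i hi => (h i hi).2

/-- One minus the effect of a boundary edge, as a function of the log-odds of its colour. -/
noncomputable def oddsRatio (b t : ℝ) : ℝ := (1 + b * Real.exp t) / (1 + Real.exp t)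

theorem oddsRatio_pos {b : ℝ} (hb : 0 ≤ b) (t : ℝ) : 0 < oddsRatio b t := by
  unfold oddsRatio; positivity

theorem oddsRatio_antitone {b : ℝ} (hb1 : b ≤ 1) : Antitone (oddsRatio b) := by
  intro u v h
  have := Real.exp_le_exp.2 h
  unfold oddsRatio
  rw [div_le_div_iff₀ (by positivity) (by positivity)]
  nlinarith

theorem oddsRatio_continuous (b : ℝ) : Continuous (oddsRatio b) := by
  unfold oddsRatio
  exact Continuous.div (by fun_prop) (by fun_prop) fun t => by positivity

/-- The logarithmic derivative of `oddsRatio` at `t` is at most `1 - oddsRatio b t` in absolute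
value. This bound increases with `t`, so its value at the right end of the interval serves as a
Lipschitz constant. -/
theorem oddsRatio_le {b : ℝ} (hb : 0 ≤ b) (hb1 : b ≤ 1) {u v κ : ℝ} (huv : u ≤ v)
    (hκ : 1 - oddsRatio b v ≤ κ) :
    oddsRatio b u ≤ Real.exp (κ * (v - u)) * oddsRatio b v := by
  have hmono : MonotoneOn (fun t => Real.log (1 + b * Real.exp t) - Real.log (1 + Real.exp t)
      + κ * t) (Set.Icc u v) := by
    have hd : ∀ t : ℝ, HasDerivAt (fun t => Real.log (1 + b * Real.exp t) -
        Real.log (1 + Real.exp t) + κ * t)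
        (b * Real.exp t / (1 + b * Real.exp t) - Real.exp t / (1 + Real.exp t) + κ * 1) t := by
      intro t
      refine HasDerivAt.add (HasDerivAt.sub ?_ ?_) ((hasDerivAt_id t).const_mul κ)
      · exact (((Real.hasDerivAt_exp t).const_mul b).const_add 1).log (by positivity)
      · exact ((Real.hasDerivAt_exp t).const_add 1).log (by positivity)
    refine monotoneOn_of_deriv_nonneg (convex_Icc u v)
      (fun t _ => (hd t).continuousAt.continuousWithinAt)
      (fun t _ => (hd t).differentiableAt.differentiableWithinAt) fun t ht => ?_
    rw [interior_Icc] at ht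
    rw [(hd t).deriv]
    have h1 : 1 - oddsRatio b t ≤ κ := by
      have := oddsRatio_antitone hb1 ht.2.le
      linarith
    have h2 : Real.exp t / (1 + Real.exp t) - b * Real.exp t / (1 + b * Real.exp t) ≤
        1 - oddsRatio b t := by
      have hp : 0 < Real.exp t := Real.exp_pos t
      have : 1 - oddsRatio b t = Real.exp t / (1 + Real.exp t) -
          b * Real.exp t / (1 + Real.exp t) := by
        unfold oddsRatio; field_simp; ring
      rw [this]
      apply sub_le_sub_left
      apply div_le_div_of_nonneg_left (by positivity) (by positivity)
      nlinarith
    linarith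
  have h := hmono (Set.left_mem_Icc.2 huv) (Set.right_mem_Icc.2 huv) huv
  have hu := oddsRatio_pos hb u
  have hv := oddsRatio_pos hb v
  rw [← Real.exp_log hu, ← Real.exp_log hv, ← Real.exp_add, Real.exp_le_exp]
  unfold oddsRatio
  rw [Real.log_div (by positivity) (by positivity), Real.log_div (by positivity) (by positivity)]
  simp only at h
  linarith

theorem oddsRatio_log {b x A : ℝ} (hx : 0 < x) (hA : 0 < A) :
    oddsRatio b (Real.log (x / A)) = (b * x + A) / (x + A) := by
  unfold oddsRatio
  rw [Real.exp_log (by positivity)]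
  field_simp
  ring

/-- The truncated ratio is closer to the true ratio than its ingredients, by a factor
`2 (1 - ρ)`. -/
theorem RelClose.max_ratio {b ρ E x A x' A' : ℝ} (hb : 0 ≤ b) (hb1 : b ≤ 1)
    (hρ1 : ρ ≤ 1) (hE : 0 ≤ E) (hx : 0 ≤ x) (hA : 0 ≤ A) (hx' : 0 ≤ x') (hA' : 0 ≤ A')
    (hpos : 0 < x + A) (h1 : RelClose E x' x) (h2 : RelClose E A' A)
    (hr : ρ * (x + A) ≤ b * x + A) :
    RelClose (2 * (1 - ρ) * E) (max ρ ((b * x' + A') / (x' + A'))) ((b * x + A) / (x + A)) := by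
  have hκ : 0 ≤ 2 * (1 - ρ) * E := mul_nonneg (mul_nonneg two_pos.le (by linarith)) hE
  have hr' : ρ ≤ (b * x + A) / (x + A) := by rwa [le_div_iff₀ hpos]
  have hpos' : ∀ {y z : ℝ}, RelClose E y z → 0 < z → 0 < y := by
    intro y z h hz
    exact pos_of_mul_pos_right (hz.trans_le h.2) (Real.exp_pos _).le
  -- Log-odds do not exist if one ingredient vanishes. Closeness then forces its approximation to
  -- vanish too, and both ratios are `1`, respectively `b`.
  rcases hx.eq_or_lt with rfl | hx0
  · have hx'0 : x' = 0 := le_antisymm (by simpa using h1.1) hx'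
    have hA0 : 0 < A := by simpa using hpos
    have := hpos' h2 hA0
    subst hx'0
    simp only [mul_zero, zero_add] at hr' ⊢
    rw [div_self this.ne', div_self hA0.ne', max_eq_right hρ1]
    exact RelClose.refl hκ zero_le_one
  rcases hA.eq_or_lt with rfl | hA0
  · have hA'0 : A' = 0 := le_antisymm (by simpa using h2.1) hA'
    have := hpos' h1 hx0
    subst hA'0
    simp only [add_zero] at hr' ⊢
    rw [mul_div_cancel_right₀ _ this.ne'] at *
    rw [mul_div_cancel_right₀ _ hx0.ne'] at *
    rw [max_eq_right hr']
    exact RelClose.refl hκ hb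
  have hx'0 := hpos' h1 hx0
  have hA'0 := hpos' h2 hA0
  rw [← oddsRatio_log hx0 hA0] at hr' ⊢
  rw [← oddsRatio_log hx'0 hA'0]
  set u := Real.log (x / A) with hu
  set u' := Real.log (x' / A') with hu'
  have hlog : ∀ {y z : ℝ}, 0 < y → 0 < z → y ≤ Real.exp E * z → Real.log y - Real.log z ≤ E := by
    intro y z hy hz h
    have := Real.log_le_log hy h
    rw [Real.log_mul (Real.exp_pos _).ne' hz.ne', Real.log_exp] at this
    linarith
  -- The log-odds are a difference of two logarithms, each off by at most `E`; this is the origin of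
  -- the factor 2 in the contraction.
  have hd1 : u - u' ≤ 2 * E := by
    rw [hu, hu', Real.log_div hx0.ne' hA0.ne', Real.log_div hx'0.ne' hA'0.ne']
    have := hlog hx0 hx'0 h1.2
    have := hlog hA'0 hA0 h2.1
    linarith
  have hd2 : u' - u ≤ 2 * E := by
    rw [hu, hu', Real.log_div hx0.ne' hA0.ne', Real.log_div hx'0.ne' hA'0.ne']
    have := hlog hx'0 hx0 h1.1
    have := hlog hA0 hA'0 h2.2
    linarith
  have key : ∀ {s t : ℝ}, s ≤ t → t - s ≤ 2 * E → ρ ≤ oddsRatio b t →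
      oddsRatio b s ≤ Real.exp (2 * (1 - ρ) * E) * oddsRatio b t := by
    intro s t hst hE2 hρt
    refine (oddsRatio_le hb hb1 hst (κ := 1 - ρ) (by linarith)).trans ?_
    refine mul_le_mul_of_nonneg_right (Real.exp_le_exp.2 ?_) (oddsRatio_pos hb t).le
    have := mul_le_mul_of_nonneg_left hE2 (sub_nonneg.2 hρ1)
    linarith
  have hone := Real.one_le_exp hκ
  rcases le_total u' u with h | h
  · have hle := oddsRatio_antitone hb1 h
    rw [max_eq_right (hr'.trans hle)]
    exact ⟨key h hd1 hr', hle.trans (le_mul_of_one_le_left (oddsRatio_pos hb _).le hone)⟩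
  · have hle := oddsRatio_antitone hb1 h
    refine ⟨(max_le hr' hle).trans (le_mul_of_one_le_left (oddsRatio_pos hb _).le hone), ?_⟩
    rcases le_or_gt ρ (oddsRatio b u') with h3 | h3
    · rw [max_eq_right h3]
      exact key h hd2 h3
    -- Below `ρ` the Lipschitz bound is not available. Clipping amounts to moving the approximate
    -- log-odds back to a point between `u` and `u'` where the ratio equals `ρ`, which only brings
    -- them closer to `u`.
    · obtain ⟨t, ht, htρ⟩ := intermediate_value_Icc' h (oddsRatio_continuous b).continuousOn
        ⟨h3.le, hr'⟩
      rw [max_eq_left h3.le, ← htρ]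
      rw [← htρ] at key
      exact key ht.1 (by linarith [ht.2]) le_rfl

end Closeness

/-! ### The recursion -/

section Recursion

open scoped Classical

variable {n q : ℕ} (G : SimpleGraph (Fin n)) (low : Fin n → Prop)

/-- The remaining high-degree neighbours of `s` after the removal of `R` and `s`. -/
noncomputable def highNbrs (R : Finset (Fin n)) (s : Fin n) : List (Fin n) :=
  (List.finRange n).filter fun w => w ∈ remNbrs G (insert s R) s ∧ ¬ low w

/-- The remaining low-degree neighbours of `s` after the removal of `R` and `s`. -/
noncomputable def lowNbrs (R : Finset (Fin n)) (s : Fin n) : List (Fin n) :=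
  (List.finRange n).filter fun w => w ∈ remNbrs G (insert s R) s ∧ low w

variable {G low} in
theorem mem_highNbrs {R : Finset (Fin n)} {s w : Fin n} :
    w ∈ highNbrs G low R s ↔ (G.Adj s w ∧ w ∉ insert s R) ∧ ¬ low w := by
  simp [highNbrs, mem_remNbrs]

variable {G low} in
theorem mem_lowNbrs {R : Finset (Fin n)} {s w : Fin n} :
    w ∈ lowNbrs G low R s ↔ (G.Adj s w ∧ w ∉ insert s R) ∧ low w := by
  simp [lowNbrs, mem_remNbrs]

theorem highNbrs_nodup (R : Finset (Fin n)) (s : Fin n) : (highNbrs G low R s).Nodup :=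
  (List.nodup_finRange n).filter _

theorem lowNbrs_nodup (R : Finset (Fin n)) (s : Fin n) : (lowNbrs G low R s).Nodup :=
  (List.nodup_finRange n).filter _

/-- The field after `s` has received the colour `c`. -/
noncomputable def elimField (R : Finset (Fin n)) (F : ColorField n q) (s : Fin n) (c : Fin q) :
    ColorField n q :=
  fun v c' => if v = s then 0 else F v c' + if v ∈ highNbrs G low R s ∧ c' = c then 1 else 0

/-- The field `F` together with the boundary edges in the list `P`. -/
def addField (F : ColorField n q) (P : List (Fin n × Fin q)) : ColorField n q :=
  fun v c => F v c + P.count (v, c)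

/-- The list of pending boundary edges of colour `c` at the vertices of `l`. -/
def colorList (l : List (Fin n)) (c : Fin q) : List (Fin n × Fin q) := l.map fun w => (w, c)

theorem card_compl_insert_lt {R : Finset (Fin n)} {s : Fin n} (h : s ∉ R) :
    (insert s R)ᶜ.card < Rᶜ.card := by
  refine Finset.card_lt_card ⟨Finset.compl_subset_compl.2 (Finset.subset_insert s R), fun hh => ?_⟩
  have := hh (Finset.mem_compl.2 h)
  simp at this

/-- One level of the recursion: enumerate the colours of the block that is explored from the stack
`S`, and multiply the approximate ratios `rhat` of the boundary edges. -/
noncomputable def levelSum (b : ℝ) (rhat : Finset (Fin n) → ColorField n q → Fin n → Fin q → ℝ) :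
    Finset (Fin n) → ColorField n q → List (Fin n) → List (Fin n × Fin q) → ℝ
  | _, _, [], [] => 1
  | R, F, [], p :: P => rhat R F p.1 p.2 * levelSum b rhat R (addOne F p) [] P
  | R, F, s :: S, P =>
    if _h : s ∈ R then levelSum b rhat R F S P
    else ∑ c : Fin q, b ^ F s c * levelSum b rhat (insert s R) (elimField G low R F s c)
      (highNbrs G low R s ++ S) (colorList (lowNbrs G low R s) c ++ P)
termination_by R _ S P => (Rᶜ.card, S.length, P.length)
decreasing_by
  · exact Prod.Lex.right _ (Prod.Lex.right _ (by simp))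
  · exact Prod.Lex.right _ (Prod.Lex.left _ _ (by simp))
  · exact Prod.Lex.left _ _ (card_compl_insert_lt ‹_›)

/-- The approximate partition function ratio with recursion depth `d`. -/
noncomputable def approxRatio (b : ℝ) (ρ : Fin n → ℝ) :
    ℕ → Finset (Fin n) → ColorField n q → List (Fin n) → List (Fin n × Fin q) → ℝ
  | 0 => levelSum G low b fun _ _ _ _ => 1
  | d + 1 => levelSum G low b fun R F w c =>
      max (ρ w) (approxRatio b ρ d R (addOne F (w, c)) [w] [] / approxRatio b ρ d R F [w] [])

/-- The vertices that are removed after the exploration from the stack `S`. -/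
noncomputable def explored : Finset (Fin n) → List (Fin n) → Finset (Fin n)
  | R, [] => R
  | R, s :: S =>
    if _h : s ∈ R then explored R S else explored (insert s R) (highNbrs G low R s ++ S)
termination_by R S => (Rᶜ.card, S.length)
decreasing_by
  · exact Prod.Lex.right _ (by simp)
  · exact Prod.Lex.left _ _ (card_compl_insert_lt ‹_›)

/-- Induction along the recursion. -/
theorem exploration_induction {motive : Finset (Fin n) → List (Fin n) → List (Fin n × Fin q) → Prop}
    (nil : ∀ R, motive R [] []) (pending : ∀ R p P, motive R [] P → motive R [] (p :: P))
    (skip : ∀ R s S P, s ∈ R → motive R S P → motive R (s :: S) P)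
    (elim : ∀ R s S P, s ∉ R → (∀ c, motive (insert s R) (highNbrs G low R s ++ S)
      (colorList (lowNbrs G low R s) c ++ P)) → motive R (s :: S) P)
    (R : Finset (Fin n)) (S : List (Fin n)) (P : List (Fin n × Fin q)) : motive R S P := by
  match S, P with
  | [], [] => exact nil R
  | [], p :: P => exact pending R p P (exploration_induction nil pending skip elim R [] P)
  | s :: S, P =>
    by_cases h : s ∈ R
    · exact skip R s S P h (exploration_induction nil pending skip elim R S P)
    · exact elim R s S P h fun c => exploration_induction nil pending skip elim _ _ _
termination_by (Rᶜ.card, S.length, P.length)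
decreasing_by
  · exact Prod.Lex.right _ (Prod.Lex.right _ (by simp))
  · exact Prod.Lex.right _ (Prod.Lex.left _ _ (by simp))
  · exact Prod.Lex.left _ _ (card_compl_insert_lt ‹_›)

section Equations

variable (b : ℝ) (rhat : Finset (Fin n) → ColorField n q → Fin n → Fin q → ℝ)
  (R : Finset (Fin n)) (F : ColorField n q)

theorem levelSum_nil : levelSum G low b rhat R F [] [] = 1 := by rw [levelSum]

theorem levelSum_pending (p : Fin n × Fin q) (P : List (Fin n × Fin q)) :
    levelSum G low b rhat R F [] (p :: P) =
      rhat R F p.1 p.2 * levelSum G low b rhat R (addOne F p) [] P := by rw [levelSum]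

variable {R}

theorem levelSum_skip {s : Fin n} (h : s ∈ R) (S : List (Fin n)) (P : List (Fin n × Fin q)) :
    levelSum G low b rhat R F (s :: S) P = levelSum G low b rhat R F S P := by
  rw [levelSum, dif_pos h]

theorem levelSum_elim {s : Fin n} (h : s ∉ R) (S : List (Fin n)) (P : List (Fin n × Fin q)) :
    levelSum G low b rhat R F (s :: S) P = ∑ c : Fin q, b ^ F s c *
      levelSum G low b rhat (insert s R) (elimField G low R F s c)
        (highNbrs G low R s ++ S) (colorList (lowNbrs G low R s) c ++ P) := by
  rw [levelSum, dif_neg h]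

theorem explored_skip {s : Fin n} (h : s ∈ R) (S : List (Fin n)) :
    explored G low R (s :: S) = explored G low R S := by rw [explored, dif_pos h]

theorem explored_elim {s : Fin n} (h : s ∉ R) (S : List (Fin n)) :
    explored G low R (s :: S) = explored G low (insert s R) (highNbrs G low R s ++ S) := by
  rw [explored, dif_neg h]

theorem explored_nil (R : Finset (Fin n)) : explored G low R [] = R := by rw [explored]

end Equations

theorem subset_explored (R : Finset (Fin n)) (S : List (Fin n)) :
    R ⊆ explored G low R S ∧ ∀ s ∈ S, s ∈ explored G low R S := by
  -- The exploration does not depend on pending edges, so one dummy colour suffices.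
  refine exploration_induction (q := 1) G low
    (motive := fun R S _ => R ⊆ explored G low R S ∧ ∀ s ∈ S, s ∈ explored G low R S)
    ?_ ?_ ?_ ?_ R S []
  · intro R; simp [explored_nil]
  · intro R _ _; exact id
  · intro R s S _ hs h
    rw [explored_skip G low hs]
    exact ⟨h.1, List.forall_mem_cons.2 ⟨h.1 hs, h.2⟩⟩
  · intro R s S _ hs h
    rw [explored_elim G low hs]
    have h := h 0
    refine ⟨(Finset.subset_insert s R).trans h.1, List.forall_mem_cons.2
      ⟨h.1 (Finset.mem_insert_self s R), fun t ht => h.2 t (List.mem_append_right _ ht)⟩⟩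

variable {G low}

theorem addField_cons (F : ColorField n q) (p : Fin n × Fin q) (P : List (Fin n × Fin q)) :
    addField F (p :: P) = addField (addOne F p) P := by
  ext v c
  simp only [addField, addOne, List.count_cons]
  have : (p == (v, c)) = decide (v = p.1 ∧ c = p.2) := by
    rcases p with ⟨a, d⟩
    rw [Bool.eq_iff_iff]
    simp only [beq_iff_eq, Prod.mk.injEq, decide_eq_true_eq]
    exact ⟨fun h => ⟨h.1.symm, h.2.symm⟩, fun h => ⟨h.1.symm, h.2.symm⟩⟩
  simp only [this, decide_eq_true_eq]
  omega

theorem count_colorList {l : List (Fin n)} (hl : l.Nodup) (c c' : Fin q) (v : Fin n) :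
    (colorList l c).count (v, c') = if v ∈ l ∧ c' = c then 1 else 0 := by
  unfold colorList
  have hinj : Function.Injective fun w : Fin n => (w, c) := fun _ _ h => (Prod.mk.inj h).1
  rw [(List.Nodup.map hinj hl).count]
  congr 1
  simp only [List.mem_map, Prod.mk.injEq, eq_iff_iff]
  constructor
  · rintro ⟨w, hw, rfl, rfl⟩; exact ⟨hw, rfl⟩
  · rintro ⟨h, rfl⟩; exact ⟨v, h, rfl, rfl⟩

/-- A remaining neighbour of `s` receives the new boundary edge either at once in the field (high
degree) or as a pending edge (low degree). Together this is exactly the field produced by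
eliminating `s`. -/
theorem addField_elimField (R : Finset (Fin n)) (F : ColorField n q) (s : Fin n) (c : Fin q)
    (P : List (Fin n × Fin q)) (v : Fin n) (hv : v ∉ insert s R) :
    addField (elimField G low R F s c) (colorList (lowNbrs G low R s) c ++ P) v =
      addNbrs (addField F P) (remNbrs G (insert s R) s) c v := by
  ext c'
  have hvs : v ≠ s := by rintro rfl; simp at hv
  simp only [addField, elimField, addNbrs, hvs, if_false, List.count_append,
    count_colorList (lowNbrs_nodup G low R s), mem_highNbrs, mem_lowNbrs, mem_remNbrs]
  by_cases h1 : G.Adj s v ∧ v ∉ insert s R <;> by_cases h2 : low v <;> by_cases h3 : c' = c <;>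
    simp [h1, h2, h3] <;> omega

/-- The field changes only at `s` and its high-degree neighbours. All of these end up in the
explored block, so the partition function outside it, by which everything is normalised, is
untouched. -/
theorem elimField_of_mem {R B : Finset (Fin n)} (F : ColorField n q) (s : Fin n) (c : Fin q)
    (hs : s ∈ B) (hB : ∀ w ∈ highNbrs G low R s, w ∈ B) (v : Fin n) (hv : v ∉ B) :
    elimField G low R F s c v = F v := by
  ext c'
  have h1 : v ≠ s := by rintro rfl; exact hv hs
  have h2 : v ∉ highNbrs G low R s := fun h => hv (hB v h)
  simp [elimField, h1, h2]

/-- The invariant: the boundary edges at `v` do not outnumber the removed neighbours of `v`. -/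
def DegreeInv (G : SimpleGraph (Fin n)) (R : Finset (Fin n)) (F : ColorField n q) : Prop :=
  ∀ v ∉ R, fieldDeg F v + (remNbrs G R v).card ≤ vdeg G v

theorem DegreeInv.zero (G : SimpleGraph (Fin n)) (R : Finset (Fin n)) :
    DegreeInv G R (0 : ColorField n q) := by
  intro v _
  simp only [fieldDeg, Pi.zero_apply, Finset.sum_const_zero, zero_add, vdeg]
  rw [← SimpleGraph.card_neighborFinset_eq_degree]
  refine Finset.card_le_card fun w hw => ?_
  rw [SimpleGraph.mem_neighborFinset]
  exact (mem_remNbrs.1 hw).1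

theorem DegreeInv.congr {R : Finset (Fin n)} {F F' : ColorField n q} (h : DegreeInv G R F)
    (hF : ∀ v ∉ R, F' v = F v) : DegreeInv G R F' := by
  intro v hv
  have := h v hv
  unfold fieldDeg at *
  rwa [hF v hv]

/-- Removing `s` trades a remaining neighbour for a boundary edge. -/
theorem DegreeInv.addNbrs {R : Finset (Fin n)} {F : ColorField n q} (h : DegreeInv G R F)
    {s : Fin n} (hs : s ∉ R) (c : Fin q) :
    DegreeInv G (insert s R) (addNbrs F (remNbrs G (insert s R) s) c) := by
  intro v hv
  have hvR : v ∉ R := fun h => hv (Finset.mem_insert_of_mem h)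
  have h1 := h v hvR
  have h2 : fieldDeg (_root_.addNbrs F (remNbrs G (insert s R) s) c) v =
      fieldDeg F v + if v ∈ remNbrs G (insert s R) s then 1 else 0 := by
    unfold fieldDeg _root_.addNbrs
    rw [Finset.sum_add_distrib]
    congr 1
    by_cases h : v ∈ remNbrs G (insert s R) s <;> simp [h]
  have h3 : (remNbrs G (insert s R) v).card + (if v ∈ remNbrs G (insert s R) s then 1 else 0) ≤
      (remNbrs G R v).card := by
    split_ifs with hh
    · have h4 : s ∉ remNbrs G (insert s R) v := by simp [mem_remNbrs]
      rw [← Finset.card_insert_of_notMem h4]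
      refine Finset.card_le_card fun w hw => ?_
      rcases Finset.mem_insert.1 hw with rfl | hw
      · exact mem_remNbrs.2 ⟨(mem_remNbrs.1 hh).1.symm, hs⟩
      · have := mem_remNbrs.1 hw
        exact mem_remNbrs.2 ⟨this.1, fun h => this.2 (Finset.mem_insert_of_mem h)⟩
    · rw [add_zero]
      refine Finset.card_le_card fun w hw => ?_
      have := mem_remNbrs.1 hw
      exact mem_remNbrs.2 ⟨this.1, fun h => this.2 (Finset.mem_insert_of_mem h)⟩
  omega

theorem fieldDeg_addOne (F : ColorField n q) (w : Fin n) (c : Fin q) :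
    fieldDeg (addOne F (w, c)) w = fieldDeg F w + 1 := by
  simp [fieldDeg, addOne, Finset.sum_add_distrib]

theorem fieldDeg_le_addField (F : ColorField n q) (P : List (Fin n × Fin q)) (v : Fin n) :
    fieldDeg F v ≤ fieldDeg (addField F P) v :=
  Finset.sum_le_sum fun _ _ => Nat.le_add_right _ _

theorem addField_nil (F : ColorField n q) : addField F [] = F := by
  ext; simp [addField]

theorem DegreeInv.elim {R : Finset (Fin n)} {F : ColorField n q} {P : List (Fin n × Fin q)}
    (h : DegreeInv G R (addField F P)) {s : Fin n} (hs : s ∉ R) (c : Fin q) :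
    DegreeInv G (insert s R)
      (addField (elimField G low R F s c) (colorList (lowNbrs G low R s) c ++ P)) :=
  (h.addNbrs hs c).congr fun v hv => addField_elimField R F s c P v hv

theorem levelSum_nonneg {b : ℝ} (hb : 0 ≤ b)
    {rhat : Finset (Fin n) → ColorField n q → Fin n → Fin q → ℝ}
    (h : ∀ R F w c, 0 ≤ rhat R F w c) (R : Finset (Fin n)) (F : ColorField n q)
    (S : List (Fin n)) (P : List (Fin n × Fin q)) : 0 ≤ levelSum G low b rhat R F S P := by
  refine exploration_induction G low
    (motive := fun R S P => ∀ F, 0 ≤ levelSum G low b rhat R F S P) ?_ ?_ ?_ ?_ R S P F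
  · intro R F; rw [levelSum_nil]; exact zero_le_one
  · intro R p P ih F; rw [levelSum_pending]; exact mul_nonneg (h _ _ _ _) (ih _)
  · intro R s S P hs ih F; rw [levelSum_skip _ _ _ _ _ hs]; exact ih F
  · intro R s S P hs ih F
    rw [levelSum_elim _ _ _ _ _ hs]
    exact Finset.sum_nonneg fun c _ => mul_nonneg (by positivity) (ih c _)

theorem approxRatio_nonneg {b : ℝ} (hb : 0 ≤ b) {ρ : Fin n → ℝ} (hρ : ∀ w, 0 ≤ ρ w) (d : ℕ)
    (R : Finset (Fin n)) (F : ColorField n q)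
    (S : List (Fin n)) (P : List (Fin n × Fin q)) : 0 ≤ approxRatio G low b ρ d R F S P := by
  cases d with
  | zero => exact levelSum_nonneg hb (fun _ _ _ _ => zero_le_one) _ _ _ _
  | succ d => exact levelSum_nonneg hb (fun _ _ w _ => (hρ w).trans (le_max_left _ _)) _ _ _ _

/-- The decay of the error along one level. -/
theorem levelSum_close {b : ℝ} (hb : 0 ≤ b) (hq : 0 < q)
    {rhat : Finset (Fin n) → ColorField n q → Fin n → Fin q → ℝ}
    (hrhat0 : ∀ R F w c, 0 ≤ rhat R F w c) {e Φ : Finset (Fin n) → Fin n → ℝ}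
    (hΦ0 : ∀ R s, 0 ≤ Φ R s)
    (hΦ : ∀ s, Antitone fun R => Φ R s) (he : ∀ s, Antitone fun R => e R s)
    (hrec : ∀ R s, s ∉ R → ((highNbrs G low R s).map (Φ (insert s R))).sum +
      ((lowNbrs G low R s).map (e (insert s R))).sum ≤ Φ R s)
    (hpos : ∀ R (F : ColorField n q) w c, w ∉ R → low w →
      fieldDeg F w + (remNbrs G R w).card + 1 ≤ vdeg G w →
      0 < fieldZ G b R F → 0 < fieldZ G b R (addOne F (w, c)))
    (hrhat : ∀ R F w c, w ∉ R → low w → DegreeInv G R F →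
      fieldDeg F w + (remNbrs G R w).card + 1 ≤ vdeg G w → 0 < fieldZ G b R F →
      RelClose (e R w) (rhat R F w c * fieldZ G b R F) (fieldZ G b R (addOne F (w, c))))
    (R : Finset (Fin n)) (S : List (Fin n)) (P : List (Fin n × Fin q)) (F : ColorField n q)
    (hP : ∀ p ∈ P, low p.1 ∧ p.1 ∉ R ∧ p.1 ∉ S) (hS : ∀ s ∈ S, ¬ low s ∨ S = [s])
    (hinv : DegreeInv G R (addField F P)) (hZ : 0 < fieldZ G b (explored G low R S) F) :
    RelClose ((S.map (Φ R)).sum + (P.map fun p => e R p.1).sum)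
      (levelSum G low b rhat R F S P * fieldZ G b (explored G low R S) F)
      (fieldZ G b R (addField F P)) := by
  revert F
  refine exploration_induction G low (motive := fun R S P =>
    (∀ p ∈ P, low p.1 ∧ p.1 ∉ R ∧ p.1 ∉ S) → (∀ s ∈ S, ¬ low s ∨ S = [s]) →
    ∀ F, DegreeInv G R (addField F P) → 0 < fieldZ G b (explored G low R S) F →
    RelClose ((S.map (Φ R)).sum + (P.map fun p => e R p.1).sum)
      (levelSum G low b rhat R F S P * fieldZ G b (explored G low R S) F)
      (fieldZ G b R (addField F P))) ?_ ?_ ?_ ?_ R S P hP hS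
  · intro R _ _ F _ hZ
    rw [levelSum_nil, addField_nil, explored_nil] at *
    rw [one_mul]
    exact RelClose.refl (by simp) hZ.le
  · intro R p P ih hP _ F hinv hZ
    rw [explored_nil] at *
    rw [addField_cons] at *
    rw [levelSum_pending]
    obtain ⟨hlow, hR, -⟩ := hP p List.mem_cons_self
    -- The pending edge is already counted by the invariant but is not yet in `F`. This spare unit
    -- of degree allows `deg - 1` in place of `deg` in the marginal bound.
    have hdeg : fieldDeg F p.1 + (remNbrs G R p.1).card + 1 ≤ vdeg G p.1 := by
      have h1 := hinv p.1 hR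
      have h2 := fieldDeg_le_addField (addOne F p) P p.1
      have h3 := fieldDeg_addOne F p.1 p.2
      rw [Prod.mk.eta] at h3
      omega
    have hinvF : DegreeInv G R F := by
      intro v hv
      have h1 := hinv v hv
      have h2 := fieldDeg_le_addField (addOne F p) P v
      have h3 : fieldDeg F v ≤ fieldDeg (addOne F p) v :=
        Finset.sum_le_sum fun _ _ => Nat.le_add_right _ _
      omega
    have hZ' := hpos R F p.1 p.2 hR hlow hdeg hZ
    have h1 := hrhat R F p.1 p.2 hR hlow hinvF hdeg hZ
    have h2 := ih (fun p hp => ⟨(hP p (List.mem_cons_of_mem _ hp)).1,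
      (hP p (List.mem_cons_of_mem _ hp)).2.1, by simp⟩) (by simp) (addOne F p) hinv hZ'
    have hl := levelSum_nonneg (G := G) (low := low) hb hrhat0 R (addOne F p) [] P
    have h3 := (h1.mul_left hl).trans h2
    refine (RelClose.mono ?_ (le_of_eq ?_) ?_ (fieldZ_nonneg G hb _ _) (E := e R p.1 +
      ((([] : List (Fin n)).map (Φ R)).sum + (P.map fun p => e R p.1).sum)))
    · convert h3 using 1
      ring
    · simp
    · have := hrhat0 R F p.1 p.2
      positivity
  · intro R s S P hs ih hP hS F hinv hZ
    -- A low-degree vertex is on the stack only as the root of a level, where it is alone; below the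
    -- top all vertices have high degree.
    have hS' : ∀ t ∈ S, ¬ low t := fun t ht => (hS t (List.mem_cons_of_mem _ ht)).resolve_right
      fun h => by
        have : S = [] := (List.cons.inj h).2
        simp [this] at ht
    rw [explored_skip G low hs] at hZ ⊢
    rw [levelSum_skip _ _ _ _ _ hs]
    have h := ih (fun p hp => ⟨(hP p hp).1, (hP p hp).2.1,
      fun h => (hP p hp).2.2 (List.mem_cons_of_mem _ h)⟩)
      (fun t ht => Or.inl (hS' t ht)) F hinv hZ
    refine h.mono ?_ (mul_nonneg (levelSum_nonneg hb hrhat0 _ _ _ _) hZ.le)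
      (fieldZ_nonneg G hb _ _)
    have := hΦ0 R s
    simp only [List.map_cons, List.sum_cons]
    linarith
  · intro R s S P hs ih hP hS F hinv hZ
    have hS' : ∀ t ∈ S, ¬ low t := fun t ht => (hS t (List.mem_cons_of_mem _ ht)).resolve_right
      fun h => by
        have : S = [] := (List.cons.inj h).2
        simp [this] at ht
    rw [explored_elim G low hs] at hZ ⊢
    rw [levelSum_elim _ _ _ _ _ hs, fieldZ_elim G b hq _ hs, Finset.sum_mul]
    set B := explored G low (insert s R) (highNbrs G low R s ++ S) with hB
    have hsub := subset_explored G low (insert s R) (highNbrs G low R s ++ S)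
    rw [← hB] at hsub
    refine RelClose.sum _ fun c _ => ?_
    have hFB : fieldZ G b B (elimField G low R F s c) = fieldZ G b B F :=
      fieldZ_congr G b fun v hv => elimField_of_mem F s c
        (hsub.1 (Finset.mem_insert_self s R))
        (fun w hw => hsub.2 w (List.mem_append_left _ hw)) v hv
    -- Pending edges never sit on stack vertices, so the weight of the colour of `s` is read off the
    -- field alone.
    have hP0 : addField F P s c = F s c := by
      have : P.count (s, c) = 0 := List.count_eq_zero_of_not_mem fun h => by
        have := (hP _ h).2.2
        simp at this
      simp [addField, this]
    have hih := ih c ?_ ?_ (elimField G low R F s c) (hinv.elim hs c) (hFB.symm ▸ hZ)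
    · rw [hP0, mul_assoc]
      refine RelClose.mul_left ?_ (by positivity)
      rw [hFB, fieldZ_congr G b (addField_elimField R F s c P)] at hih
      refine hih.mono ?_ (mul_nonneg (levelSum_nonneg hb hrhat0 _ _ _ _) hZ.le)
        (fieldZ_nonneg G hb _ _)
      -- The error charged to `s` is passed on to its neighbours; the errors charged to the other
      -- entries can only decrease as the removed set grows.
      have h1 := hrec R s hs
      have h2 : (S.map (Φ (insert s R))).sum ≤ (S.map (Φ R)).sum :=
        List.sum_le_sum fun t _ => hΦ t (Finset.subset_insert s R)
      have h3 : (P.map fun p => e (insert s R) p.1).sum ≤ (P.map fun p => e R p.1).sum :=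
        List.sum_le_sum fun p _ => he p.1 (Finset.subset_insert s R)
      have h4 : ((colorList (lowNbrs G low R s) c).map fun p => e (insert s R) p.1) =
          (lowNbrs G low R s).map (e (insert s R)) := by
        simp [colorList, Function.comp_def]
      simp only [List.map_append, List.sum_append, List.map_cons, List.sum_cons, h4]
      linarith
    · intro p hp
      rcases List.mem_append.1 hp with hp | hp
      · obtain ⟨w, hw, rfl⟩ := List.mem_map.1 hp
        have hw' := mem_lowNbrs.1 hw
        refine ⟨hw'.2, hw'.1.2, fun h => ?_⟩
        rcases List.mem_append.1 h with h | h
        · exact (mem_highNbrs.1 h).2 hw'.2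
        · exact hS' w h hw'.2
      · obtain ⟨h1, h2, h3⟩ := hP p hp
        refine ⟨h1, ?_, fun h => ?_⟩
        · rw [Finset.mem_insert]
          rintro (h | h)
          · exact h3 (h ▸ List.mem_cons_self)
          · exact h2 h
        · rcases List.mem_append.1 h with h | h
          · exact (mem_highNbrs.1 h).2 h1
          · exact h3 (List.mem_cons_of_mem _ h)
    · intro t ht
      rcases List.mem_append.1 ht with ht | ht
      · exact Or.inl (mem_highNbrs.1 ht).2
      · exact Or.inl (hS' t ht)

end Recursion

/-! ### Weights of self-avoiding walks that avoid a removed set -/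

section Decay

open scoped Classical

variable {n q : ℕ} {G : SimpleGraph (Fin n)} {low : Fin n → Prop}

/-- The weighted number of self-avoiding walks of length `l` from `s` that avoid `R`. -/
noncomputable def avoidSum (G : SimpleGraph (Fin n)) (δ : Fin n → ℝ) :
    ℕ → Finset (Fin n) → Fin n → ℝ
  | 0, _, _ => 1
  | l + 1, R, s => ∑ w ∈ remNbrs G (insert s R) s, δ w * avoidSum G δ l (insert s R) w

/-- The weighted number of self-avoiding walks of length at least `d` from `s` that avoid `R`. -/
noncomputable def avoidTail (G : SimpleGraph (Fin n)) (δ : Fin n → ℝ) (d : ℕ)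
    (R : Finset (Fin n)) (s : Fin n) : ℝ :=
  ∑ l ∈ Finset.Ico d (Rᶜ.card + 1), avoidSum G δ l R s

theorem remNbrs_subset {R R' : Finset (Fin n)} (h : R ⊆ R') (s : Fin n) :
    remNbrs G R' s ⊆ remNbrs G R s := fun w hw => by
  rw [mem_remNbrs] at *
  exact ⟨hw.1, fun h' => hw.2 (h h')⟩

theorem remNbrs_insert_self (R : Finset (Fin n)) (s : Fin n) :
    remNbrs G (insert s R) s = remNbrs G R s := by
  ext w
  simp only [mem_remNbrs, Finset.mem_insert, not_or]
  exact ⟨fun h => ⟨h.1, h.2.2⟩, fun h => ⟨h.1, h.1.ne', h.2⟩⟩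

variable {δ : Fin n → ℝ} (hδ : ∀ w, 0 ≤ δ w)

include hδ

theorem avoidSum_nonneg (l : ℕ) (R : Finset (Fin n)) (s : Fin n) : 0 ≤ avoidSum G δ l R s := by
  induction l generalizing R s with
  | zero => exact zero_le_one
  | succ l ih => exact Finset.sum_nonneg fun w _ => mul_nonneg (hδ w) (ih _ _)

theorem avoidSum_antitone (l : ℕ) (s : Fin n) : Antitone fun R => avoidSum G δ l R s := by
  induction l generalizing s with
  | zero => exact fun _ _ _ => le_rfl
  | succ l ih =>
    intro R R' h
    have hi := Finset.insert_subset_insert s h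
    refine (Finset.sum_le_sum_of_subset_of_nonneg (remNbrs_subset hi s) fun w _ _ =>
      mul_nonneg (hδ w) (avoidSum_nonneg hδ l _ _)).trans ?_
    exact Finset.sum_le_sum fun w _ => mul_le_mul_of_nonneg_left (ih w hi) (hδ w)

theorem avoidTail_nonneg (d : ℕ) (R : Finset (Fin n)) (s : Fin n) : 0 ≤ avoidTail G δ d R s :=
  Finset.sum_nonneg fun l _ => avoidSum_nonneg hδ l R s

theorem avoidTail_antitone (d : ℕ) (s : Fin n) : Antitone fun R => avoidTail G δ d R s := by
  intro R R' h
  refine (Finset.sum_le_sum fun l _ => avoidSum_antitone hδ l s h).trans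
    (Finset.sum_le_sum_of_subset_of_nonneg (Finset.Ico_subset_Ico_right ?_)
      fun l _ _ => avoidSum_nonneg hδ l R s)
  exact Nat.succ_le_succ (Finset.card_le_card (Finset.compl_subset_compl.2 h))

theorem avoidTail_succ_le (d : ℕ) (R : Finset (Fin n)) (s : Fin n) :
    avoidTail G δ (d + 1) R s ≤ avoidTail G δ d R s :=
  Finset.sum_le_sum_of_subset_of_nonneg (Finset.Ico_subset_Ico_left (Nat.le_succ d))
    fun l _ _ => avoidSum_nonneg hδ l R s

omit hδ in
theorem avoidTail_zero (R : Finset (Fin n)) (s : Fin n) :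
    avoidTail G δ 0 R s = 1 + avoidTail G δ 1 R s := by
  unfold avoidTail
  rw [Finset.sum_eq_sum_Ico_succ_bot (Nat.succ_pos _)]
  rfl

theorem one_le_avoidTail_zero (R : Finset (Fin n)) (s : Fin n) : 1 ≤ avoidTail G δ 0 R s := by
  rw [avoidTail_zero]
  linarith [avoidTail_nonneg (G := G) hδ 1 R s]

-- Splitting off the first step shifts the length by one. Removing `s` also lowers the number of
-- remaining vertices by exactly one, so the upper cut-offs of the two sums match.
omit hδ in
theorem avoidTail_succ (d : ℕ) {R : Finset (Fin n)} {s : Fin n} (hs : s ∉ R) :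
    avoidTail G δ (d + 1) R s =
      ∑ w ∈ remNbrs G (insert s R) s, δ w * avoidTail G δ d (insert s R) w := by
  unfold avoidTail
  have hcard : Rᶜ.card = (insert s R)ᶜ.card + 1 := by
    rw [Finset.card_compl, Finset.card_compl, Finset.card_insert_of_notMem hs]
    have : (insert s R).card ≤ Fintype.card (Fin n) := Finset.card_le_univ _
    rw [Finset.card_insert_of_notMem hs] at this
    omega
  rw [hcard, ← Finset.sum_Ico_add' (fun l => avoidSum G δ l R s) d _ 1]
  simp only [avoidSum, Finset.mul_sum]
  rw [Finset.sum_comm]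

omit hδ in
theorem sum_remNbrs (R : Finset (Fin n)) (s : Fin n) (f : Fin n → ℝ) :
    ∑ w ∈ remNbrs G (insert s R) s, f w =
      ((highNbrs G low R s).map f).sum + ((lowNbrs G low R s).map f).sum := by
  rw [← List.sum_toFinset f (highNbrs_nodup G low R s),
    ← List.sum_toFinset f (lowNbrs_nodup G low R s),
    ← Finset.sum_filter_not_add_sum_filter _ low]
  congr 1
  · refine Finset.sum_congr ?_ fun _ _ => rfl
    ext w
    simp [mem_highNbrs, mem_remNbrs]
  · refine Finset.sum_congr ?_ fun _ _ => rfl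
    ext w
    simp [mem_lowNbrs, mem_remNbrs]

end Decay

/-! ### The error of the recursion, by induction on its depth -/

section DepthInduction

open scoped Classical

variable {n q : ℕ} {G : SimpleGraph (Fin n)} {low : Fin n → Prop}

/-- The hypotheses on the truncation `ρ` and the weight `δ` of the vertices. -/
structure DecayData (G : SimpleGraph (Fin n)) (low : Fin n → Prop) (q : ℕ) (b : ℝ)
    (ρ δ : Fin n → ℝ) (c₀ c₁ : ℝ) : Prop where
  b_nonneg : 0 ≤ b
  b_le_one : b ≤ 1
  q_pos : 0 < q
  ρ_nonneg : ∀ w, 0 ≤ ρ w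
  ρ_le_one : ∀ w, low w → ρ w ≤ 1
  exp_le_ρ : ∀ w, low w → Real.exp (-c₀) ≤ ρ w
  c₀_nonneg : 0 ≤ c₀
  c₁_nonneg : 0 ≤ c₁
  marginal : ∀ w, low w → 1 - b ≤ (1 - ρ w) * (q - (1 - b) * (vdeg G w - 1))
  δ_nonneg : ∀ w, 0 ≤ δ w
  contraction : ∀ w, low w → 2 * (1 - ρ w) ≤ δ w
  δ_high : ∀ w, ¬ low w → δ w = 1
  c₀_le : ∀ w, low w → c₀ ≤ c₁ * δ w

variable {b : ℝ} {ρ δ : Fin n → ℝ} {c₀ c₁ : ℝ} (D : DecayData G low q b ρ δ c₀ c₁)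

/-- The error at a boundary edge. -/
noncomputable def edgeError (G : SimpleGraph (Fin n)) (δ : Fin n → ℝ) (c₀ c₁ : ℝ) :
    ℕ → Finset (Fin n) → Fin n → ℝ
  | 0, _, _ => c₀
  | d + 1, R, w => δ w * (c₁ * avoidTail G δ (d + 1) R w)

include D

theorem edgeError_nonneg (d : ℕ) (R : Finset (Fin n)) (w : Fin n) :
    0 ≤ edgeError G δ c₀ c₁ d R w := by
  cases d with
  | zero => exact D.c₀_nonneg
  | succ d =>
    exact mul_nonneg (D.δ_nonneg w)
      (mul_nonneg D.c₁_nonneg (avoidTail_nonneg D.δ_nonneg _ _ _))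

theorem edgeError_antitone (d : ℕ) (w : Fin n) :
    Antitone fun R => edgeError G δ c₀ c₁ d R w := by
  cases d with
  | zero => exact fun _ _ _ => le_rfl
  | succ d =>
    exact fun R R' h => mul_le_mul_of_nonneg_left
      (mul_le_mul_of_nonneg_left (avoidTail_antitone D.δ_nonneg _ _ h) D.c₁_nonneg) (D.δ_nonneg w)

/-- This is the first-step decomposition of the walk tail. A high-degree neighbour has `δ = 1` and
keeps the depth, so its tail may only get longer. A low-degree neighbour uses up one level and
contributes its factor `δ`; at depth 0 the trivial error `c₀` is paid by `c₁ * δ w` and the walk of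
length 0. -/
theorem nbrs_error_le (d : ℕ) (R : Finset (Fin n)) (s : Fin n) (hs : s ∉ R) :
    ((highNbrs G low R s).map fun w => c₁ * avoidTail G δ (d + 1) (insert s R) w).sum +
      ((lowNbrs G low R s).map (edgeError G δ c₀ c₁ d (insert s R))).sum ≤
    c₁ * avoidTail G δ (d + 1) R s := by
  rw [avoidTail_succ d hs, Finset.mul_sum, sum_remNbrs (low := low)]
  refine add_le_add (List.sum_le_sum fun w hw => ?_) (List.sum_le_sum fun w hw => ?_)
  · rw [D.δ_high w (mem_highNbrs.1 hw).2, one_mul]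
    exact mul_le_mul_of_nonneg_left (avoidTail_succ_le D.δ_nonneg _ _ _) D.c₁_nonneg
  · have hl := (mem_lowNbrs.1 hw).2
    cases d with
    | zero =>
      refine (D.c₀_le w hl).trans (mul_le_mul_of_nonneg_left ?_ D.c₁_nonneg)
      exact le_mul_of_one_le_right (D.δ_nonneg w) (one_le_avoidTail_zero D.δ_nonneg _ _)
    | succ d => exact le_of_eq (by simp only [edgeError]; ring)

theorem marginal_le {R : Finset (Fin n)} {F : ColorField n q} {w : Fin n} (c : Fin q)
    (hw : w ∉ R) (hl : low w) (hdeg : fieldDeg F w + (remNbrs G R w).card + 1 ≤ vdeg G w) :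
    ρ w * fieldZ G b R F ≤ fieldZ G b R (addOne F (w, c)) := by
  refine le_fieldZ_addOne G D.b_nonneg D.b_le_one D.q_pos F hw c (m := vdeg G w - 1) ?_
    (D.ρ_le_one w hl) ?_
  · rw [remNbrs_insert_self]; omega
  · rw [Nat.cast_sub (by omega), Nat.cast_one]
    exact D.marginal w hl

-- `elimField` erases the field at the eliminated vertex. Hence the numerator and the denominator of
-- a ratio rooted at `w` share all values below `w`.
omit D in
theorem elimField_addOne (R : Finset (Fin n)) (F : ColorField n q) (w : Fin n) (c c' : Fin q) :
    elimField G low R (addOne F (w, c)) w c' = elimField G low R F w c' := by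
  ext v c''
  by_cases h : v = w <;> simp [elimField, addOne, h]

omit D in
theorem approxRatio_zero : approxRatio (q := q) G low b ρ 0 =
    levelSum G low b fun _ _ _ _ => 1 := rfl

omit D in
theorem approxRatio_succ (d : ℕ) : approxRatio (q := q) G low b ρ (d + 1) =
    levelSum G low b fun R F w c => max (ρ w)
      (approxRatio G low b ρ d R (addOne F (w, c)) [w] [] / approxRatio G low b ρ d R F [w] []) :=
  rfl

omit D in
theorem approxRatio_elim (d : ℕ) {R : Finset (Fin n)} (F : ColorField n q) {s : Fin n}
    (hs : s ∉ R) (S : List (Fin n)) (P : List (Fin n × Fin q)) :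
    approxRatio G low b ρ d R F (s :: S) P = ∑ c : Fin q, b ^ F s c *
      approxRatio G low b ρ d (insert s R) (elimField G low R F s c)
        (highNbrs G low R s ++ S) (colorList (lowNbrs G low R s) c ++ P) := by
  cases d with
  | zero => rw [approxRatio_zero, levelSum_elim _ _ _ _ _ hs]
  | succ d => rw [approxRatio_succ, levelSum_elim _ _ _ _ _ hs]

omit D in
theorem approxRatio_skip (d : ℕ) {R : Finset (Fin n)} (F : ColorField n q) {s : Fin n}
    (hs : s ∈ R) (S : List (Fin n)) (P : List (Fin n × Fin q)) :
    approxRatio G low b ρ d R F (s :: S) P = approxRatio G low b ρ d R F S P := by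
  cases d with
  | zero => rw [approxRatio_zero, levelSum_skip _ _ _ _ _ hs]
  | succ d => rw [approxRatio_succ, levelSum_skip _ _ _ _ _ hs]

/-- The accuracy of the recursion of depth `d`. -/
theorem approxRatio_close (d : ℕ) (R : Finset (Fin n)) (S : List (Fin n))
    (P : List (Fin n × Fin q)) (F : ColorField n q)
    (hP : ∀ p ∈ P, low p.1 ∧ p.1 ∉ R ∧ p.1 ∉ S) (hS : ∀ s ∈ S, ¬ low s ∨ S = [s])
    (hinv : DegreeInv G R (addField F P)) (hZ : 0 < fieldZ G b (explored G low R S) F) :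
    RelClose ((S.map fun s => c₁ * avoidTail G δ (d + 1) R s).sum +
        (P.map fun p => edgeError G δ c₀ c₁ d R p.1).sum)
      (approxRatio G low b ρ d R F S P * fieldZ G b (explored G low R S) F)
      (fieldZ G b R (addField F P)) := by
  have hexp : 0 < Real.exp (-c₀) := Real.exp_pos _
  have hpos : ∀ R (F : ColorField n q) w c, w ∉ R → low w →
      fieldDeg F w + (remNbrs G R w).card + 1 ≤ vdeg G w →
      0 < fieldZ G b R F → 0 < fieldZ G b R (addOne F (w, c)) :=
    fun R F w c hw hl hdeg h => (mul_pos (hexp.trans_le (D.exp_le_ρ w hl)) h).trans_le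
      (marginal_le D c hw hl hdeg)
  induction d generalizing R S P F with
  | zero =>
    rw [approxRatio_zero]
    refine levelSum_close (e := edgeError G δ c₀ c₁ 0)
      (Φ := fun R s => c₁ * avoidTail G δ (0 + 1) R s) D.b_nonneg D.q_pos
      (fun _ _ _ _ => zero_le_one)
      (fun R s => mul_nonneg D.c₁_nonneg (avoidTail_nonneg D.δ_nonneg _ _ _))
      (fun s R R' h => mul_le_mul_of_nonneg_left (avoidTail_antitone D.δ_nonneg _ _ h)
        D.c₁_nonneg) (fun w => edgeError_antitone D 0 w)
      (fun R s hs => nbrs_error_le D 0 R s hs) hpos ?_ R S P F hP hS hinv hZ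
    -- At depth 0 the ratio is estimated by 1, while the true value lies between `ρ w`, hence `exp
    -- (-c₀)`, and 1.
    intro R F w c hw hl _ hdeg hZ
    have h1 := marginal_le D c hw hl hdeg
    have h2 := mul_le_mul_of_nonneg_right (D.exp_le_ρ w hl) hZ.le
    rw [one_mul]
    constructor
    · simp only [edgeError]
      rw [← div_le_iff₀' (Real.exp_pos _), div_eq_inv_mul, ← Real.exp_neg]
      exact h2.trans h1
    · exact (fieldZ_addOne_le G D.b_nonneg D.b_le_one D.q_pos F hw c).trans
        (le_mul_of_one_le_left hZ.le (Real.one_le_exp D.c₀_nonneg))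
  | succ d ih =>
    rw [approxRatio_succ]
    refine levelSum_close (e := edgeError G δ c₀ c₁ (d + 1))
      (Φ := fun R s => c₁ * avoidTail G δ (d + 1 + 1) R s) D.b_nonneg D.q_pos
      (fun _ _ w _ => (D.ρ_nonneg w).trans (le_max_left _ _))
      (fun R s => mul_nonneg D.c₁_nonneg (avoidTail_nonneg D.δ_nonneg _ _ _))
      (fun s R R' h => mul_le_mul_of_nonneg_left (avoidTail_antitone D.δ_nonneg _ _ h)
        D.c₁_nonneg) (fun w => edgeError_antitone D (d + 1) w)
      (fun R s hs => nbrs_error_le D (d + 1) R s hs) hpos ?_ R S P F hP hS hinv hZ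
    intro R F w c hw hl hinv hdeg hZ
    -- Both recursive calls start by eliminating `w` and then use the same values `t`; they differ
    -- only in the power of `b` attached to the colour `c`.
    set t : Fin q → ℝ := fun c' => approxRatio G low b ρ d (insert w R) (elimField G low R F w c')
      (highNbrs G low R w ++ []) (colorList (lowNbrs G low R w) c' ++ [])
    have hden : approxRatio G low b ρ d R F [w] [] = ∑ c', b ^ F w c' * t c' := by
      simp only [t]
      rw [approxRatio_elim _ _ hw]
    have hnum : approxRatio G low b ρ d R (addOne F (w, c)) [w] [] =
        ∑ c', b ^ addOne F (w, c) w c' * t c' := by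
      simp only [t]
      rw [approxRatio_elim _ _ hw]
      simp_rw [elimField_addOne]
    set Z : Fin q → ℝ := fun c' =>
      fieldZ G b (insert w R) (addNbrs F (remNbrs G (insert w R) w) c')
    set B := explored G low (insert w R) (highNbrs G low R w ++ []) with hB
    have hsub := subset_explored G low (insert w R) (highNbrs G low R w ++ [])
    rw [← hB] at hsub
    have hRB : R ⊆ B := (Finset.subset_insert w R).trans hsub.1
    have hZB : 0 < fieldZ G b B F := fieldZ_pos_of_subset G D.b_nonneg D.b_le_one D.q_pos hRB hZ
    have ht0 : ∀ c', 0 ≤ t c' := fun c' => approxRatio_nonneg D.b_nonneg D.ρ_nonneg _ _ _ _ _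
    have hZ0 : ∀ c', 0 ≤ Z c' := fun c' => fieldZ_nonneg G D.b_nonneg _ _
    have hE0 : 0 ≤ c₁ * avoidTail G δ (d + 1) R w :=
      mul_nonneg D.c₁_nonneg (avoidTail_nonneg D.δ_nonneg _ _ _)
    have hclose : ∀ c', RelClose (c₁ * avoidTail G δ (d + 1) R w) (t c' * fieldZ G b B F)
        (Z c') := by
      intro c'
      have hFB : fieldZ G b B (elimField G low R F w c') = fieldZ G b B F :=
        fieldZ_congr G b fun v hv => elimField_of_mem F w c'
          (hsub.1 (Finset.mem_insert_self w R))
          (fun w hw => hsub.2 w (List.mem_append_left _ hw)) v hv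
      have h := ih (insert w R) (highNbrs G low R w ++ [])
        (colorList (lowNbrs G low R w) c' ++ []) (elimField G low R F w c') ?_ ?_ ?_ ?_
      · rw [← hB, hFB, fieldZ_congr G b (addField_elimField R F w c' []), addField_nil] at h
        refine h.mono ?_ (mul_nonneg (ht0 c') hZB.le) (hZ0 c')
        refine le_trans (le_of_eq ?_) (nbrs_error_le D d R w hw)
        simp [colorList, Function.comp_def]
      · intro p hp
        rw [List.append_nil] at hp ⊢
        obtain ⟨v, hv, rfl⟩ := List.mem_map.1 hp
        have hv' := mem_lowNbrs.1 hv
        exact ⟨hv'.2, hv'.1.2, fun h => (mem_highNbrs.1 h).2 hv'.2⟩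
      · intro s hs
        rw [List.append_nil] at hs
        exact Or.inl (mem_highNbrs.1 hs).2
      · exact DegreeInv.elim (by rwa [addField_nil]) hw c'
      · rw [← hB, hFB]; exact hZB
    -- With `x` the weight of the colour `c` at `w` and `A` the weight of the others, the ratio is
    -- `(b * x + A) / (x + A)`; the primed quantities are the approximations, rescaled by the common
    -- factor of the outer graph.
    set x := b ^ F w c * Z c with hx
    set A := ∑ c' ∈ Finset.univ.erase c, b ^ F w c' * Z c' with hA
    set x' := b ^ F w c * (t c * fieldZ G b B F) with hx'
    set A' := ∑ c' ∈ Finset.univ.erase c, b ^ F w c' * (t c' * fieldZ G b B F) with hA'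
    have hb := D.b_nonneg
    have hx0 : 0 ≤ x := by have := hZ0 c; positivity
    have hA0 : 0 ≤ A := Finset.sum_nonneg fun c' _ => by have := hZ0 c'; positivity
    have hx'0 : 0 ≤ x' := by have := ht0 c; positivity
    have hA'0 : 0 ≤ A' := Finset.sum_nonneg fun c' _ => by have := ht0 c'; positivity
    have hadd : addOne F (w, c) w c = F w c + 1 := by simp [addOne]
    have hadd' : ∀ c' ∈ Finset.univ.erase c, addOne F (w, c) w c' = F w c' := fun c' hc' => by
      simp [addOne, Finset.ne_of_mem_erase hc']
    have e1 : fieldZ G b R F = x + A := by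
      rw [fieldZ_elim G b D.q_pos F hw, ← Finset.add_sum_erase _ _ (Finset.mem_univ c)]
    have e2 : fieldZ G b R (addOne F (w, c)) = b * x + A := by
      rw [fieldZ_addOne G b D.q_pos F hw, e1]
      ring
    have e3 : approxRatio G low b ρ d R F [w] [] * fieldZ G b B F = x' + A' := by
      rw [hden, ← Finset.add_sum_erase _ _ (Finset.mem_univ c), add_mul, Finset.sum_mul, hx', hA',
        mul_assoc]
      congr 1
      exact Finset.sum_congr rfl fun c' _ => mul_assoc _ _ _
    have e4 : approxRatio G low b ρ d R (addOne F (w, c)) [w] [] * fieldZ G b B F =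
        b * x' + A' := by
      rw [hnum, ← Finset.add_sum_erase _ _ (Finset.mem_univ c), add_mul, Finset.sum_mul, hx', hA',
        hadd, pow_succ]
      congr 1
      · ring
      · exact Finset.sum_congr rfl fun c' hc' => by rw [hadd' c' hc', mul_assoc]
    have hmain := RelClose.max_ratio D.b_nonneg D.b_le_one (D.ρ_le_one w hl) hE0 hx0 hA0 hx'0 hA'0
      (e1 ▸ hZ) ((hclose c).mul_left (by positivity))
      (RelClose.sum _ fun c' _ => (hclose c').mul_left (by positivity))
      (by rw [← e1, ← e2]; exact marginal_le D c hw hl hdeg)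
    have hratio : approxRatio G low b ρ d R (addOne F (w, c)) [w] [] /
        approxRatio G low b ρ d R F [w] [] = (b * x' + A') / (x' + A') := by
      rw [← e3, ← e4, mul_div_mul_right _ _ hZB.ne']
    rw [hratio]
    have h2 := hmain.mul_left hZ.le
    rw [← e2, ← e1, mul_div_cancel₀ _ hZ.ne',
      mul_comm (fieldZ G b R F) (max _ _)] at h2
    have hmax0 : 0 ≤ max (ρ w) ((b * x' + A') / (x' + A')) :=
      (D.ρ_nonneg w).trans (le_max_left _ _)
    refine h2.mono ?_ (mul_nonneg hmax0 hZ.le) (fieldZ_nonneg G hb _ _)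
    exact mul_le_mul_of_nonneg_right (D.contraction w hl) hE0

/-- The quotient that approximates `Z(R) / Z(R ∪ {v})`. -/
noncomputable def vertexFactor (q : ℕ) (G : SimpleGraph (Fin n)) (low : Fin n → Prop) (b : ℝ)
    (ρ : Fin n → ℝ) (d : ℕ) (R : Finset (Fin n)) (v : Fin n) : ℝ :=
  approxRatio (q := q) G low b ρ d R 0 [v] [] /
    approxRatio (q := q) G low b ρ d (insert v R) 0 (highNbrs G low R v) []

/-- Exploring from `v` first eliminates `v` and then explores from its high-degree neighbours. So
numerator and denominator are normalised by the same outer partition function, which cancels, and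
their errors add. Closeness to a positive number also shows that the approximate denominator is
positive, even for `b = 0`. -/
theorem vertexFactor_close (d : ℕ) {R : Finset (Fin n)} {v : Fin n} (hv : v ∉ R)
    (hZ : 0 < fieldZ G b R (0 : ColorField n q)) :
    0 < approxRatio G low b ρ d (insert v R) (0 : ColorField n q) (highNbrs G low R v) [] ∧
    RelClose (2 * (c₁ * avoidTail G δ (d + 1) ∅ v))
      (vertexFactor q G low b ρ d R v * fieldZ G b (insert v R) (0 : ColorField n q))
      (fieldZ G b R (0 : ColorField n q)) := by
  set B := explored G low R [v] with hB
  have hB' : explored G low (insert v R) (highNbrs G low R v) = B := by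
    rw [hB, explored_elim _ _ hv, List.append_nil]
  have hRB : R ⊆ B := (subset_explored G low R [v]).1
  have hZB := fieldZ_pos_of_subset G D.b_nonneg D.b_le_one D.q_pos hRB hZ
  have hZv := fieldZ_pos_of_subset G D.b_nonneg D.b_le_one D.q_pos (Finset.subset_insert v R) hZ
  have h1 := approxRatio_close D d R [v] [] (0 : ColorField n q) (by simp)
    (fun s hs => Or.inr (by rw [List.mem_singleton.1 hs])) (by
      rw [addField_nil]; exact DegreeInv.zero G R) hZB
  have h2 := approxRatio_close D d (insert v R) (highNbrs G low R v) [] (0 : ColorField n q)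
    (by simp) (fun s hs => Or.inl (mem_highNbrs.1 hs).2) (by
      rw [addField_nil]; exact DegreeInv.zero G _) (hB'.symm ▸ hZB)
  rw [addField_nil, hB'] at h2
  rw [addField_nil, ← hB] at h1
  set X := approxRatio G low b ρ d R (0 : ColorField n q) [v] [] with hX
  set Y := approxRatio G low b ρ d (insert v R) (0 : ColorField n q) (highNbrs G low R v) []
  set ZB := fieldZ G b B (0 : ColorField n q)
  set T := c₁ * avoidTail G δ (d + 1) ∅ v
  have hT : c₁ * avoidTail G δ (d + 1) R v ≤ T :=
    mul_le_mul_of_nonneg_left (avoidTail_antitone D.δ_nonneg _ _ (Finset.empty_subset R))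
      D.c₁_nonneg
  have hX0 : 0 ≤ X := approxRatio_nonneg D.b_nonneg D.ρ_nonneg _ _ _ _ _
  have hY0 : 0 ≤ Y := approxRatio_nonneg D.b_nonneg D.ρ_nonneg _ _ _ _ _
  have h1' := h1.mono (E' := T) (by simpa using hT) (by positivity) hZ.le
  have h2' := h2.mono (E' := T) (by
    have := nbrs_error_le D d R v hv
    have h0 : 0 ≤ ((lowNbrs G low R v).map (edgeError G δ c₀ c₁ d (insert v R))).sum :=
      List.sum_nonneg fun x hx => by
        obtain ⟨w, -, rfl⟩ := List.mem_map.1 hx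
        exact edgeError_nonneg D _ _ _
    simp only [List.map_nil, List.sum_nil, add_zero]
    linarith) (by positivity) hZv.le
  have hYZ : 0 < Y * ZB := pos_of_mul_pos_right (hZv.trans_le h2'.2) (Real.exp_pos _).le
  have hYpos : 0 < Y := pos_of_mul_pos_left hYZ hZB.le
  refine ⟨hYpos, ?_⟩
  have hV : vertexFactor q G low b ρ d R v = X / Y := rfl
  rw [hV, two_mul]
  have h3 := (h2'.symm.mul_left (div_nonneg hX0 hY0)).trans (z := fieldZ G b R 0) (E' := T) (by
    convert h1' using 1
    field_simp)
  exact h3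

/-- The product of the approximations of `Z(R) / Z(R ∪ {v})` along the list `l`. -/
noncomputable def factorProd (q : ℕ) (G : SimpleGraph (Fin n)) (low : Fin n → Prop) (b : ℝ)
    (ρ : Fin n → ℝ) (d : ℕ) : Finset (Fin n) → List (Fin n) → ℝ
  | _, [] => 1
  | R, v :: l => vertexFactor q G low b ρ d R v * factorProd q G low b ρ d (insert v R) l

/-- The quotients telescope down to the graph with all vertices removed, whose normalised partition
function is 1. -/
theorem factorProd_close (d : ℕ) (l : List (Fin n)) (R : Finset (Fin n)) (hl : l.Nodup)
    (hR : ∀ v, v ∉ R ↔ v ∈ l) (hZ : 0 < fieldZ G b R (0 : ColorField n q)) :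
    RelClose (l.map fun v => 2 * (c₁ * avoidTail G δ (d + 1) ∅ v)).sum
      (factorProd q G low b ρ d R l) (fieldZ G b R (0 : ColorField n q)) := by
  induction l generalizing R with
  | nil =>
    have : R = Finset.univ := by
      ext v
      have := hR v
      simp at this
      simp [this]
    rw [this, fieldZ_univ G b D.q_pos]
    exact RelClose.refl (by simp) zero_le_one
  | cons v l ih =>
    have hv : v ∉ R := (hR v).2 List.mem_cons_self
    have hnd := List.nodup_cons.1 hl
    obtain ⟨-, h1⟩ := vertexFactor_close D d hv hZ
    have hZv := fieldZ_pos_of_subset G D.b_nonneg D.b_le_one D.q_pos (Finset.subset_insert v R) hZ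
    have h2 := ih (insert v R) hnd.2 (fun u => by
      have := hR u
      rw [List.mem_cons] at this
      rw [Finset.mem_insert, not_or, this]
      constructor
      · rintro ⟨h1, h2⟩; exact h2.resolve_left h1
      · intro h; exact ⟨by rintro rfl; exact hnd.1 h, Or.inr h⟩) hZv
    have h0 : 0 ≤ vertexFactor q G low b ρ d R v := div_nonneg
      (approxRatio_nonneg D.b_nonneg D.ρ_nonneg _ _ _ _ _)
      (approxRatio_nonneg D.b_nonneg D.ρ_nonneg _ _ _ _ _)
    have h3 := (h2.mul_left h0).trans h1
    rw [List.map_cons, List.sum_cons, add_comm]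
    exact h3

omit D in
/-- A ratio whose denominator vanishes has numerator zero. -/
theorem approxRatio_addOne_le (hb0 : 0 ≤ b) (hb1 : b ≤ 1) (hρ : ∀ w, 0 ≤ ρ w) (d : ℕ)
    (R : Finset (Fin n)) (F : ColorField n q) (w : Fin n)
    (c : Fin q) :
    approxRatio G low b ρ d R (addOne F (w, c)) [w] [] ≤ approxRatio G low b ρ d R F [w] [] ∨
      w ∈ R := by
  by_cases hw : w ∈ R
  · exact Or.inr hw
  left
  rw [approxRatio_elim _ _ hw, approxRatio_elim _ _ hw]
  simp_rw [elimField_addOne]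
  refine Finset.sum_le_sum fun c' _ => mul_le_mul_of_nonneg_right
    (pow_le_pow_of_le_one hb0 hb1 (Nat.le_add_right _ _))
    (approxRatio_nonneg hb0 hρ _ _ _ _ _)

end DepthInduction


/-! ### Recursive walk weights as sums over paths -/

section SelfAvoiding

open scoped Classical

variable {n : ℕ} {G : SimpleGraph (Fin n)}

/-- The weight of a walk: the product over all its vertices but the first. -/
noncomputable def walkWeight (δ : Fin n → ℝ) {u v : Fin n} (p : G.Walk u v) : ℝ :=
  (p.support.tail.map δ).prod

theorem sum_finsetWalkLength_succ (l : ℕ) (u v : Fin n) (f : G.Walk u v → ℝ) :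
    ∑ p ∈ G.finsetWalkLength (l + 1) u v, f p =
      ∑ w : G.neighborSet u, ∑ p ∈ G.finsetWalkLength l w v,
        f (.cons ((G.mem_neighborSet u w).1 w.2) p) := by
  rw [SimpleGraph.finsetWalkLength, Finset.sum_biUnion]
  · refine Finset.sum_congr rfl fun w _ => ?_
    rw [Finset.sum_map]
    rfl
  · intro w _ w' _ hne
    rw [Function.onFun, Finset.disjoint_left]
    intro p hp hp'
    obtain ⟨a, -, rfl⟩ := Finset.mem_map.1 hp
    obtain ⟨b, -, h⟩ := Finset.mem_map.1 hp'
    have h' : SimpleGraph.Walk.cons ((G.mem_neighborSet u w').1 w'.2) b =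
      SimpleGraph.Walk.cons ((G.mem_neighborSet u w).1 w.2) a := h
    injection h' with _ h1
    exact hne (Subtype.ext h1.symm)

/-- Self-avoiding walks of length `l` from `s` outside `R`. -/
def SelfAvoidsOutside (R : Finset (Fin n)) {s v : Fin n} (p : G.Walk s v) : Prop :=
  p.IsPath ∧ ∀ x ∈ p.support, x ∉ R

/-- After the first step, avoiding `R` and `s` encodes both the constraint `R` and the condition
that the walk never returns to `s`. -/
theorem avoidSum_eq_sum_walks (δ : Fin n → ℝ) (l : ℕ) (R : Finset (Fin n)) (s : Fin n)
    (hs : s ∉ R) : avoidSum G δ l R s =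
      ∑ v : Fin n, ∑ p ∈ G.finsetWalkLength l s v with SelfAvoidsOutside R p, walkWeight δ p := by
  induction l generalizing R s with
  | zero =>
    rw [Finset.sum_eq_single s]
    · have : (G.finsetWalkLength 0 s s).filter (SelfAvoidsOutside R) =
          {SimpleGraph.Walk.nil} := by
        ext p
        simp only [Finset.mem_filter, SimpleGraph.mem_finsetWalkLength_iff, Finset.mem_singleton]
        constructor
        · rintro ⟨h, -⟩
          exact (SimpleGraph.Walk.eq_nil_iff_nil).2 (SimpleGraph.Walk.length_eq_zero_iff.1 h)
        · rintro rfl; exact ⟨rfl, by simp [SelfAvoidsOutside, hs]⟩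
      rw [this]
      simp [avoidSum, walkWeight]
    · intro v _ hv
      rw [Finset.sum_eq_zero]
      intro p hp
      have := SimpleGraph.mem_finsetWalkLength_iff.1 (Finset.mem_filter.1 hp).1
      exact absurd (SimpleGraph.Walk.eq_of_length_eq_zero this).symm hv
    · simp
  | succ l ih =>
    have h1 : ∀ v, ∑ p ∈ G.finsetWalkLength (l + 1) s v with SelfAvoidsOutside R p, walkWeight δ p =
        ∑ w : G.neighborSet s, ∑ p ∈ G.finsetWalkLength l w v,
          if (w : Fin n) ∉ R ∧ SelfAvoidsOutside (insert s R) p then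
            δ w * walkWeight δ p else 0 := by
      intro v
      rw [Finset.sum_filter, sum_finsetWalkLength_succ]
      refine Finset.sum_congr rfl fun w _ => Finset.sum_congr rfl fun p _ => ?_
      have hw : walkWeight δ (.cons ((G.mem_neighborSet s w).1 w.2) p) = δ w * walkWeight δ p := by
        unfold walkWeight
        rw [SimpleGraph.Walk.support_cons, List.tail_cons, ← SimpleGraph.Walk.cons_tail_support p,
          List.tail_cons, List.map_cons, List.prod_cons]
      rw [hw]
      refine if_congr ?_ rfl rfl
      unfold SelfAvoidsOutside
      rw [SimpleGraph.Walk.cons_isPath_iff, SimpleGraph.Walk.support_cons]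
      simp only [List.mem_cons, forall_eq_or_imp, Finset.mem_insert, not_or]
      constructor
      · rintro ⟨⟨h1, h2⟩, h3, h4⟩
        exact ⟨h4 _ p.start_mem_support, h1, fun x hx => ⟨by rintro rfl; exact h2 hx, h4 x hx⟩⟩
      · rintro ⟨h1, h2, h3⟩
        exact ⟨⟨h2, fun h => (h3 s h).1 rfl⟩, hs, fun x hx => (h3 x hx).2⟩
    simp_rw [h1]
    rw [Finset.sum_comm]
    have h2 : ∀ w : G.neighborSet s, (∑ v : Fin n, ∑ p ∈ G.finsetWalkLength l w v,
        if (w : Fin n) ∉ R ∧ SelfAvoidsOutside (insert s R) p then δ w * walkWeight δ p else 0) =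
        if (w : Fin n) ∉ R then δ w * avoidSum G δ l (insert s R) w else 0 := by
      intro w
      by_cases hw : (w : Fin n) ∉ R
      · rw [if_pos hw]
        have hw' : (w : Fin n) ∉ insert s R := by
          rw [Finset.mem_insert, not_or]
          exact ⟨(G.ne_of_adj w.2).symm, hw⟩
        rw [ih _ _ hw', Finset.mul_sum]
        refine Finset.sum_congr rfl fun v _ => ?_
        rw [Finset.mul_sum, Finset.sum_filter]
        exact Finset.sum_congr rfl fun p _ => by simp [hw]
      · simp [hw]
    simp_rw [h2]
    rw [avoidSum]
    have h3 : remNbrs G (insert s R) s = (G.neighborSet s).toFinset.filter (· ∉ R) := by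
      ext w
      simp [remNbrs_insert_self, mem_remNbrs]
    rw [h3, Finset.sum_filter, ← Finset.sum_coe_sort]
    refine Fintype.sum_equiv (Equiv.subtypeEquivRight fun w => by simp) _ _ fun w => ?_
    rfl

theorem sawSum_eq (δ : ℕ → ℝ) (l : ℕ) (v : Fin n) : sawSum G δ v l =
    ∑ u : Fin n, ∑ p ∈ G.finsetWalkLength l v u with p.IsPath,
      walkWeight (fun w => δ (vdeg G w)) p := by
  unfold sawSum
  congr!

theorem avoidSum_empty_eq_sawSum (δ : ℕ → ℝ) (l : ℕ) (v : Fin n) :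
    avoidSum G (fun w => δ (vdeg G w)) l ∅ v = sawSum G δ v l := by
  rw [avoidSum_eq_sum_walks _ _ _ _ (by simp), sawSum_eq]
  refine Finset.sum_congr rfl fun u _ => Finset.sum_congr ?_ fun p _ => rfl
  ext p
  simp [SelfAvoidsOutside]

/-- A path is a single nonnegative term of the sum. Thus the contraction hypothesis bounds the
weight of each individual path, and later its length. -/
theorem walkWeight_le_sawSum (δ : ℕ → ℝ) (hδ : ∀ d, 0 ≤ δ d) {u v : Fin n} (p : G.Walk u v)
    (hp : p.IsPath) : walkWeight (fun w => δ (vdeg G w)) p ≤ sawSum G δ u p.length := by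
  have h0 : ∀ (v : Fin n) (p : G.Walk u v), 0 ≤ walkWeight (fun w => δ (vdeg G w)) p :=
    fun v p => List.prod_nonneg fun x hx => by
      obtain ⟨w, -, rfl⟩ := List.mem_map.1 hx
      exact hδ _
  rw [sawSum_eq]
  refine le_trans ?_ (Finset.single_le_sum (fun v _ => Finset.sum_nonneg fun p _ => h0 v p)
    (Finset.mem_univ v))
  exact Finset.single_le_sum (f := fun p : G.Walk u v => walkWeight (fun w => δ (vdeg G w)) p)
    (fun p _ => h0 v p)
    (Finset.mem_filter.2 ⟨SimpleGraph.mem_finsetWalkLength_iff.2 rfl, hp⟩)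

end SelfAvoiding

/-! ### The number of nodes of the recursion -/

section Cost

open scoped Classical

variable {n : ℕ} (G : SimpleGraph (Fin n)) (low : Fin n → Prop)

/-- The cost of one level of the recursion, if `rc` is the cost of the ratios. -/
noncomputable def levelCost (q : ℕ) (rc : Finset (Fin n) → Fin n → ℕ) :
    Finset (Fin n) → List (Fin n) → List (Fin n) → ℕ
  | _, [], [] => 1
  | R, [], w :: P => 1 + rc R w + levelCost q rc R [] P
  | R, s :: S, P =>
    if _h : s ∈ R then 1 + levelCost q rc R S P
    else 1 + q * (1 + levelCost q rc (insert s R) (highNbrs G low R s ++ S)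
      (lowNbrs G low R s ++ P))
termination_by R S P => (Rᶜ.card, S.length, P.length)
decreasing_by
  · exact Prod.Lex.right _ (Prod.Lex.right _ (by simp))
  · exact Prod.Lex.right _ (Prod.Lex.left _ _ (by simp))
  · exact Prod.Lex.left _ _ (card_compl_insert_lt ‹_›)

/-- The cost of the recursion of depth `d`. -/
noncomputable def recCost (q : ℕ) : ℕ → Finset (Fin n) → List (Fin n) → List (Fin n) → ℕ
  | 0 => levelCost G low q fun _ _ => 0
  | d + 1 => levelCost G low q fun R w => 2 * recCost q d R [w] []

variable {G low} {q : ℕ}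

/-- The costs of the ratio of a boundary edge. -/
noncomputable def edgeCost (G : SimpleGraph (Fin n)) (low : Fin n → Prop) (q : ℕ) :
    ℕ → Finset (Fin n) → Fin n → ℕ
  | 0, _, _ => 0
  | d + 1, R, w => 2 * recCost G low q d R [w] []

theorem recCost_eq_levelCost (d : ℕ) :
    recCost G low q d = levelCost G low q (edgeCost G low q d) := by
  cases d <;> rfl

theorem recCost_nil (d : ℕ) (R : Finset (Fin n)) : recCost G low q d R [] [] = 1 := by
  rw [recCost_eq_levelCost, levelCost]

theorem recCost_pending (d : ℕ) (R : Finset (Fin n)) (w : Fin n) (P : List (Fin n)) :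
    recCost G low q d R [] (w :: P) =
      1 + edgeCost G low q d R w + recCost G low q d R [] P := by
  rw [recCost_eq_levelCost, levelCost]

theorem recCost_skip (d : ℕ) {R : Finset (Fin n)} {s : Fin n} (hs : s ∈ R)
    (S P : List (Fin n)) :
    recCost G low q d R (s :: S) P = 1 + recCost G low q d R S P := by
  rw [recCost_eq_levelCost, levelCost, dif_pos hs]

theorem recCost_elim (d : ℕ) {R : Finset (Fin n)} {s : Fin n} (hs : s ∉ R)
    (S P : List (Fin n)) :
    recCost G low q d R (s :: S) P = 1 + q * (1 + recCost G low q d (insert s R)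
      (highNbrs G low R s ++ S) (lowNbrs G low R s ++ P)) := by
  rw [recCost_eq_levelCost, levelCost, dif_neg hs]

theorem one_le_recCost (d : ℕ) (R : Finset (Fin n)) (S P : List (Fin n)) :
    1 ≤ recCost G low q d R S P := by
  rcases S with _ | ⟨s, S⟩
  · rcases P with _ | ⟨w, P⟩
    · rw [recCost_nil]
    · rw [recCost_pending]; omega
  · by_cases h : s ∈ R
    · rw [recCost_skip d h]; omega
    · rw [recCost_elim d h]; omega

variable {β : ℝ}

theorem permissiveBlock_mono {S T : Set (Fin n)} (h : S ⊆ T) :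
    permissiveBlock q β G S ⊆ permissiveBlock q β G T :=
  (permissiveBlock_isLeast q β G S).2 ⟨h.trans (permissiveBlock_isLeast q β G T).1.1,
    (permissiveBlock_isLeast q β G T).1.2⟩

theorem subset_permissiveBlock (S : Set (Fin n)) : S ⊆ permissiveBlock q β G S :=
  (permissiveBlock_isLeast q β G S).1.1

/-- The vertex `s` is the end of a path from `v₀` through `T` with few low-degree vertices. -/
def ReachedBy (G : SimpleGraph (Fin n)) (q : ℕ) (β : ℝ) (v₀ : Fin n) (m : ℕ) (T : Set (Fin n))
    (R : Finset (Fin n)) (s : Fin n) : Prop :=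
  ∃ p : G.Walk v₀ s, p.IsPath ∧ (∀ x ∈ p.support, x = s ∨ x ∈ R) ∧ (∀ x ∈ T, x ∈ p.support) ∧
    (p.support.tail.countP fun w => IsLowDegree q β G w) ≤ m

theorem ReachedBy.mono {v₀ : Fin n} {m : ℕ} {T : Set (Fin n)} {R R' : Finset (Fin n)} {s : Fin n}
    (h : ReachedBy G q β v₀ m T R s) (hR : R ⊆ R') : ReachedBy G q β v₀ m T R' s := by
  obtain ⟨p, h1, h2, h3, h4⟩ := h
  exact ⟨p, h1, fun x hx => (h2 x hx).imp_right fun h => hR h, h3, h4⟩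

theorem ReachedBy.concat {v₀ : Fin n} {m m' : ℕ} {T : Set (Fin n)} {R : Finset (Fin n)}
    {s w : Fin n} (h : ReachedBy G q β v₀ m T R s) (hsw : G.Adj s w) (hw : w ∉ insert s R)
    (hm : m + (if IsLowDegree q β G w then 1 else 0) ≤ m') :
    ReachedBy G q β v₀ m' T (insert s R) w := by
  obtain ⟨p, h1, h2, h3, h4⟩ := h
  have hsub : ∀ x ∈ p.support, x ∈ insert s R := fun x hx => by
    rcases h2 x hx with rfl | h
    · exact Finset.mem_insert_self _ _
    · exact Finset.mem_insert_of_mem h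
  refine ⟨p.concat hsw, h1.concat (fun h => hw (hsub w h)) hsw, fun x hx => ?_, fun x hx => ?_, ?_⟩
  · rw [SimpleGraph.Walk.support_concat, List.mem_append] at hx
    rcases hx with hx | hx
    · exact Or.inr (hsub x hx)
    · exact Or.inl (List.mem_singleton.1 hx)
  · rw [SimpleGraph.Walk.support_concat, List.mem_append]
    exact Or.inl (h3 x hx)
  · rw [SimpleGraph.Walk.support_concat, List.tail_append_of_ne_nil
      (SimpleGraph.Walk.support_ne_nil p), List.countP_append]
    simp only [List.countP_singleton, decide_eq_true_eq]
    omega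

/-- The invariant of the exploration. -/
structure ExplorationInv (G : SimpleGraph (Fin n)) (q : ℕ) (β : ℝ) (R₀ : Finset (Fin n))
    (v₀ : Fin n) (d₀ d : ℕ) (T : Set (Fin n)) (R : Finset (Fin n)) (S P : List (Fin n)) :
    Prop where
  sub : R₀ ⊆ R
  removed : ∀ x ∈ R, x ∉ R₀ → x ∈ permissiveBlock q β G T
  stack : ∀ s ∈ S, s ∈ permissiveBlock q β G T
  stack_reached : ∀ s ∈ S, ∃ m, m + d ≤ d₀ ∧ ReachedBy G q β v₀ m T R s
  pending_reached : ∀ w ∈ P, ∃ m, m + d ≤ d₀ + 1 ∧ ReachedBy G q β v₀ m T R w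

variable {R₀ : Finset (Fin n)} {v₀ : Fin n} {d₀ d : ℕ} {T : Set (Fin n)} {R : Finset (Fin n)}

/-- Permissiveness puts a high-degree neighbour of a block vertex into the block. A low-degree
neighbour becomes pending and uses one unit of the allowance of low-degree vertices on its path. -/
theorem ExplorationInv.elim {s : Fin n} {S P : List (Fin n)}
    (h : ExplorationInv G q β R₀ v₀ d₀ d T R (s :: S) P) :
    ExplorationInv G q β R₀ v₀ d₀ d T (insert s R)
      (highNbrs G (IsLowDegree q β G) R s ++ S) (lowNbrs G (IsLowDegree q β G) R s ++ P) where
  sub := h.sub.trans (Finset.subset_insert s R)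
  removed x hx hx0 := by
    rcases Finset.mem_insert.1 hx with rfl | hx
    · exact h.stack x List.mem_cons_self
    · exact h.removed x hx hx0
  stack t ht := by
    rcases List.mem_append.1 ht with ht | ht
    · have ht' := mem_highNbrs.1 ht
      by_contra hcon
      exact ht'.2 ((permissiveBlock_isLeast q β G T).1.2 t hcon
        ⟨s, h.stack s List.mem_cons_self, ht'.1.1.symm⟩)
    · exact h.stack t (List.mem_cons_of_mem _ ht)
  stack_reached t ht := by
    rcases List.mem_append.1 ht with ht | ht
    · have ht' := mem_highNbrs.1 ht
      obtain ⟨m, hm, hr⟩ := h.stack_reached s List.mem_cons_self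
      exact ⟨m, hm, hr.concat ht'.1.1 ht'.1.2 (by simp [ht'.2])⟩
    · obtain ⟨m, hm, hr⟩ := h.stack_reached t (List.mem_cons_of_mem _ ht)
      exact ⟨m, hm, hr.mono (Finset.subset_insert s R)⟩
  pending_reached t ht := by
    rcases List.mem_append.1 ht with ht | ht
    · have ht' := mem_lowNbrs.1 ht
      obtain ⟨m, hm, hr⟩ := h.stack_reached s List.mem_cons_self
      exact ⟨m + 1, by omega, hr.concat ht'.1.1 ht'.1.2 (by simp [ht'.2])⟩
    · obtain ⟨m, hm, hr⟩ := h.pending_reached t ht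
      exact ⟨m, hm, hr.mono (Finset.subset_insert s R)⟩

/-- The next level starts at `w`, and `T` collects the roots of all levels so far. The path that
reaches `w` passes through all of them, so one path always covers `T`. The lower depth compensates
for the extra low-degree vertex. -/
theorem ExplorationInv.root {w : Fin n} {S P : List (Fin n)}
    (h : ExplorationInv G q β R₀ v₀ d₀ (d + 1) T R S P) (hw : w ∈ P) :
    ExplorationInv G q β R₀ v₀ d₀ d (insert w T) R [w] [] where
  sub := h.sub
  removed x hx hx0 := permissiveBlock_mono (Set.subset_insert w T) (h.removed x hx hx0)
  stack s hs := by
    rw [List.mem_singleton.1 hs]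
    exact subset_permissiveBlock _ (Set.mem_insert w T)
  stack_reached s hs := by
    rw [List.mem_singleton.1 hs]
    obtain ⟨m, hm, p, h1, h2, h3, h4⟩ := h.pending_reached w hw
    refine ⟨m, by omega, p, h1, h2, fun x hx => ?_, h4⟩
    rcases hx with rfl | hx
    · exact p.end_mem_support
    · exact h3 x hx
  pending_reached := by simp

/-- A bound on the blocks along the paths with few low-degree vertices. -/
def BlockBound (G : SimpleGraph (Fin n)) (q : ℕ) (β : ℝ) (v₀ : Fin n) (d₀ M : ℕ) : Prop :=
  ∀ (s : Fin n) (p : G.Walk v₀ s), p.IsPath →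
    (p.support.tail.countP fun w => IsLowDegree q β G w) ≤ d₀ →
    (permissiveBlock q β G {w | w ∈ p.support}).ncard ≤ M

/-- All vertices removed so far, together with `s`, lie in the block of `T`, hence in the block of
the single path that reaches `s`. This limits the number of colour enumerations along a branch. -/
theorem ExplorationInv.card_le {s : Fin n} {S P : List (Fin n)} {M : ℕ}
    (h : ExplorationInv G q β R₀ v₀ d₀ d T R (s :: S) P) (hM : BlockBound G q β v₀ d₀ M)
    (hs : s ∉ R) : (R \ R₀).card + 1 ≤ M ∧ (insert s R \ R₀).card = (R \ R₀).card + 1 := by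
  have h1 : (insert s R \ R₀).card = (R \ R₀).card + 1 := by
    rw [Finset.insert_sdiff_of_notMem _ fun h' => hs (h.sub h'), Finset.card_insert_of_notMem]
    exact fun h' => hs (Finset.mem_sdiff.1 h').1
  refine ⟨?_, h1⟩
  rw [← h1]
  obtain ⟨m, hm, p, hp1, -, hp3, hp4⟩ := h.stack_reached s List.mem_cons_self
  refine le_trans ?_ (hM s p hp1 (by omega))
  rw [← Set.ncard_coe_finset]
  refine Set.ncard_le_ncard (fun x hx => ?_) (Set.toFinite _)
  refine permissiveBlock_mono (q := q) (β := β) (G := G) (S := T) hp3 ?_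
  have hx := Finset.mem_sdiff.1 (Finset.mem_coe.1 hx)
  exact h.elim.removed x hx.1 hx.2

variable {δ : Fin n → ℝ} {κ : ℝ}

/-- A bound for the number of nodes below a vertex of the stack, up to the enumeration. -/
noncomputable def stackWeight (G : SimpleGraph (Fin n)) (δ : Fin n → ℝ) (κ : ℝ) (d : ℕ)
    (R : Finset (Fin n)) (s : Fin n) : ℝ := κ ^ (d + 1) * avoidTail G δ 0 R s

/-- A bound for the number of nodes below a boundary edge, up to the enumeration. -/
noncomputable def pendingWeight (G : SimpleGraph (Fin n)) (δ : Fin n → ℝ) (κ : ℝ) :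
    ℕ → Finset (Fin n) → Fin n → ℝ
  | 0, _, _ => 1
  | d + 1, R, s => stackWeight G δ κ d R s

variable (hδ : ∀ w, 0 ≤ δ w) (hδhigh : ∀ w, ¬ IsLowDegree q β G w → δ w = 1)
  (hκ : 5 ≤ κ) (hκδ : ∀ w, 1 ≤ κ * δ w)

-- The value 5 is one node plus two calls of cost 2, the price of a boundary edge whose vertex has
-- already been removed.
include hδ hκ in
theorem five_le_stackWeight (d : ℕ) (R : Finset (Fin n)) (s : Fin n) :
    5 ≤ stackWeight G δ κ d R s := by
  have h1 := one_le_avoidTail_zero (G := G) hδ R s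
  have h2 : 1 ≤ κ ^ d := one_le_pow₀ (by linarith)
  unfold stackWeight
  rw [pow_succ]
  nlinarith [mul_nonneg (sub_nonneg.2 h2) (sub_nonneg.2 hκ)]

include hδ hκ in
theorem stackWeight_antitone (d : ℕ) (s : Fin n) :
    Antitone fun R => stackWeight G δ κ d R s := fun _ _ h =>
  mul_le_mul_of_nonneg_left (avoidTail_antitone hδ 0 s h) (pow_nonneg (by linarith) _)

include hδ hκ in
theorem one_le_pendingWeight (d : ℕ) (R : Finset (Fin n)) (s : Fin n) :
    1 ≤ pendingWeight G δ κ d R s := by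
  cases d with
  | zero => exact le_rfl
  | succ d => exact le_trans (by norm_num) (five_le_stackWeight hδ hκ d R s)

include hδ hκ in
theorem pendingWeight_antitone (d : ℕ) (s : Fin n) :
    Antitone fun R => pendingWeight G δ κ d R s := by
  cases d with
  | zero => exact fun _ _ _ => le_rfl
  | succ d => exact stackWeight_antitone hδ hκ d s

-- The walk sums are now used for counting. The walk of length 0 pays for the node itself. A
-- high-degree neighbour has `δ = 1`; a low-degree one gives up a power of `κ`, and `κ * δ ≥ 1`
-- makes up for its weight.
include hδ hδhigh hκ hκδ in
theorem nbrs_weight_le (d : ℕ) (R : Finset (Fin n)) (s : Fin n) (hs : s ∉ R) :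
    1 + ((highNbrs G (IsLowDegree q β G) R s).map (stackWeight G δ κ d (insert s R))).sum +
      ((lowNbrs G (IsLowDegree q β G) R s).map (pendingWeight G δ κ d (insert s R))).sum ≤
    stackWeight G δ κ d R s := by
  have hκ0 : 0 ≤ κ := by linarith
  have h1 : 1 ≤ κ ^ (d + 1) := one_le_pow₀ (by linarith)
  unfold stackWeight
  rw [avoidTail_zero, avoidTail_succ 0 hs, mul_add, mul_one, Finset.mul_sum,
    sum_remNbrs (low := IsLowDegree q β G), add_assoc]
  refine add_le_add h1 (add_le_add (List.sum_le_sum fun w hw => ?_)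
    (List.sum_le_sum fun w _ => ?_))
  · rw [hδhigh w (mem_highNbrs.1 hw).2, one_mul]
  · have h3 := one_le_avoidTail_zero (G := G) hδ (insert s R) w
    have h4 := hκδ w
    cases d with
    | zero =>
      simp only [pendingWeight]
      rw [zero_add, pow_one, ← mul_assoc]
      nlinarith
    | succ d =>
      simp only [pendingWeight, stackWeight]
      rw [pow_succ κ (d + 1)]
      have h5 : 0 ≤ κ ^ (d + 1) * avoidTail G δ 0 (insert s R) w :=
        mul_nonneg (pow_nonneg hκ0 _) (by linarith)
      calc κ ^ (d + 1) * avoidTail G δ 0 (insert s R) w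
          ≤ (κ ^ (d + 1) * avoidTail G δ 0 (insert s R) w) * (κ * δ w) :=
            le_mul_of_one_le_right h5 h4
        _ = _ := by ring

include hδ hδhigh hκ hκδ in
theorem elim_weight_le (d : ℕ) {R : Finset (Fin n)} {s : Fin n} (hs : s ∉ R) (S P : List (Fin n)) :
    1 + ((highNbrs G (IsLowDegree q β G) R s ++ S).map (stackWeight G δ κ d (insert s R))).sum +
      ((lowNbrs G (IsLowDegree q β G) R s ++ P).map (pendingWeight G δ κ d (insert s R))).sum ≤
    1 + ((s :: S).map (stackWeight G δ κ d R)).sum + (P.map (pendingWeight G δ κ d R)).sum := by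
  have h1 := nbrs_weight_le hδ hδhigh hκ hκδ d R s hs
  have h2 : (S.map (stackWeight G δ κ d (insert s R))).sum ≤ (S.map (stackWeight G δ κ d R)).sum :=
    List.sum_le_sum fun t _ => stackWeight_antitone hδ hκ d t (Finset.subset_insert s R)
  have h3 : (P.map (pendingWeight G δ κ d (insert s R))).sum ≤
      (P.map (pendingWeight G δ κ d R)).sum :=
    List.sum_le_sum fun t _ => pendingWeight_antitone hδ hκ d t (Finset.subset_insert s R)
  simp only [List.map_append, List.sum_append, List.map_cons, List.sum_cons]
  linarith

/-- One factor `8 * q` covers the `q` colours, the two evaluations needed for a ratio, and the nodes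
in between. The same estimate therefore serves for stack vertices and for boundary edges. -/
theorem enumeration_cost_le {q m : ℕ} (hq : 1 ≤ q) {c X X' : ℝ} (hc : c ≤ (8 * q) ^ m * X')
    (hX : X' ≤ X) (h1 : 1 ≤ X) : 1 + 2 * (1 + q * (1 + c)) ≤ (8 * q) ^ (m + 1) * X := by
  have hq' : (1 : ℝ) ≤ q := by exact_mod_cast hq
  have hL : (1 : ℝ) ≤ (8 * q) ^ m := one_le_pow₀ (by linarith)
  have h2 : c ≤ (8 * q) ^ m * X := hc.trans (mul_le_mul_of_nonneg_left hX (by linarith))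
  have h3 : 1 ≤ (8 * q) ^ m * X := by nlinarith
  rw [pow_succ]
  nlinarith [mul_le_mul_of_nonneg_left h2 (by linarith : (0 : ℝ) ≤ q),
    mul_le_mul_of_nonneg_left h3 (by linarith : (0 : ℝ) ≤ q)]

theorem sum_map_nonneg {f : Fin n → ℝ} (hf : ∀ w, 0 ≤ f w) (l : List (Fin n)) :
    0 ≤ (l.map f).sum :=
  List.sum_nonneg fun x hx => by
    obtain ⟨w, -, rfl⟩ := List.mem_map.1 hx
    exact hf w

-- Two kinds of branching are separated. Enumerating the colours of a vertex multiplies the cost,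
-- but each enumeration enlarges `R \ R₀`, whose size is limited by `M`. Different stack vertices
-- and boundary edges add up, and this is recorded by the walk weights.
include hδ hδhigh hκ hκδ in
theorem recCost_le_of_edgeCost_le {M : ℕ} (hq : 1 ≤ q) (hM : BlockBound G q β v₀ d₀ M) (d : ℕ)
    (hedge : ∀ T R S P w, ExplorationInv G q β R₀ v₀ d₀ d T R S P → w ∈ P →
      (1 + edgeCost G (IsLowDegree q β G) q d R w : ℝ) ≤
        (8 * q) ^ (M - (R \ R₀).card) * pendingWeight G δ κ d R w)
    (T : Set (Fin n)) (R : Finset (Fin n)) (S P : List (Fin n))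
    (h : ExplorationInv G q β R₀ v₀ d₀ d T R S P) :
    (recCost G (IsLowDegree q β G) q d R S P : ℝ) ≤ (8 * q) ^ (M - (R \ R₀).card) *
      (1 + (S.map (stackWeight G δ κ d R)).sum + (P.map (pendingWeight G δ κ d R)).sum) := by
  have hq' : (1 : ℝ) ≤ q := by exact_mod_cast hq
  have hL : ∀ m : ℕ, (1 : ℝ) ≤ (8 * q) ^ m := fun m => one_le_pow₀ (by linarith)
  have hs0 : ∀ R w, 0 ≤ stackWeight G δ κ d R w := fun R w => by
    linarith [five_le_stackWeight (G := G) hδ hκ d R w]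
  have hp0 : ∀ R w, 0 ≤ pendingWeight G δ κ d R w := fun R w => by
    linarith [one_le_pendingWeight (G := G) hδ hκ d R w]
  -- The cost does not depend on colours; one dummy colour makes the exploration induction
  -- applicable.
  obtain ⟨P', rfl⟩ : ∃ P' : List (Fin n × Fin 1), P = P'.map Prod.fst :=
    ⟨P.map fun w => (w, 0), by simp [Function.comp_def]⟩
  revert h
  refine exploration_induction G (IsLowDegree q β G) (motive := fun R S P' =>
    ExplorationInv G q β R₀ v₀ d₀ d T R S (P'.map Prod.fst) →
    (recCost G (IsLowDegree q β G) q d R S (P'.map Prod.fst) : ℝ) ≤ (8 * q) ^ (M - (R \ R₀).card) *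
      (1 + (S.map (stackWeight G δ κ d R)).sum +
        ((P'.map Prod.fst).map (pendingWeight G δ κ d R)).sum)) ?_ ?_ ?_ ?_ R S P'
  · intro R _
    rw [List.map_nil, recCost_nil]
    simpa using hL _
  · intro R p P ih h
    have h1 := hedge T R _ _ p.1 h (by simp)
    have h2 := ih ⟨h.sub, h.removed, h.stack, h.stack_reached, fun w hw =>
      h.pending_reached w (List.mem_cons_of_mem _ hw)⟩
    rw [List.map_cons, recCost_pending]
    simp only [List.map_cons, List.sum_cons, List.map_nil, List.sum_nil] at h2 ⊢
    push_cast
    linarith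
  · intro R s S P hs ih h
    rw [recCost_skip _ hs]
    have h1 := ih ⟨h.sub, h.removed, fun t ht => h.stack t (List.mem_cons_of_mem _ ht),
      fun t ht => h.stack_reached t (List.mem_cons_of_mem _ ht), h.pending_reached⟩
    have h2 := five_le_stackWeight (G := G) hδ hκ d R s
    have h3 := hL (M - (R \ R₀).card)
    push_cast
    simp only [List.map_cons, List.sum_cons]
    nlinarith
  · intro R s S P hs ih h
    obtain ⟨hc1, hc2⟩ := h.card_le hM hs
    have hP : (colorList (lowNbrs G (IsLowDegree q β G) R s) (0 : Fin 1) ++ P).map Prod.fst =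
        lowNbrs G (IsLowDegree q β G) R s ++ P.map Prod.fst := by
      simp [colorList, Function.comp_def]
    have h1 := ih 0
    rw [hP] at h1
    have h2 := elim_weight_le hδ hδhigh hκ hκδ d hs S (P.map Prod.fst)
    have h3 := enumeration_cost_le hq (h1 h.elim) h2 (by
      have := sum_map_nonneg (hs0 R) (s :: S)
      have := sum_map_nonneg (hp0 R) (P.map Prod.fst)
      linarith)
    rw [hc2, show M - ((R \ R₀).card + 1) + 1 = M - (R \ R₀).card by omega] at h3
    rw [recCost_elim _ hs]
    push_cast
    have h5 : (0 : ℝ) ≤ q * (1 + recCost G (IsLowDegree q β G) q d (insert s R)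
        (highNbrs G (IsLowDegree q β G) R s ++ S)
        (lowNbrs G (IsLowDegree q β G) R s ++ P.map Prod.fst)) := by positivity
    linarith

-- Induction on the depth supplies the bound for boundary edges: such an edge triggers two
-- explorations from its vertex at the next lower depth.
include hδ hδhigh hκ hκδ in
theorem recCost_le {M : ℕ} (hq : 1 ≤ q) (hM : BlockBound G q β v₀ d₀ M) (d : ℕ) (T : Set (Fin n))
    (R : Finset (Fin n)) (S P : List (Fin n)) (h : ExplorationInv G q β R₀ v₀ d₀ d T R S P) :
    (recCost G (IsLowDegree q β G) q d R S P : ℝ) ≤ (8 * q) ^ (M - (R \ R₀).card) *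
      (1 + (S.map (stackWeight G δ κ d R)).sum + (P.map (pendingWeight G δ κ d R)).sum) := by
  have hq' : (1 : ℝ) ≤ q := by exact_mod_cast hq
  have hL : ∀ m : ℕ, (1 : ℝ) ≤ (8 * q) ^ m := fun m => one_le_pow₀ (by linarith)
  induction d generalizing T R S P with
  | zero =>
    refine recCost_le_of_edgeCost_le hδ hδhigh hκ hκδ hq hM 0 (fun T R S P w _ _ => ?_) T R S P h
    simpa [edgeCost, pendingWeight] using hL _
  | succ d ih =>
    refine recCost_le_of_edgeCost_le hδ hδhigh hκ hκδ hq hM (d + 1)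
      (fun T R S P w h hw => ?_) T R S P h
    have hr := h.root hw
    have h5 := five_le_stackWeight (G := G) hδ hκ d R w
    simp only [edgeCost, pendingWeight]
    push_cast
    -- For a vertex that is already removed both calls return at once; this is the case for which
    -- the weights must be at least 5.
    by_cases hwR : w ∈ R
    · rw [recCost_skip d hwR, recCost_nil]
      push_cast
      have := hL (M - (R \ R₀).card)
      nlinarith
    · obtain ⟨hc1, hc2⟩ := hr.card_le hM hwR
      have h1 := ih _ _ _ _ hr.elim
      have h2 := nbrs_weight_le hδ hδhigh hκ hκδ d R w hwR
      rw [List.append_nil, List.append_nil] at h1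
      have h3 := enumeration_cost_le hq h1 h2 (by linarith)
      rw [hc2, show M - ((R \ R₀).card + 1) + 1 = M - (R \ R₀).card by omega] at h3
      rw [recCost_elim _ hwR, List.append_nil, List.append_nil]
      push_cast
      linarith

/-- The start of the exploration. -/
theorem ExplorationInv.init (R₀ : Finset (Fin n)) (v₀ : Fin n) (d₀ : ℕ) :
    ExplorationInv G q β R₀ v₀ d₀ d₀ {v₀} R₀ [v₀] [] where
  sub := subset_rfl
  removed x hx hx0 := absurd hx hx0
  stack s hs := by
    rw [List.mem_singleton.1 hs]
    exact subset_permissiveBlock _ rfl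
  stack_reached s hs := by
    rw [List.mem_singleton.1 hs]
    exact ⟨0, by omega, .nil, .nil, by simp, by simp, by simp⟩
  pending_reached := by simp

include hδ hδhigh hκ hκδ in
theorem recCost_root_le {M : ℕ} (hq : 1 ≤ q) (hM : BlockBound G q β v₀ d₀ M)
    (hv : v₀ ∉ R₀) :
    (recCost G (IsLowDegree q β G) q d₀ R₀ [v₀] [] : ℝ) ≤
      (8 * q) ^ M * (2 * stackWeight G δ κ d₀ ∅ v₀) ∧
    (recCost G (IsLowDegree q β G) q d₀ (insert v₀ R₀)
      (highNbrs G (IsLowDegree q β G) R₀ v₀) [] : ℝ) ≤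
      (8 * q) ^ M * (2 * stackWeight G δ κ d₀ ∅ v₀) := by
  have hq' : (1 : ℝ) ≤ q := by exact_mod_cast hq
  have h5 := five_le_stackWeight (G := G) hδ hκ d₀ ∅ v₀
  have hanti := stackWeight_antitone (G := G) hδ hκ d₀ v₀ (Finset.empty_subset R₀)
  simp only at hanti
  have hinit := ExplorationInv.init (G := G) (q := q) (β := β) R₀ v₀ d₀
  constructor
  · have h1 := recCost_le hδ hδhigh hκ hκδ hq hM d₀ _ _ _ _ hinit
    refine h1.trans (mul_le_mul (pow_le_pow_right₀ (by linarith) (Nat.sub_le _ _)) ?_ ?_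
      (by positivity))
    · simp only [List.map_cons, List.map_nil, List.sum_cons, List.sum_nil]
      linarith
    · simp only [List.map_cons, List.map_nil, List.sum_cons, List.sum_nil]
      linarith [five_le_stackWeight (G := G) hδ hκ d₀ R₀ v₀]
  · have h := hinit.elim
    rw [List.append_nil, List.append_nil] at h
    have h1 := recCost_le hδ hδhigh hκ hκδ hq hM d₀ {v₀} (insert v₀ R₀)
      (highNbrs G (IsLowDegree q β G) R₀ v₀) []
      ⟨h.sub, h.removed, h.stack, h.stack_reached, by simp⟩
    have h2 := nbrs_weight_le hδ hδhigh hκ hκδ d₀ R₀ v₀ hv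
    have hs0 := sum_map_nonneg (fun w => (by norm_num : (0 : ℝ) ≤ 5).trans
      (five_le_stackWeight (G := G) hδ hκ d₀ (insert v₀ R₀) w))
      (highNbrs G (IsLowDegree q β G) R₀ v₀)
    have hp0 := sum_map_nonneg (fun w => zero_le_one.trans
      (one_le_pendingWeight (G := G) hδ hκ d₀ (insert v₀ R₀) w))
      (lowNbrs G (IsLowDegree q β G) R₀ v₀)
    refine h1.trans (mul_le_mul (pow_le_pow_right₀ (by linarith) (Nat.sub_le _ _)) ?_ ?_
      (by positivity))
    · simp only [List.map_nil, List.sum_nil]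
      linarith
    · simp only [List.map_nil, List.sum_nil]
      linarith

end Cost

/-! ### A weakest precondition calculus for the programs -/

namespace Lisp

section Calculus

variable {prog : Program} {env : List Data}

/-- The evaluation of `e` terminates with a value and a number of steps that satisfy `Q`. -/
def WP (prog : Program) (env : List Data) (e : Code) (Q : Data → ℕ → Prop) : Prop :=
  ∃ v t, Eval prog env e v t ∧ Q v t

/-- The call of the function `f` with the argument `a` terminates with a value and a number of
steps that satisfy `Q`. -/
def Calls (prog : Program) (f : ℕ) (a : Data) (Q : Data → ℕ → Prop) : Prop :=
  ∃ body, prog[f]? = some body ∧ WP prog [a] body Q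

theorem WP.mono {e : Code} {Q Q' : Data → ℕ → Prop} (h : WP prog env e Q)
    (hQ : ∀ v t, Q v t → Q' v t) : WP prog env e Q' := by
  obtain ⟨v, t, h1, h2⟩ := h
  exact ⟨v, t, h1, hQ v t h2⟩

theorem Calls.mono {f : ℕ} {a : Data} {Q Q' : Data → ℕ → Prop} (h : Calls prog f a Q)
    (hQ : ∀ v t, Q v t → Q' v t) : Calls prog f a Q' := by
  obtain ⟨body, h1, h2⟩ := h
  exact ⟨body, h1, h2.mono hQ⟩

theorem calls_iff {f : ℕ} {a : Data} {body : Code} {Q : Data → ℕ → Prop}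
    (h : prog[f]? = some body) : Calls prog f a Q ↔ WP prog [a] body Q := by
  simp [Calls, h]

theorem wp_var {i : ℕ} {Q : Data → ℕ → Prop} :
    WP prog env (.var i) Q ↔ ∃ v, env[i]? = some v ∧ Q v 1 := by
  constructor
  · rintro ⟨v, t, h, hQ⟩
    cases h with | var h => exact ⟨v, h, hQ⟩
  · rintro ⟨v, h, hQ⟩
    exact ⟨v, 1, .var h, hQ⟩

theorem wp_nil {Q : Data → ℕ → Prop} : WP prog env .nil Q ↔ Q .nil 1 := by
  constructor
  · rintro ⟨v, t, h, hQ⟩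
    cases h; exact hQ
  · intro h
    exact ⟨_, _, .nil, h⟩

theorem wp_cons {e₁ e₂ : Code} {Q : Data → ℕ → Prop} : WP prog env (.cons e₁ e₂) Q ↔
    WP prog env e₁ fun v t => WP prog env e₂ fun v' t' => Q (.cons v v') (t + t' + 1) := by
  constructor
  · rintro ⟨v, t, h, hQ⟩
    cases h with | cons h₁ h₂ => exact ⟨_, _, h₁, _, _, h₂, hQ⟩
  · rintro ⟨_, _, h₁, _, _, h₂, hQ⟩
    exact ⟨_, _, .cons h₁ h₂, hQ⟩

theorem wp_bind {e₁ e₂ : Code} {Q : Data → ℕ → Prop} : WP prog env (.bind e₁ e₂) Q ↔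
    WP prog env e₁ fun v t => WP prog (v :: env) e₂ fun v' t' => Q v' (t + t' + 1) := by
  constructor
  · rintro ⟨v, t, h, hQ⟩
    cases h with | bind h₁ h₂ => exact ⟨_, _, h₁, _, _, h₂, hQ⟩
  · rintro ⟨_, _, h₁, _, _, h₂, hQ⟩
    exact ⟨_, _, .bind h₁ h₂, hQ⟩

theorem wp_call {f : ℕ} {e : Code} {Q : Data → ℕ → Prop} : WP prog env (.call f e) Q ↔
    WP prog env e fun v t => Calls prog f v fun v' t' => Q v' (t + t' + 1) := by
  constructor
  · rintro ⟨v, t, h, hQ⟩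
    cases h with | call h₁ h₂ h₃ => exact ⟨_, _, h₁, _, h₂, _, _, h₃, hQ⟩
  · rintro ⟨_, _, h₁, _, h₂, _, _, h₃, hQ⟩
    exact ⟨_, _, .call h₁ h₂ h₃, hQ⟩

/-- Inspection of the value `v`, after `t` steps. -/
def WPCond (prog : Program) (env : List Data) (e₀ e₁ : Code) (Q : Data → ℕ → Prop) (t : ℕ) :
    Data → Prop
  | .nil => WP prog env e₀ fun v' t' => Q v' (t + t' + 1)
  | .cons a b => WP prog (a :: b :: env) e₁ fun v' t' => Q v' (t + t' + 1)

theorem wp_cond {e e₀ e₁ : Code} {Q : Data → ℕ → Prop} : WP prog env (.cond e e₀ e₁) Q ↔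
    WP prog env e fun v t => WPCond prog env e₀ e₁ Q t v := by
  constructor
  · rintro ⟨v, t, h, hQ⟩
    cases h with
    | condNil h h₀ => exact ⟨_, _, h, _, _, h₀, hQ⟩
    | condCons h h₁ => exact ⟨_, _, h, _, _, h₁, hQ⟩
  · rintro ⟨v, t, h, h'⟩
    cases v with
    | nil =>
      obtain ⟨_, _, h₀, hQ⟩ := h'
      exact ⟨_, _, .condNil h h₀, hQ⟩
    | cons a b =>
      obtain ⟨_, _, h₁, hQ⟩ := h'
      exact ⟨_, _, .condCons h h₁, hQ⟩

theorem wpCond_nil {e₀ e₁ : Code} {Q : Data → ℕ → Prop} {t : ℕ} :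
    WPCond prog env e₀ e₁ Q t .nil ↔ WP prog env e₀ fun v' t' => Q v' (t + t' + 1) := Iff.rfl

theorem wpCond_cons {e₀ e₁ : Code} {Q : Data → ℕ → Prop} {t : ℕ} {a b : Data} :
    WPCond prog env e₀ e₁ Q t (.cons a b) ↔
      WP prog (a :: b :: env) e₁ fun v' t' => Q v' (t + t' + 1) := Iff.rfl

/-- The first component of a cell, `nil` for `nil`. -/
def Data.fst : Data → Data
  | .nil => .nil
  | .cons a _ => a

/-- The second component of a cell, `nil` for `nil`. -/
def Data.snd : Data → Data
  | .nil => .nil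
  | .cons _ b => b

@[simp] theorem Data.fst_nil : Data.fst .nil = .nil := rfl
@[simp] theorem Data.snd_nil : Data.snd .nil = .nil := rfl
@[simp] theorem Data.fst_cons (a b : Data) : (Data.cons a b).fst = a := rfl
@[simp] theorem Data.snd_cons (a b : Data) : (Data.cons a b).snd = b := rfl

/-- The code for the first component. -/
def Code.fst (e : Code) : Code := .cond e .nil (.var 0)

/-- The code for the second component. -/
def Code.snd (e : Code) : Code := .cond e .nil (.var 1)

theorem wp_fst {e : Code} {Q : Data → ℕ → Prop} : WP prog env e.fst Q ↔
    WP prog env e fun v t => Q v.fst (t + 2) := by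
  rw [Code.fst, wp_cond]
  have : ∀ v t, WPCond prog env .nil (.var 0) Q t v ↔ Q v.fst (t + 2) := by
    rintro (_ | ⟨a, b⟩) t <;> simp [WPCond, wp_nil, wp_var]
  simp [this]

theorem wp_snd {e : Code} {Q : Data → ℕ → Prop} : WP prog env e.snd Q ↔
    WP prog env e fun v t => Q v.snd (t + 2) := by
  rw [Code.snd, wp_cond]
  have : ∀ v t, WPCond prog env .nil (.var 1) Q t v ↔ Q v.snd (t + 2) := by
    rintro (_ | ⟨a, b⟩) t <;> simp [WPCond, wp_nil, wp_var]
  simp [this]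

/-- The code for a constant. -/
def Code.const : Data → Code
  | .nil => .nil
  | .cons a b => .cons (Code.const a) (Code.const b)

/-- The size of a tree. -/
def Data.size : Data → ℕ
  | .nil => 1
  | .cons a b => a.size + b.size + 1

theorem Data.one_le_size (d : Data) : 1 ≤ d.size := by
  cases d <;> simp [Data.size]

theorem wp_const {d : Data} {Q : Data → ℕ → Prop} :
    WP prog env (Code.const d) Q ↔ Q d d.size := by
  induction d generalizing Q with
  | nil => exact wp_nil
  | cons a b iha ihb => rw [Code.const, wp_cons, iha, ihb, Data.size]

end Calculus

/-- The length of the right spine. -/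
def Data.len : Data → ℕ
  | .nil => 0
  | .cons _ d => d.len + 1

@[simp] theorem Data.len_nil : Data.nil.len = 0 := rfl
@[simp] theorem Data.len_cons (a b : Data) : (Data.cons a b).len = b.len + 1 := rfl

theorem Data.len_snd (d : Data) : d.snd.len = d.len - 1 := by cases d <;> simp

/-- The bit that a tree represents. -/
def Data.bit : Data → ℕ
  | .nil => 0
  | .cons _ _ => 1

@[simp] theorem Data.bit_nil : Data.nil.bit = 0 := rfl
@[simp] theorem Data.bit_cons (a b : Data) : (Data.cons a b).bit = 1 := rfl

@[simp] theorem Data.toNat_nil : Data.nil.toNat = 0 := rfl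

@[simp] theorem Data.toNat_cons (a b : Data) :
    (Data.cons a b).toNat = 2 * b.toNat + a.bit := by
  cases a <;> rfl

theorem Data.toNat_eq (d : Data) : d.toNat = 2 * d.snd.toNat + d.fst.bit := by
  cases d <;> simp

theorem Data.bit_le_one (d : Data) : d.bit ≤ 1 := by cases d <;> simp

theorem Data.toNat_lt (d : Data) : d.toNat < 2 ^ d.len := by
  induction d with
  | nil => simp
  | cons a b _ ih =>
    have := a.bit_le_one
    rw [Data.toNat_cons, Data.len_cons, pow_succ]
    omega

end Lisp

/-! ### The program: binary arithmetic -/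

namespace Lisp

/-- The tree that represents `1` as a bit and `true` as a truth value. -/
def Data.one : Data := .cons .nil .nil

/-- The code of the bit `1`. -/
def Code.one : Code := .cons .nil .nil

/-- Full adder: `(c, (x, y))` with bits `c`, `x`, `y` is mapped to (sum, carry). -/
def fullAdderCode : Code :=
  .cond (.fst (.var 0))
    (.cond (.fst (.snd (.var 0)))
      (.cond (.snd (.snd (.var 0))) (.cons .nil .nil) (.cons .one .nil))
      (.cond (.snd (.snd (.var 2))) (.cons .one .nil) (.cons .nil .one)))
    (.cond (.fst (.snd (.var 2)))
      (.cond (.snd (.snd (.var 2))) (.cons .one .nil) (.cons .nil .one))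
      (.cond (.snd (.snd (.var 4))) (.cons .nil .one) (.cons .one .one)))

/-- One step of the addition, in an environment in which variable 2 is the argument. -/
def addStepCode : Code :=
  .bind (.call 2 (.cons (.fst (.var 2)) (.cons (.fst (.fst (.snd (.var 2))))
      (.fst (.snd (.snd (.var 2)))))))
    (.cons (.fst (.var 0)) (.call 1 (.cons (.snd (.var 0))
      (.cons (.snd (.fst (.snd (.var 3)))) (.snd (.snd (.snd (.var 3))))))))

/-- Addition of binary numbers: `(c, (x, y))` is mapped to `x + y + c`. -/
def addCode : Code :=
  .cond (.fst (.snd (.var 0)))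
    (.cond (.snd (.snd (.var 0))) (.cond (.fst (.var 0)) .nil (.cons .one .nil)) addStepCode)
    addStepCode

/-- Multiplication of binary numbers. -/
def mulCode : Code :=
  .cond (.fst (.var 0)) .nil
    (.bind (.cons .nil (.call 3 (.cons (.var 1) (.snd (.var 2)))))
      (.cond (.var 1) (.var 0)
        (.call 1 (.cons .nil (.cons (.snd (.var 5)) (.var 2))))))

/-- One step of the comparison, in an environment in which variable 2 is the argument. -/
def leStepCode : Code :=
  .call 4 (.cons
    (.cond (.fst (.fst (.snd (.var 2))))
      (.cond (.fst (.snd (.snd (.var 2)))) (.fst (.var 2)) .one)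
      (.cond (.fst (.snd (.snd (.var 4)))) .nil (.fst (.var 6))))
    (.cons (.snd (.fst (.snd (.var 2)))) (.snd (.snd (.snd (.var 2))))))

/-- Comparison of binary numbers: `(c, (x, y))` is mapped to the truth value of `x < y + c`. -/
def leCode : Code :=
  .cond (.fst (.snd (.var 0)))
    (.cond (.snd (.snd (.var 0))) (.fst (.var 0)) leStepCode)
    leStepCode

/-- The product of two fractions. -/
def ratMulCode : Code :=
  .cons (.call 3 (.cons (.fst (.fst (.var 0))) (.fst (.snd (.var 0)))))
    (.call 3 (.cons (.snd (.fst (.var 0))) (.snd (.snd (.var 0)))))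

/-- The sum of two fractions. -/
def ratAddCode : Code :=
  .cons (.call 1 (.cons .nil (.cons
      (.call 3 (.cons (.fst (.fst (.var 0))) (.snd (.snd (.var 0)))))
      (.call 3 (.cons (.fst (.snd (.var 0))) (.snd (.fst (.var 0))))))))
    (.call 3 (.cons (.snd (.fst (.var 0))) (.snd (.snd (.var 0)))))

/-- The quotient of two fractions, truncated from below: `(r, (x, y))` is mapped to
`max r (x / y)`. -/
def ratClampCode : Code :=
  .bind (.call 5 (.cons (.fst (.snd (.var 0)))
      (.cons (.snd (.snd (.snd (.var 0)))) (.fst (.snd (.snd (.var 0)))))))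
    (.cond (.call 4 (.cons .one (.cons
        (.call 3 (.cons (.fst (.var 0)) (.snd (.fst (.var 1)))))
        (.call 3 (.cons (.fst (.fst (.var 1))) (.snd (.var 0)))))))
      (.var 0) (.fst (.var 3)))

/-- The arithmetic part of a program. -/
structure ArithProg (prog : Program) : Prop where
  add : prog[1]? = some addCode
  fullAdder : prog[2]? = some fullAdderCode
  mul : prog[3]? = some mulCode
  le : prog[4]? = some leCode
  ratMul : prog[5]? = some ratMulCode
  ratAdd : prog[6]? = some ratAddCode
  ratClamp : prog[7]? = some ratClampCode

variable {prog : Program} (A : ArithProg prog)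

include A

theorem calls_fullAdder (c x y : Data) : Calls prog 2 (.cons c (.cons x y)) fun v t =>
    v.fst.bit + 2 * v.snd.bit = c.bit + x.bit + y.bit ∧ t ≤ 40 := by
  rw [calls_iff A.fullAdder]
  rcases c with _ | ⟨c, c'⟩ <;> rcases x with _ | ⟨x, x'⟩ <;> rcases y with _ | ⟨y, y'⟩ <;>
  simp [fullAdderCode, wp_cond, wp_fst, wp_snd, wp_var, wp_cons, wp_nil, wpCond_nil, wpCond_cons,
    Code.one]

/-- The specification of the addition. -/
def AddSpec (c x y v : Data) (t : ℕ) : Prop :=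
  v.toNat = x.toNat + y.toNat + c.bit ∧
    (v.len ≤ max x.len y.len ∨ v.len = max x.len y.len + 1 ∧ 2 ^ max x.len y.len ≤ v.toNat) ∧
    t ≤ 150 * (max x.len y.len + 1)

/-- The dummy values `a` and `b` are the variables bound by the inspection that led here. The
reserve of 50 steps pays for that inspection. -/
theorem calls_addStep (c x y : Data) (a b : Data) (hxy : 0 < max x.len y.len)
    (ih : ∀ c, Calls prog 1 (.cons c (.cons x.snd y.snd)) (AddSpec c x.snd y.snd)) :
    WP prog [a, b, .cons c (.cons x y)] addStepCode fun v t =>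
      v.toNat = x.toNat + y.toNat + c.bit ∧
    (v.len ≤ max x.len y.len ∨ v.len = max x.len y.len + 1 ∧ 2 ^ max x.len y.len ≤ v.toNat) ∧
    t + 50 ≤ 150 * (max x.len y.len + 1) := by
  simp only [addStepCode, wp_bind, wp_call, wp_cons, wp_fst, wp_snd, wp_var,
    List.getElem?_cons_succ, List.getElem?_cons_zero, Option.some.injEq, exists_eq_left',
    Data.fst_cons, Data.snd_cons]
  refine (calls_fullAdder A c x.fst y.fst).mono fun v t ⟨hv, ht⟩ => ?_
  refine (ih v.snd).mono fun w t' ⟨hw, hl, ht'⟩ => ?_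
  have hx := x.toNat_eq
  have hy := y.toNat_eq
  have hm : max x.snd.len y.snd.len + 1 = max x.len y.len := by
    rw [Data.len_snd, Data.len_snd]; omega
  refine ⟨?_, ?_, ?_⟩
  · rw [Data.toNat_cons]; omega
  · rw [Data.len_cons, ← hm]
    rcases hl with hl | ⟨hl, hl'⟩
    · left; omega
    · right
      refine ⟨by omega, ?_⟩
      rw [Data.toNat_cons, pow_succ]; omega
  · omega

theorem calls_add (c x y : Data) : Calls prog 1 (.cons c (.cons x y)) (AddSpec c x y) := by
  have hbase : ∀ x y c : Data, 0 < max x.len y.len →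
      (∀ c, Calls prog 1 (.cons c (.cons x.snd y.snd)) (AddSpec c x.snd y.snd)) →
      Calls prog 1 (.cons c (.cons x y)) (AddSpec c x y) := by
    intro x y c h ih
    rw [calls_iff A.add]
    rcases x with _ | ⟨xa, xb⟩
    · rcases y with _ | ⟨ya, yb⟩
      · simp at h
      · simp only [addCode, wp_cond, wp_fst, wp_snd, wp_var, List.getElem?_cons_zero,
          Option.some.injEq, exists_eq_left', Data.fst_cons, Data.snd_cons, wpCond_nil, wpCond_cons]
        refine (calls_addStep A c _ _ ya yb h ih).mono fun v t ⟨h1, h2, h3⟩ => ⟨h1, h2, by omega⟩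
    · simp only [addCode, wp_cond, wp_fst, wp_snd, wp_var, List.getElem?_cons_zero,
          Option.some.injEq, exists_eq_left', Data.fst_cons, Data.snd_cons, wpCond_cons]
      refine (calls_addStep A c _ _ xa xb h ih).mono fun v t ⟨h1, h2, h3⟩ => ⟨h1, h2, by omega⟩
  induction x generalizing y c with
  | nil =>
    induction y generalizing c with
    | nil =>
      rw [calls_iff A.add]
      rcases c with _ | ⟨c, c'⟩ <;>
      simp [addCode, wp_cond, wp_fst, wp_snd, wp_var, wp_cons, wp_nil, wpCond_nil, wpCond_cons,
        Code.one, AddSpec]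
    | cons ya yb _ ih => exact hbase _ _ c (by simp) ih
  | cons xa xb _ ih => exact hbase _ _ c (by simp) fun c => ih c _

/-- The length must be exactly subadditive: carry bits gained in each product would destroy the
linear growth of the fractions along the recursion. -/
theorem calls_mul (x y : Data) : Calls prog 3 (.cons x y) fun v t =>
    v.toNat = x.toNat * y.toNat ∧ v.len ≤ x.len + y.len ∧
      t ≤ 200 * (x.len + 1) * (x.len + y.len + 1) := by
  induction x with
  | nil =>
    rw [calls_iff A.mul]
    simp [mulCode, wp_cond, wp_fst, wp_var, wp_nil, wpCond_nil]
    omega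
  | cons a b _ ih =>
    rw [calls_iff A.mul]
    simp only [mulCode, wp_cond, wp_fst, wp_snd, wp_bind, wp_call, wp_cons, wp_nil, wp_var,
      List.getElem?_cons_succ, List.getElem?_cons_zero, Option.some.injEq, exists_eq_left',
      Data.fst_cons, Data.snd_cons, wpCond_cons]
    refine ih.mono fun v t ⟨h1, h2, h3⟩ => ?_
    have h4 : 200 * (b.len + 1 + 1) * (b.len + 1 + y.len + 1) =
      200 * (b.len + 1) * (b.len + y.len + 1) + 200 * (b.len + 1) + 200 * (b.len + y.len + 2) := by
      ring
    rcases a with _ | ⟨a, a'⟩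
    · simp only [wpCond_nil, wp_var, List.getElem?_cons_zero, Option.some.injEq, exists_eq_left',
        Data.toNat_cons, Data.len_cons, Data.bit_nil]
      refine ⟨by rw [h1]; ring, by omega, ?_⟩
      rw [h4]
      omega
    · simp only [wpCond_cons, wp_call, wp_cons, wp_snd, wp_nil, wp_var, List.getElem?_cons_succ,
        List.getElem?_cons_zero, Option.some.injEq, exists_eq_left', Data.snd_cons]
      refine (calls_add A .nil y (.cons .nil v)).mono fun w t' ⟨g1, g2, g3⟩ => ?_
      simp only [Data.toNat_cons, Data.len_cons, Data.bit_nil, Data.bit_cons] at g1 g2 g3 ⊢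
      have hval : w.toNat = (2 * b.toNat + 1) * y.toNat := by rw [g1, h1]; ring
      refine ⟨hval, ?_, ?_⟩
      · rcases g2 with g2 | ⟨g2, g2'⟩
        · omega
        -- A carry that lengthens the sum is a true leading 1. The result would then be at least a
        -- power of two that exceeds the product of the factors.
        · by_contra hcon
          have hb := b.toNat_lt
          have hy := y.toNat_lt
          have h5 : w.toNat < 2 ^ (b.len + 1 + y.len) := by
            rw [hval, pow_add, pow_succ]
            calc (2 * b.toNat + 1) * y.toNat ≤ (2 * b.toNat + 1) * 2 ^ y.len :=
                  Nat.mul_le_mul_left _ hy.le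
              _ < 2 ^ b.len * 2 * 2 ^ y.len := by
                  apply Nat.mul_lt_mul_of_pos_right _ (by positivity)
                  omega
          have h6 := Nat.pow_le_pow_right (n := 2) (by norm_num)
            (show b.len + 1 + y.len ≤ max y.len (v.len + 1) by omega)
          omega
      · rw [h4]
        omega

/-- Bits are read from the least significant end, and `c` holds the verdict on the bits already
read, to be kept if the current bits agree. Starting with `c` set turns `<` into `≤`. -/
theorem calls_le (c x y : Data) : Calls prog 4 (.cons c (.cons x y)) fun v t =>
    (v ≠ .nil ↔ x.toNat < y.toNat + c.bit) ∧ t ≤ 150 * (max x.len y.len + 1) := by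
  have hstep : ∀ (x y c a b : Data), 0 < max x.len y.len →
      (∀ c, Calls prog 4 (.cons c (.cons x.snd y.snd)) fun v t =>
        (v ≠ .nil ↔ x.snd.toNat < y.snd.toNat + c.bit) ∧
          t ≤ 150 * (max x.snd.len y.snd.len + 1)) →
      WP prog [a, b, .cons c (.cons x y)] leStepCode fun v t =>
        (v ≠ .nil ↔ x.toNat < y.toNat + c.bit) ∧ t + 50 ≤ 150 * (max x.len y.len + 1) := by
    intro x y c a b h ih
    have hx := x.toNat_eq
    have hy := y.toNat_eq
    have hm : max x.snd.len y.snd.len + 1 = max x.len y.len := by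
      rw [Data.len_snd, Data.len_snd]; omega
    have hc := c.bit_le_one
    simp only [leStepCode, wp_call, wp_cons, wp_fst, wp_snd, wp_var, wp_cond,
      List.getElem?_cons_succ, List.getElem?_cons_zero, Option.some.injEq, exists_eq_left',
      Data.fst_cons, Data.snd_cons]
    rcases hxf : x.fst with _ | ⟨xa, xb⟩ <;> rcases hyf : y.fst with _ | ⟨ya, yb⟩ <;>
    · simp only [wpCond_nil, wpCond_cons, wp_cons, wp_fst, wp_snd, wp_var, wp_nil,
        wp_cond, Code.one,
        List.getElem?_cons_succ, List.getElem?_cons_zero, Option.some.injEq, exists_eq_left',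
        Data.fst_cons, Data.snd_cons, hyf]
      refine (ih _).mono fun v t ⟨h1, h2⟩ => ⟨?_, by omega⟩
      rw [h1, hx, hy, hxf, hyf]
      simp only [Data.bit_nil, Data.bit_cons]
      omega
  have hbase : ∀ x y c : Data, 0 < max x.len y.len →
      (∀ c, Calls prog 4 (.cons c (.cons x.snd y.snd)) fun v t =>
        (v ≠ .nil ↔ x.snd.toNat < y.snd.toNat + c.bit) ∧
          t ≤ 150 * (max x.snd.len y.snd.len + 1)) →
      Calls prog 4 (.cons c (.cons x y)) fun v t =>
        (v ≠ .nil ↔ x.toNat < y.toNat + c.bit) ∧ t ≤ 150 * (max x.len y.len + 1) := by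
    intro x y c h ih
    rw [calls_iff A.le]
    rcases x with _ | ⟨xa, xb⟩
    · rcases y with _ | ⟨ya, yb⟩
      · simp at h
      · simp only [leCode, wp_cond, wp_fst, wp_snd, wp_var, List.getElem?_cons_zero,
          Option.some.injEq, exists_eq_left', Data.fst_cons, Data.snd_cons, wpCond_nil, wpCond_cons]
        exact (hstep _ _ c ya yb h ih).mono fun v t ⟨h1, h2⟩ => ⟨h1, by omega⟩
    · simp only [leCode, wp_cond, wp_fst, wp_snd, wp_var, List.getElem?_cons_zero,
          Option.some.injEq, exists_eq_left', Data.fst_cons, Data.snd_cons, wpCond_cons]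
      exact (hstep _ _ c xa xb h ih).mono fun v t ⟨h1, h2⟩ => ⟨h1, by omega⟩
  induction x generalizing y c with
  | nil =>
    induction y generalizing c with
    | nil =>
      rw [calls_iff A.le]
      rcases c with _ | ⟨c, c'⟩ <;>
      simp [leCode, wp_cond, wp_fst, wp_snd, wp_var, wpCond_nil]
    | cons ya yb _ ih => exact hbase _ _ c (by simp) ih
  | cons xa xb _ ih => exact hbase _ _ c (by simp) fun c => ih c _

omit A in
/-- The tree `v` is a fraction with value `x`, numerator and denominator of length at most `m`. -/
def IsFrac (v : Data) (x : ℝ) (m : ℕ) : Prop :=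
  ∃ nu de : Data, v = .cons nu de ∧ 0 < de.toNat ∧ (nu.toNat : ℝ) / de.toNat = x ∧
    nu.len ≤ m ∧ de.len ≤ m

omit A in
theorem IsFrac.mono {v : Data} {x : ℝ} {m m' : ℕ} (h : IsFrac v x m) (hm : m ≤ m') :
    IsFrac v x m' := by
  obtain ⟨nu, de, h1, h2, h3, h4, h5⟩ := h
  exact ⟨nu, de, h1, h2, h3, h4.trans hm, h5.trans hm⟩

omit A in
theorem mul_time_le {a b m m' : ℕ} (ha : a ≤ m) (hb : b ≤ m') :
    200 * (a + 1) * (a + b + 1) ≤ 200 * (m + m' + 1) ^ 2 := by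
  calc 200 * (a + 1) * (a + b + 1) ≤ 200 * (m + m' + 1) * (m + m' + 1) := by
        gcongr; omega
    _ = _ := by ring

theorem calls_ratMul {v w : Data} {x y : ℝ} {m m' : ℕ} (hv : IsFrac v x m) (hw : IsFrac w y m') :
    Calls prog 5 (.cons v w) fun u t =>
      IsFrac u (x * y) (m + m') ∧ t ≤ 500 * (m + m' + 1) ^ 2 := by
  obtain ⟨nu, de, rfl, hde, rfl, h1, h2⟩ := hv
  obtain ⟨nu', de', rfl, hde', rfl, h1', h2'⟩ := hw
  rw [calls_iff A.ratMul]
  simp only [ratMulCode, wp_cons, wp_call, wp_fst, wp_snd, wp_var, List.getElem?_cons_zero,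
    Option.some.injEq, exists_eq_left', Data.fst_cons, Data.snd_cons]
  refine (calls_mul A nu nu').mono fun a t ⟨a1, a2, a3⟩ => ?_
  refine (calls_mul A de de').mono fun b t' ⟨b1, b2, b3⟩ => ?_
  have e1 := mul_time_le h1 h1'
  have e2 := mul_time_le h2 h2'
  have e3 : 1 ≤ (m + m' + 1) ^ 2 := Nat.one_le_pow _ _ (by omega)
  refine ⟨⟨a, b, rfl, by rw [b1]; positivity, ?_, by omega, by omega⟩, by omega⟩
  rw [a1, b1]
  push_cast
  exact (div_mul_div_comm _ _ _ _).symm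

theorem calls_ratAdd {v w : Data} {x y : ℝ} {m m' : ℕ} (hv : IsFrac v x m) (hw : IsFrac w y m') :
    Calls prog 6 (.cons v w) fun u t =>
      IsFrac u (x + y) (m + m' + 1) ∧ t ≤ 1000 * (m + m' + 1) ^ 2 := by
  obtain ⟨nu, de, rfl, hde, rfl, h1, h2⟩ := hv
  obtain ⟨nu', de', rfl, hde', rfl, h1', h2'⟩ := hw
  rw [calls_iff A.ratAdd]
  simp only [ratAddCode, wp_cons, wp_call, wp_fst, wp_snd, wp_var, wp_nil, List.getElem?_cons_zero,
    Option.some.injEq, exists_eq_left', Data.fst_cons, Data.snd_cons]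
  refine (calls_mul A nu de').mono fun a t ⟨a1, a2, a3⟩ => ?_
  refine (calls_mul A nu' de).mono fun a' t' ⟨a1', a2', a3'⟩ => ?_
  refine (calls_add A .nil a a').mono fun s t'' ⟨s1, s2, s3⟩ => ?_
  refine (calls_mul A de de').mono fun b t''' ⟨b1, b2, b3⟩ => ?_
  have e1 := mul_time_le h1 h2'
  have e1' := mul_time_le h1' h2
  have e2 := mul_time_le h2 h2'
  rw [add_comm m'] at e1'
  have e3 : m + m' + 1 ≤ (m + m' + 1) ^ 2 := Nat.le_self_pow (by norm_num) _
  refine ⟨⟨s, b, rfl, by rw [b1]; positivity, ?_, by omega, by omega⟩, by omega⟩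
  rw [s1, b1, a1, a1']
  have h3 : (de.toNat : ℝ) ≠ 0 := by exact_mod_cast hde.ne'
  have h4 : (de'.toNat : ℝ) ≠ 0 := by exact_mod_cast hde'.ne'
  push_cast
  simp only [Data.bit_nil, Nat.cast_zero, add_zero]
  field_simp

/-- The quotient is formed by cross multiplication and may have denominator 0. If `y = 0` forces `x
= 0`, the comparison then reads `0 ≤ 0` and selects `r`, in accordance with `0 / 0 = 0`, so that no
zero denominator is ever returned. -/
theorem calls_ratClamp {r v w : Data} {ρ x y : ℝ} {h m m' : ℕ} (hr : IsFrac r ρ h)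
    (hv : IsFrac v x m) (hw : IsFrac w y m') (hxy : y = 0 → x = 0) :
    Calls prog 7 (.cons r (.cons v w)) fun u t =>
      IsFrac u (max ρ (x / y)) (h + m + m') ∧ t ≤ 1500 * (h + m + m' + 1) ^ 2 := by
  obtain ⟨ρn, ρd, rfl, hρd, rfl, h1, h2⟩ := hr
  obtain ⟨xn, xd, rfl, hxd, rfl, h3, h4⟩ := hv
  obtain ⟨yn, yd, rfl, hyd, rfl, h5, h6⟩ := hw
  rw [calls_iff A.ratClamp]
  simp only [ratClampCode, wp_bind, wp_cons, wp_call, wp_fst, wp_snd, wp_var, wp_nil, wp_cond,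
    List.getElem?_cons_succ, List.getElem?_cons_zero, Code.one,
    Option.some.injEq, exists_eq_left', Data.fst_cons, Data.snd_cons]
  rw [calls_iff A.ratMul]
  simp only [ratMulCode, wp_cons, wp_call, wp_fst, wp_snd, wp_var, List.getElem?_cons_zero,
    Option.some.injEq, exists_eq_left', Data.fst_cons, Data.snd_cons]
  refine (calls_mul A xn yd).mono fun a t ⟨a1, a2, a3⟩ => ?_
  refine (calls_mul A xd yn).mono fun b t' ⟨b1, b2, b3⟩ => ?_
  refine (calls_mul A a ρd).mono fun c t'' ⟨c1, c2, c3⟩ => ?_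
  refine (calls_mul A ρn b).mono fun d t''' ⟨d1, d2, d3⟩ => ?_
  refine (calls_le A (.cons .nil .nil) c d).mono fun s u ⟨s1, s2⟩ => ?_
  have e1 := mul_time_le (m := m) (m' := h + m') h3 (by omega : yd.len ≤ h + m')
  have e2 := mul_time_le (m := m) (m' := h + m') h4 (by omega : yn.len ≤ h + m')
  have e3 := mul_time_le (m := m + m') (m' := h) (by omega) h2 (a := a.len)
  have e4 := mul_time_le (m := h) (m' := m + m') h1 (by omega) (b := b.len)
  rw [show m + (h + m') + 1 = h + m + m' + 1 by ring] at e1 e2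
  rw [show m + m' + h + 1 = h + m + m' + 1 by ring] at e3
  rw [show h + (m + m') + 1 = h + m + m' + 1 by ring] at e4
  have e5 : h + m + m' + 1 ≤ (h + m + m' + 1) ^ 2 := Nat.le_self_pow (by norm_num) _
  have hρd' : (0 : ℝ) < ρd.toNat := by exact_mod_cast hρd
  have hxd' : (0 : ℝ) < xd.toNat := by exact_mod_cast hxd
  have hyd' : (0 : ℝ) < yd.toNat := by exact_mod_cast hyd
  have hcmp : s ≠ .nil ↔ xn.toNat * yd.toNat * ρd.toNat ≤ ρn.toNat * (xd.toNat * yn.toNat) := by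
    rw [s1, c1, d1, a1, b1, Data.bit_cons]; omega
  rcases s with _ | ⟨s, s'⟩
  · simp only [wpCond_nil, wp_var, List.getElem?_cons_zero, Option.some.injEq, exists_eq_left']
    have hlt : ρn.toNat * (xd.toNat * yn.toNat) < xn.toNat * yd.toNat * ρd.toNat := by
      simpa using hcmp
    have hxn : 0 < xn.toNat := by
      rcases Nat.eq_zero_or_pos xn.toNat with h0 | h0
      · simp [h0] at hlt
      · exact h0
    -- The quotient is returned only if it is strictly larger than `r`, which makes its numerator
    -- positive and excludes `y = 0`.
    have hyn : 0 < yn.toNat := by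
      rcases Nat.eq_zero_or_pos yn.toNat with h0 | h0
      · have := hxy (by simp [h0])
        rw [div_eq_zero_iff] at this
        rcases this with h | h
        · exact absurd (by exact_mod_cast h) hxn.ne'
        · exact absurd h hxd'.ne'
      · exact h0
    have hyn' : (0 : ℝ) < yn.toNat := by exact_mod_cast hyn
    refine ⟨⟨a, b, rfl, by rw [b1]; positivity, ?_, by omega, by omega⟩, by omega⟩
    have hval : (xn.toNat : ℝ) / xd.toNat / (yn.toNat / yd.toNat) = a.toNat / b.toNat := by
      rw [a1, b1]; push_cast; field_simp
    rw [hval, max_eq_right]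
    rw [a1, b1, div_le_div_iff₀ hρd' (by push_cast; positivity)]
    exact_mod_cast hlt.le
  · simp only [wpCond_cons, wp_fst, wp_var, List.getElem?_cons_succ, List.getElem?_cons_zero,
      Option.some.injEq, exists_eq_left', Data.fst_cons]
    have hle := hcmp.1 (by simp)
    refine ⟨⟨ρn, ρd, rfl, hρd, ?_, by omega, by omega⟩, by omega⟩
    rw [max_eq_left]
    rcases Nat.eq_zero_or_pos yn.toNat with h0 | h0
    · simp only [h0, Nat.cast_zero, zero_div, div_zero]
      positivity
    · have hyn' : (0 : ℝ) < yn.toNat := by exact_mod_cast h0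
      have hval : (xn.toNat : ℝ) / xd.toNat / (yn.toNat / yd.toNat) =
          ((xn.toNat * yd.toNat : ℕ) : ℝ) / (xd.toNat * yn.toNat : ℕ) := by
        push_cast; field_simp
      rw [hval, div_le_div_iff₀ (by push_cast; positivity) hρd']
      exact_mod_cast hle

end Lisp

/-! ### The program: lists and graphs -/

namespace Lisp

/-- Structural equality of trees. -/
def eqCode : Code :=
  .cond (.fst (.var 0)) (.cond (.snd (.var 0)) .one .nil)
    (.cond (.snd (.var 2)) .nil
      (.cond (.call 8 (.cons (.var 2) (.var 0))) .nil (.call 8 (.cons (.var 5) (.var 3)))))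

/-- Membership `(x, l)` of a tree in a list. -/
def memCode : Code :=
  .cond (.snd (.var 0)) .nil
    (.cond (.call 8 (.cons (.var 0) (.fst (.var 2)))) (.call 9 (.cons (.fst (.var 2)) (.var 1)))
      .one)

/-- The value of `s` in the association list `l`, for `(s, l)`. -/
def lookupCode : Code :=
  .cond (.snd (.var 0)) .nil
    (.cond (.call 8 (.cons (.fst (.var 0)) (.fst (.var 2))))
      (.call 10 (.cons (.fst (.var 2)) (.var 1))) (.snd (.var 2)))

/-- The binary number one. -/
def Data.oneNat : Data := .cons .one .nil

/-- The fraction one. -/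
def Data.fracOne : Data := .cons .oneNat .oneNat

/-- The fraction zero. -/
def Data.fracZero : Data := .cons .nil .oneNat

/-- The power of `b` to the number of occurrences of `x` in `l`, for `(b, (x, l))`. -/
def weightCode : Code :=
  .cond (.snd (.snd (.var 0))) (.const .fracOne)
    (.bind (.call 11 (.cons (.fst (.var 2)) (.cons (.fst (.snd (.var 2))) (.var 1))))
      (.cond (.call 8 (.cons (.var 1) (.fst (.snd (.var 3))))) (.var 0)
        (.call 5 (.cons (.fst (.var 5)) (.var 2)))))

/-- The distribution of the neighbours `N` of a vertex of colour `c` to the stack `S`, the pending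
edges `P` and the field `F`, for `(c, (R, (N, (S, (P, F)))))`. -/
def expandCode : Code :=
  .cond (.fst (.snd (.snd (.var 0)))) (.snd (.snd (.snd (.var 0))))
    (.bind (.call 12 (.cons (.fst (.var 2)) (.cons (.fst (.snd (.var 2)))
        (.cons (.var 1) (.snd (.snd (.snd (.var 2))))))))
      (.cond (.call 9 (.cons (.var 1) (.fst (.snd (.var 3)))))
        (.cond (.snd (.var 1))
          (.cons (.cons (.var 1) (.fst (.var 0))) (.cons (.fst (.snd (.var 0)))
            (.cons (.cons (.var 1) (.fst (.var 3))) (.snd (.snd (.var 0))))))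
          (.cons (.fst (.var 2)) (.cons (.cons (.cons (.var 3) (.fst (.var 5)))
            (.fst (.snd (.var 2)))) (.snd (.snd (.var 2))))))
        (.var 2)))

/-- The entry of the table `T` whose index is the number of ones in `row`, for `(row, T)`. -/
def tableCode : Code :=
  .cond (.fst (.var 0)) (.fst (.snd (.var 0)))
    (.cond (.var 0) (.call 13 (.cons (.var 1) (.snd (.var 2))))
      (.call 13 (.cons (.var 3) (.snd (.snd (.var 4))))))

/-- The list of the vertices with their table entries, for `(matrix, (i, T))`. -/
def vertsCode : Code :=
  .cond (.fst (.var 0)) .nil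
    (.cons (.cons (.fst (.snd (.var 2))) (.call 13 (.cons (.var 0) (.snd (.snd (.var 2))))))
      (.call 14 (.cons (.var 1) (.cons (.cons .nil (.fst (.snd (.var 2))))
        (.snd (.snd (.var 2)))))))

/-- The sublist of `l` that is selected by `row`, for `(row, l)`. -/
def selectCode : Code :=
  .cond (.fst (.var 0)) .nil
    (.bind (.call 15 (.cons (.var 1) (.snd (.snd (.var 2)))))
      (.cond (.var 1) (.var 0) (.cons (.fst (.snd (.var 5))) (.var 2))))

/-- The adjacency lists, for `(matrix, (l, vertices))`, where `l` is the list of the vertices that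
belong to the rows of the matrix. -/
def adjacencyCode : Code :=
  .cond (.fst (.var 0)) .nil
    (.cons (.cons (.fst (.fst (.snd (.var 2))))
        (.call 15 (.cons (.var 0) (.snd (.snd (.var 2))))))
      (.call 16 (.cons (.var 1) (.cons (.snd (.fst (.snd (.var 2)))) (.snd (.snd (.var 2)))))))

/-- Concatenation of two lists. -/
def appendCode : Code :=
  .cond (.fst (.var 0)) (.snd (.var 0))
    (.cons (.var 0) (.call 17 (.cons (.var 1) (.snd (.var 2)))))

/-- Half of a number in unary. -/
def halveCode : Code :=
  .cond (.var 0) .nil (.cond (.var 1) .nil (.cons .nil (.call 18 (.var 1))))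

/-- `K` new cells on top of the value of `e`. -/
def Code.consN (e : Code) : ℕ → Code
  | 0 => e
  | K + 1 => .cons .nil (Code.consN e K)

/-- `K` times the binary length of the length of a list, in unary. -/
def logCode (K : ℕ) : Code :=
  .cond (.var 0) .nil (Code.consN (.call 19 (.call 18 (.var 2))) K)

/-- The binary number `2 ^ k`, for `k` in unary. -/
def powTwoCode : Code := .cond (.var 0) (.const .oneNat) (.cons .nil (.call 20 (.var 1)))

/-- The part of a program that works on lists and graphs. -/
structure ListProg (K : ℕ) (prog : Program) : Prop extends ArithProg prog where
  eq : prog[8]? = some eqCode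
  mem : prog[9]? = some memCode
  lookup : prog[10]? = some lookupCode
  weight : prog[11]? = some weightCode
  expand : prog[12]? = some expandCode
  table : prog[13]? = some tableCode
  verts : prog[14]? = some vertsCode
  select : prog[15]? = some selectCode
  adjacency : prog[16]? = some adjacencyCode
  append : prog[17]? = some appendCode
  halve : prog[18]? = some halveCode
  log : prog[19]? = some (logCode K)
  powTwo : prog[20]? = some powTwoCode

@[simp] theorem Data.ofList_nil : Data.ofList [] = .nil := rfl

@[simp] theorem Data.ofList_cons (a : Data) (l : List Data) :
    Data.ofList (a :: l) = .cons a (Data.ofList l) := rfl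

@[simp] theorem Data.len_ofList (l : List Data) : (Data.ofList l).len = l.length := by
  induction l with
  | nil => rfl
  | cons a l ih => simp [ih]

@[simp] theorem Data.size_nil : Data.nil.size = 1 := rfl

@[simp] theorem Data.size_cons (a b : Data) : (Data.cons a b).size = a.size + b.size + 1 := rfl

theorem Data.size_ofList_le {l : List Data} {m : ℕ} (h : ∀ a ∈ l, a.size ≤ m) :
    (Data.ofList l).size ≤ l.length * (m + 1) + 1 := by
  induction l with
  | nil => simp
  | cons a l ih =>
    have h1 := h a List.mem_cons_self
    have h2 := ih fun b hb => h b (List.mem_cons_of_mem _ hb)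
    rw [Data.ofList_cons, Data.size_cons, List.length_cons, Nat.succ_mul]
    omega

theorem isFrac_fracOne : IsFrac .fracOne 1 1 :=
  ⟨.oneNat, .oneNat, rfl, by simp [Data.oneNat, Data.one], by simp [Data.oneNat, Data.one],
    by simp [Data.oneNat], by simp [Data.oneNat]⟩

theorem isFrac_fracZero : IsFrac .fracZero 0 1 :=
  ⟨.nil, .oneNat, rfl, by simp [Data.oneNat, Data.one], by simp,
    by simp, by simp [Data.oneNat]⟩

variable {K : ℕ} {prog : Program} (A : ListProg K prog)

include A

theorem calls_eq (x y : Data) : Calls prog 8 (.cons x y) fun v t =>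
    (v ≠ .nil ↔ x = y) ∧ t ≤ 50 * x.size := by
  induction x generalizing y with
  | nil =>
    rw [calls_iff A.eq]
    rcases y with _ | ⟨y1, y2⟩ <;>
    simp [eqCode, wp_cond, wp_fst, wp_snd, wp_var, wp_cons, wp_nil, wpCond_nil, wpCond_cons,
      Code.one]
  | cons x1 x2 ih1 ih2 =>
    rw [calls_iff A.eq]
    rcases y with _ | ⟨y1, y2⟩
    · simp [eqCode, wp_cond, wp_fst, wp_snd, wp_var, wp_nil, wpCond_nil, wpCond_cons]
      omega
    · simp only [eqCode, wp_cond, wp_fst, wp_snd, wp_call, wp_cons, wp_var,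
        List.getElem?_cons_succ, List.getElem?_cons_zero, Option.some.injEq, exists_eq_left',
        Data.fst_cons, Data.snd_cons, wpCond_cons]
      refine (ih1 y1).mono fun v t ⟨h1, h2⟩ => ?_
      rcases v with _ | ⟨a, b⟩
      · simp only [wpCond_nil, wp_nil]
        have : x1 ≠ y1 := fun h => h1.2 h rfl
        simp only [ne_eq, not_true_eq_false, Data.cons.injEq, this, false_and, true_and,
          Data.size_cons]
        omega
      · simp only [wpCond_cons, wp_call, wp_cons, wp_var, List.getElem?_cons_succ,
          List.getElem?_cons_zero, Option.some.injEq, exists_eq_left']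
        refine (ih2 y2).mono fun w t' ⟨g1, g2⟩ => ?_
        have : x1 = y1 := h1.1 (by simp)
        rw [Data.size_cons]
        exact ⟨by rw [g1]; simp [this], by omega⟩

theorem calls_mem (x : Data) (l : List Data) : Calls prog 9 (.cons x (.ofList l)) fun v t =>
    (v ≠ .nil ↔ x ∈ l) ∧ t ≤ 50 * (Data.ofList l).size := by
  induction l with
  | nil =>
    rw [calls_iff A.mem]
    simp [memCode, wp_cond, wp_snd, wp_var, wp_nil, wpCond_nil]
  | cons a l ih =>
    rw [calls_iff A.mem]
    have ha := a.one_le_size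
    simp only [memCode, wp_cond, wp_fst, wp_snd, wp_call, wp_cons, wp_var, Data.ofList_cons,
      List.getElem?_cons_succ, List.getElem?_cons_zero, Option.some.injEq, exists_eq_left',
      Data.fst_cons, Data.snd_cons, wpCond_cons]
    refine (calls_eq A a x).mono fun v t ⟨h1, h2⟩ => ?_
    rcases v with _ | ⟨c, d⟩
    · simp only [wpCond_nil, wp_call, wp_cons, wp_fst, wp_var, List.getElem?_cons_succ,
        List.getElem?_cons_zero, Option.some.injEq, exists_eq_left', Data.fst_cons]
      refine ih.mono fun w t' ⟨g1, g2⟩ => ?_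
      have : x ≠ a := fun h => h1.2 h.symm rfl
      rw [Data.size_cons]
      exact ⟨by rw [g1]; simp [this], by omega⟩
    · have : a = x := h1.1 (by simp)
      simp [wpCond_cons, wp_cons, wp_nil, Code.one, this]
      rw [this] at h2
      omega

theorem calls_lookup {α : Type*} (key val : α → Data) (hkey : Function.Injective key) (l : List α)
    (a : α) (ha : a ∈ l) : Calls prog 10
      (.cons (key a) (.ofList (l.map fun x => .cons (key x) (val x)))) fun v t =>
    v = val a ∧ t ≤ 50 * (Data.ofList (l.map fun x => .cons (key x) (val x))).size := by
  induction l with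
  | nil => simp at ha
  | cons x l ih =>
    rw [calls_iff A.lookup]
    simp only [lookupCode, wp_cond, wp_fst, wp_snd, wp_call, wp_cons, wp_var, Data.ofList_cons,
      List.getElem?_cons_succ, List.getElem?_cons_zero, Option.some.injEq, exists_eq_left',
      Data.fst_cons, Data.snd_cons, wpCond_cons, List.map_cons]
    have h0 := (key x).one_le_size
    have h0' := (val x).one_le_size
    refine (calls_eq A (key x) (key a)).mono fun v t ⟨h1, h2⟩ => ?_
    rcases v with _ | ⟨c, d⟩
    · simp only [wpCond_nil, wp_call, wp_cons, wp_fst, wp_var, List.getElem?_cons_succ,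
        List.getElem?_cons_zero, Option.some.injEq, exists_eq_left', Data.fst_cons]
      have hne : a ≠ x := fun h => h1.2 (by rw [h]) rfl
      refine (ih (List.mem_of_ne_of_mem hne ha)).mono fun w t' ⟨g1, g2⟩ => ?_
      simp only [Data.size_cons]
      exact ⟨g1, by omega⟩
    · have : x = a := hkey (h1.1 (by simp))
      simp [wpCond_cons, wp_var, wp_snd, this]
      subst this
      omega

theorem calls_weight {bp : Data} {b : ℝ} {k : ℕ} (hb : IsFrac bp b k) {α : Type*} [BEq α]
    [LawfulBEq α]
    (key : α → Data) (hkey : Function.Injective key) (x : α) (l : List α) :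
    Calls prog 11 (.cons bp (.cons (key x) (.ofList (l.map key)))) fun v t =>
      IsFrac v (b ^ l.count x) (l.length * k + 1) ∧
      t ≤ 50 * (Data.ofList (l.map key)).size + l.length * (500 * (l.length * k + k + 2) ^ 2) := by
  induction l with
  | nil =>
    rw [calls_iff A.weight]
    simp only [weightCode, wp_cond, wp_snd, wp_var, wp_const, wpCond_nil, List.map_nil,
      Data.ofList_nil, List.getElem?_cons_zero, Option.some.injEq, exists_eq_left', Data.snd_cons]
    refine ⟨?_, ?_⟩
    · simpa using isFrac_fracOne
    · simp [Data.fracOne, Data.oneNat, Data.one]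
  | cons y l ih =>
    rw [calls_iff A.weight]
    simp only [weightCode, wp_cond, wp_fst, wp_snd, wp_call, wp_cons, wp_bind, wp_var,
      Data.ofList_cons,
      List.getElem?_cons_succ, List.getElem?_cons_zero, Option.some.injEq, exists_eq_left',
      Data.fst_cons, Data.snd_cons, wpCond_cons, List.map_cons]
    refine ih.mono fun v t ⟨h1, h2⟩ => ?_
    refine (calls_eq A (key y) (key x)).mono fun e t' ⟨h3, h4⟩ => ?_
    have h0 := (key y).one_le_size
    have hmono : l.length * (500 * (l.length * k + k + 2) ^ 2) ≤
        l.length * (500 * ((l.length + 1) * k + k + 2) ^ 2) := by gcongr; omega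
    have hsucc : (l.length + 1) * (500 * ((l.length + 1) * k + k + 2) ^ 2) =
        l.length * (500 * ((l.length + 1) * k + k + 2) ^ 2) +
          500 * ((l.length + 1) * k + k + 2) ^ 2 := by ring
    rcases e with _ | ⟨c, d⟩
    · simp only [wpCond_nil, wp_var, List.getElem?_cons_zero, Option.some.injEq, exists_eq_left']
      have hne : y ≠ x := fun h => h3.2 (by rw [h]) rfl
      rw [List.count_cons_of_ne hne, List.length_cons, Data.size_cons]
      refine ⟨h1.mono (by rw [Nat.succ_mul]; omega), ?_⟩
      rw [hsucc]
      omega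
    · have hxy : y = x := hkey (h3.1 (by simp))
      simp only [wpCond_cons, wp_call, wp_cons, wp_fst, wp_var, List.getElem?_cons_succ,
        List.getElem?_cons_zero, Option.some.injEq, exists_eq_left', Data.fst_cons]
      refine (calls_ratMul A.toArithProg hb h1).mono fun u t'' ⟨g1, g2⟩ => ?_
      rw [hxy, List.count_cons_self, List.length_cons, Data.size_cons, pow_succ']
      refine ⟨g1.mono (by rw [Nat.succ_mul]; omega), ?_⟩
      rw [hsucc]
      have : 500 * (k + (l.length * k + 1) + 1) ^ 2 ≤
          500 * ((l.length + 1) * k + k + 2) ^ 2 :=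
        Nat.mul_le_mul_left _ (Nat.pow_le_pow_left (by rw [Nat.succ_mul]; omega) 2)
      rw [hxy] at h0 h4
      omega

/-- The ones in an adjacency row are counted by moving along the table, so the entry found is the
one indexed by the degree. -/
theorem calls_table (T : Data) (row : List Bool) :
    Calls prog 13 (.cons (.ofList (row.map Data.ofBool)) T) fun v t =>
      v = ((Data.snd)^[row.count true] T).fst ∧ t ≤ 30 * (row.length + 1) := by
  induction row generalizing T with
  | nil =>
    rw [calls_iff A.table]
    simp [tableCode, wp_cond, wp_fst, wp_snd, wp_var, wpCond_nil]
  | cons b row ih =>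
    rw [calls_iff A.table]
    simp only [tableCode, wp_cond, wp_fst, wp_var, Data.ofList_cons,
      List.getElem?_cons_zero, Option.some.injEq, exists_eq_left',
      Data.fst_cons, wpCond_cons, List.map_cons]
    cases b with
    | false =>
      simp only [Data.ofBool, cond_false, wpCond_nil, wp_call, wp_cons, wp_snd, wp_var,
        List.getElem?_cons_succ,
        List.getElem?_cons_zero, Option.some.injEq, exists_eq_left', Data.snd_cons]
      refine (ih T).mono fun v t ⟨h1, h2⟩ => ⟨by simpa using h1, ?_⟩
      rw [List.length_cons]; omega
    | true =>
      simp only [Data.ofBool, cond_true, wpCond_cons, wp_call, wp_cons, wp_snd, wp_var,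
        List.getElem?_cons_succ,
        List.getElem?_cons_zero, Option.some.injEq, exists_eq_left', Data.snd_cons]
      refine (ih T.snd).mono fun v t ⟨h1, h2⟩ => ⟨by simpa using h1, ?_⟩
      rw [List.length_cons]; omega

theorem calls_select {α : Type*} (p : α → Bool) (f : α → Data) (l : List α) :
    Calls prog 15 (.cons (.ofList (l.map fun x => Data.ofBool (p x))) (.ofList (l.map f)))
      fun v t => v = .ofList ((l.filter p).map f) ∧ t ≤ 50 * (l.length + 1) := by
  induction l with
  | nil =>
    rw [calls_iff A.select]
    simp [selectCode, wp_cond, wp_fst, wp_nil, wp_var, wpCond_nil]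
  | cons x l ih =>
    rw [calls_iff A.select]
    simp only [selectCode, wp_cond, wp_fst, wp_var, Data.ofList_cons, wp_snd, wp_call, wp_cons,
      wp_bind, List.getElem?_cons_succ, List.getElem?_cons_zero, Option.some.injEq,
      exists_eq_left', Data.fst_cons, Data.snd_cons, wpCond_cons, List.map_cons]
    refine ih.mono fun v t ⟨h1, h2⟩ => ?_
    cases hp : p x with
    | false =>
      simp [Data.ofBool, wpCond_nil, wp_var, hp, h1]
      omega
    | true =>
      simp [Data.ofBool, wpCond_cons, wp_var, wp_cons, wp_fst, wp_snd, hp, h1]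
      omega

theorem calls_append (l l' : List Data) : Calls prog 17 (.cons (.ofList l) (.ofList l')) fun v t =>
    v = .ofList (l ++ l') ∧ t ≤ 20 * (l.length + 1) := by
  induction l with
  | nil =>
    rw [calls_iff A.append]
    simp [appendCode, wp_cond, wp_fst, wp_snd, wp_var, wpCond_nil]
  | cons x l ih =>
    rw [calls_iff A.append]
    simp only [appendCode, wp_cond, wp_fst, wp_var, Data.ofList_cons, wp_snd, wp_call, wp_cons,
      List.getElem?_cons_succ, List.getElem?_cons_zero, Option.some.injEq,
      exists_eq_left', Data.fst_cons, Data.snd_cons, wpCond_cons]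
    refine ih.mono fun v t ⟨h1, h2⟩ => ⟨by simp [h1], ?_⟩
    rw [List.length_cons]; omega

theorem calls_halve (x : Data) : Calls prog 18 x fun v t =>
    v = .unary (x.len / 2) ∧ t ≤ 20 * (x.len + 1) := by
  induction hn : x.len using Nat.strong_induction_on generalizing x with
  | _ m ih =>
    rw [calls_iff A.halve]
    rcases x with _ | ⟨a, _ | ⟨b, x⟩⟩
    · simp [halveCode, wp_cond, wp_var, wp_nil, wpCond_nil, Data.unary, ← hn]
    · simp [halveCode, wp_cond, wp_var, wp_nil, wpCond_nil, wpCond_cons, Data.unary, ← hn]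
    · simp only [halveCode, wp_cond, wp_var, wp_call, wp_cons, wp_nil,
        List.getElem?_cons_succ, List.getElem?_cons_zero, Option.some.injEq,
        exists_eq_left', wpCond_cons]
      simp only [Data.len_cons] at hn
      refine (ih x.len (by omega) x rfl).mono fun v t ⟨h1, h2⟩ => ⟨?_, by omega⟩
      rw [h1, ← hn, show (x.len + 1 + 1) / 2 = x.len / 2 + 1 by omega]
      simp [Data.unary, List.replicate_succ]

omit A in
theorem wp_consN {env : List Data} {e : Code} {K : ℕ} {Q : Data → ℕ → Prop} :
    WP prog env (Code.consN e K) Q ↔ WP prog env e fun v t =>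
      Q ((Data.cons .nil)^[K] v) (t + 2 * K) := by
  induction K generalizing Q with
  | zero => rfl
  | succ K ih =>
    rw [Code.consN, wp_cons, wp_nil, ih]
    simp only [Function.iterate_succ_apply']
    have : ∀ t, 1 + (t + 2 * K) + 1 = t + 2 * (K + 1) := fun t => by ring
    simp only [this]

omit A in
theorem iterate_cons_unary (K m : ℕ) : (Data.cons .nil)^[K] (.unary m) = .unary (K + m) := by
  induction K with
  | zero => simp
  | succ K ih =>
    rw [Function.iterate_succ_apply', ih, show K + 1 + m = (K + m) + 1 by ring]
    simp [Data.unary, List.replicate_succ]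

omit A in
@[simp] theorem Data.len_unary (m : ℕ) : (Data.unary m).len = m := by simp [Data.unary]

/-- Halving a number down to 0 takes `Nat.size` many rounds, each of which adds `K` cells. This
produces the logarithmic recursion depth in unary. -/
theorem calls_log (x : Data) : Calls prog 19 x fun v t =>
    v = .unary (K * Nat.size x.len) ∧ t ≤ (100 + 2 * K) * (2 * x.len) + 50 := by
  induction hn : x.len using Nat.strong_induction_on generalizing x with
  | _ m ih =>
    rw [calls_iff A.log]
    rcases x with _ | ⟨a, x⟩
    · simp only [Data.len_nil] at hn
      simp [logCode, wp_cond, wp_var, wp_nil, wpCond_nil, Data.unary, ← hn]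
    · simp only [logCode, wp_cond, wp_var, wp_consN, wp_call,
        List.getElem?_cons_succ, List.getElem?_cons_zero, Option.some.injEq,
        exists_eq_left', wpCond_cons]
      simp only [Data.len_cons] at hn
      refine (calls_halve A _).mono fun v t ⟨h1, h2⟩ => ?_
      rw [Data.len_cons, hn] at h1 h2
      have hlt : m / 2 < m := by omega
      refine (ih (m / 2) hlt v (by rw [h1, Data.len_unary])).mono fun w t' ⟨g1, g2⟩ => ⟨?_, ?_⟩
      · have : Nat.size m = Nat.size (m / 2) + 1 := by
          have h0 : m ≠ 0 := by omega
          have hb : Nat.bit m.bodd (m / 2) = m := by rw [← Nat.div2_val, Nat.bit_bodd_div2]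
          have h := Nat.size_bit (b := m.bodd) (n := m / 2) (by rw [hb]; exact h0)
          rwa [hb] at h
        rw [g1, iterate_cons_unary, this]
        congr 1
        ring
      · have h3 : (100 + 2 * K) * (2 * (m / 2)) ≤ (100 + 2 * K) * m :=
          Nat.mul_le_mul_left _ (by omega)
        have h4 : (100 + 2 * K) * (2 * m) = (100 + 2 * K) * m + (100 * m + 2 * K * m) := by ring
        have h5 : 2 * K * 1 ≤ 2 * K * m := Nat.mul_le_mul_left _ (by omega)
        omega

theorem calls_powTwo (k : ℕ) : Calls prog 20 (.unary k) fun v t =>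
    v.toNat = 2 ^ k ∧ v.len = k + 1 ∧ t ≤ 20 * (k + 1) := by
  induction k with
  | zero =>
    rw [calls_iff A.powTwo]
    simp [powTwoCode, wp_cond, wp_var, wp_const, wpCond_nil, Data.unary, Data.oneNat, Data.one]
  | succ k ih =>
    rw [calls_iff A.powTwo]
    have : Data.unary (k + 1) = .cons .nil (.unary k) := by
      simp [Data.unary, List.replicate_succ]
    rw [this]
    simp only [powTwoCode, wp_cond, wp_var, wp_cons, wp_nil, wp_call,
        List.getElem?_cons_succ, List.getElem?_cons_zero, Option.some.injEq,
        exists_eq_left', wpCond_cons]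
    refine ih.mono fun v t ⟨h1, h2, h3⟩ => ⟨?_, ?_, by omega⟩
    · rw [Data.toNat_cons, h1, pow_succ]; simp; ring
    · rw [Data.len_cons, h2]

-- The degree class of a vertex is visible in its encoding: the second component is its table entry,
-- which is `nil` exactly for high degrees.
open scoped Classical in
theorem calls_expand {α : Type*} (venc : α → Data) (hvenc : Function.Injective venc)
    (low : α → Prop) (hlow : ∀ w, (venc w).snd = .nil ↔ ¬ low w) (c : Data) (R N : List α)
    (S P F : List Data) :
    Calls prog 12 (.cons c (.cons (.ofList (R.map venc)) (.cons (.ofList (N.map venc))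
      (.cons (.ofList S) (.cons (.ofList P) (.ofList F)))))) fun v t =>
      v = .cons (.ofList ((N.filter fun w => w ∉ R ∧ ¬ low w).map venc ++ S))
        (.cons (.ofList ((N.filter fun w => w ∉ R ∧ low w).map (fun w => .cons (venc w) c) ++ P))
          (.ofList ((N.filter fun w => w ∉ R ∧ ¬ low w).map (fun w => .cons (venc w) c) ++ F))) ∧
      t ≤ (N.length + 1) * (50 * (Data.ofList (R.map venc)).size + 100) := by
  induction N with
  | nil =>
    rw [calls_iff A.expand]
    simp only [expandCode, wp_cond, wp_fst, wp_snd, wp_var,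
      List.getElem?_cons_zero, Option.some.injEq, exists_eq_left', Data.fst_cons, Data.snd_cons,
      wpCond_nil, List.map_nil, Data.ofList_nil, List.filter_nil, List.nil_append, true_and]
    rw [Nat.succ_mul]; omega
  | cons w N ih =>
    rw [calls_iff A.expand]
    simp only [expandCode, wp_cond, wp_fst, wp_snd, wp_call, wp_cons, wp_bind, wp_var,
      List.map_cons, Data.ofList_cons, List.getElem?_cons_succ, List.getElem?_cons_zero,
      Option.some.injEq, exists_eq_left', Data.fst_cons, Data.snd_cons, wpCond_cons]
    refine ih.mono fun v t ⟨h1, h2⟩ => ?_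
    refine (calls_mem A (venc w) (R.map venc)).mono fun e t' ⟨h3, h4⟩ => ?_
    rw [List.mem_map_of_injective hvenc] at h3
    rw [List.length_cons, Nat.succ_mul]
    rcases e with _ | ⟨e1, e2⟩
    · have hR : w ∉ R := fun h => h3.2 h rfl
      simp only [wpCond_nil, wp_cond, wp_snd, wp_var, List.getElem?_cons_succ,
        List.getElem?_cons_zero, Option.some.injEq, exists_eq_left']
      rcases hs : (venc w).snd with _ | ⟨s1, s2⟩
      · have hw : ¬ low w := (hlow w).1 hs
        simp only [wpCond_nil, wp_cons, wp_fst, wp_snd, wp_var, List.getElem?_cons_succ,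
          List.getElem?_cons_zero, Option.some.injEq, exists_eq_left', h1, Data.fst_cons,
          Data.snd_cons]
        refine ⟨by simp [hR, hw], by omega⟩
      · have hw : low w := by
          by_contra h
          rw [(hlow w).2 h] at hs
          cases hs
        simp only [wpCond_cons, wp_cons, wp_fst, wp_snd, wp_var, List.getElem?_cons_succ,
          List.getElem?_cons_zero, Option.some.injEq, exists_eq_left', h1, Data.fst_cons,
          Data.snd_cons]
        refine ⟨by simp [hR, hw], by omega⟩
    · have hR : w ∈ R := h3.1 (by simp)
      simp only [wpCond_cons, wp_var, List.getElem?_cons_succ,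
          List.getElem?_cons_zero, Option.some.injEq, exists_eq_left', h1]
      refine ⟨by simp [hR], by omega⟩

theorem calls_verts {α : Type*} (row : α → List Bool) (idx : α → ℕ) (m : ℕ) (T : Data)
    (l : List α) (hl : ∀ x ∈ l, (row x).length ≤ m) (i : ℕ)
    (hidx : l.map idx = List.range' i l.length) :
    Calls prog 14 (.cons (.ofList (l.map fun x => .ofList ((row x).map Data.ofBool)))
      (.cons (.unary i) T)) fun v t =>
      v = .ofList (l.map fun x =>
        .cons (.unary (idx x)) ((Data.snd)^[(row x).count true] T).fst) ∧
      t ≤ (l.length + 1) * (30 * (m + 1) + 100) := by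
  induction l generalizing i with
  | nil =>
    rw [calls_iff A.verts]
    simp only [vertsCode, wp_cond, wp_fst, wp_var, List.map_nil, Data.ofList_nil,
      List.getElem?_cons_zero, Option.some.injEq, exists_eq_left', Data.fst_cons, wpCond_nil,
      wp_nil, true_and]
    rw [Nat.succ_mul]; omega
  | cons x l ih =>
    rw [List.map_cons, List.length_cons, List.range'_succ, List.cons.injEq] at hidx
    rw [calls_iff A.verts]
    simp only [vertsCode, wp_cond, wp_fst, wp_snd, wp_call, wp_cons, wp_nil, wp_var,
      List.map_cons, Data.ofList_cons, List.getElem?_cons_succ, List.getElem?_cons_zero,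
      Option.some.injEq, exists_eq_left', Data.fst_cons, Data.snd_cons, wpCond_cons]
    refine (calls_table A T (row x)).mono fun v t ⟨h1, h2⟩ => ?_
    have hu : Data.cons .nil (.unary i) = .unary (i + 1) := by
      simp [Data.unary, List.replicate_succ]
    rw [hu]
    refine (ih (fun y hy => hl y (List.mem_cons_of_mem _ hy)) (i + 1) hidx.2).mono
      fun w t' ⟨g1, g2⟩ => ?_
    have := hl x List.mem_cons_self
    rw [List.length_cons, Nat.succ_mul]
    exact ⟨by rw [h1, g1, hidx.1], by omega⟩

theorem calls_adjacency {α : Type*} (venc : α → Data) (adj : α → α → Bool) (L l : List α) :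
    Calls prog 16 (.cons (.ofList (l.map fun x => .ofList (L.map fun y => Data.ofBool (adj x y))))
      (.cons (.ofList (l.map venc)) (.ofList (L.map venc)))) fun v t =>
      v = .ofList (l.map fun x =>
        .cons (venc x) (.ofList ((L.filter (adj x)).map venc))) ∧
      t ≤ (l.length + 1) * (50 * (L.length + 1) + 100) := by
  induction l with
  | nil =>
    rw [calls_iff A.adjacency]
    simp only [adjacencyCode, wp_cond, wp_fst, wp_var, List.map_nil, Data.ofList_nil,
      List.getElem?_cons_zero, Option.some.injEq, exists_eq_left', Data.fst_cons, wpCond_nil,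
      wp_nil, true_and]
    rw [Nat.succ_mul]; omega
  | cons x l ih =>
    rw [calls_iff A.adjacency]
    simp only [adjacencyCode, wp_cond, wp_fst, wp_snd, wp_call, wp_cons, wp_var,
      List.map_cons, Data.ofList_cons, List.getElem?_cons_succ, List.getElem?_cons_zero,
      Option.some.injEq, exists_eq_left', Data.fst_cons, Data.snd_cons, wpCond_cons]
    refine (calls_select A (adj x) venc L).mono fun v t ⟨h1, h2⟩ => ?_
    refine ih.mono fun w t' ⟨g1, g2⟩ => ?_
    rw [List.length_cons, Nat.succ_mul]
    exact ⟨by rw [h1, g1], by omega⟩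

end Lisp

/-! ### The program: the recursion -/

namespace Lisp

/-- The context in the argument of the recursion. -/
def Code.argCtx (e : Code) : Code := .fst e

/-- The recursion depth in the argument of the recursion. -/
def Code.argDepth (e : Code) : Code := .fst (.snd e)

/-- The removed vertices in the argument of the recursion. -/
def Code.argRemoved (e : Code) : Code := .fst (.snd (.snd e))

/-- The field in the argument of the recursion. -/
def Code.argField (e : Code) : Code := .fst (.snd (.snd (.snd e)))

/-- The stack in the argument of the recursion. -/
def Code.argStack (e : Code) : Code :=
  .fst (.snd (.snd (.snd (.snd e))))

/-- The pending edges in the argument of the recursion. -/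
def Code.argPending (e : Code) : Code :=
  .snd (.snd (.snd (.snd (.snd e))))

/-- A call of the recursion. -/
def Code.callRatio (ctx d R F S P : Code) : Code :=
  .call 21 (.cons ctx (.cons d (.cons R (.cons F (.cons S P)))))

/-- The first pending edge, in an environment that starts with this edge, the other edges, and the
argument. -/
def pendingCode : Code :=
  .cond (.argDepth (.var 2)) (.const .fracOne)
    (.bind (.callRatio (.argCtx (.var 4)) (.var 1) (.argRemoved (.var 4))
        (.cons (.var 2) (.argField (.var 4))) (.cons (.fst (.var 2)) .nil) .nil)
      (.bind (.callRatio (.argCtx (.var 5)) (.var 2) (.argRemoved (.var 5))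
          (.argField (.var 5)) (.cons (.fst (.var 3)) .nil) .nil)
        (.bind (.call 7 (.cons (.snd (.fst (.var 4))) (.cons (.var 1) (.var 0))))
          (.call 5 (.cons (.var 0) (.callRatio (.argCtx (.var 7)) (.argDepth (.var 7))
            (.argRemoved (.var 7)) (.cons (.var 5) (.argField (.var 7))) .nil (.var 6)))))))

/-- The approximate ratio, for `(ctx, (d, (R, (F, (S, P)))))`. -/
def ratioCode (q : ℕ) : Code :=
  .cond (.argStack (.var 0))
    (.cond (.argPending (.var 0)) (.const .fracOne) pendingCode)
    (.cond (.call 9 (.cons (.var 0) (.argRemoved (.var 2))))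
      (.call 22 (.cons (.const (.ofList ((List.finRange q).map fun c : Fin q => .unary c)))
        (.cons (.var 0) (.cons (.var 1) (.var 2)))))
      (.callRatio (.argCtx (.var 4)) (.argDepth (.var 4)) (.argRemoved (.var 4))
        (.argField (.var 4)) (.var 3) (.argPending (.var 4))))

/-- The component of the argument of `colorSumCode` that is an argument of the recursion. -/
def Code.inner (e : Code) : Code := .snd (.snd (.snd e))

/-- The sum over the colours in `cs`, for `(cs, (s, (S, arg)))`. -/
def colorSumCode : Code :=
  .cond (.fst (.var 0)) (.const .fracZero)
    (.bind (.call 11 (.cons (.fst (.argCtx (.inner (.var 2))))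
        (.cons (.cons (.fst (.snd (.var 2))) (.var 0)) (.argField (.inner (.var 2))))))
      (.bind (.call 12 (.cons (.var 1)
          (.cons (.cons (.fst (.snd (.var 3))) (.argRemoved (.inner (.var 3))))
            (.cons (.call 10 (.cons (.fst (.snd (.var 3))) (.snd (.argCtx (.inner (.var 3))))))
              (.cons (.fst (.snd (.snd (.var 3))))
                (.cons (.argPending (.inner (.var 3))) (.argField (.inner (.var 3)))))))))
        (.bind (.callRatio (.argCtx (.inner (.var 4))) (.argDepth (.inner (.var 4)))
            (.cons (.fst (.snd (.var 4))) (.argRemoved (.inner (.var 4))))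
            (.snd (.snd (.var 0))) (.fst (.var 0)) (.fst (.snd (.var 0))))
          (.call 6 (.cons (.call 5 (.cons (.var 2) (.var 0)))
            (.call 22 (.cons (.var 4) (.snd (.var 5)))))))))

/-- The product of the vertex factors of `l`, for `(ctx, (d, (R, l)))`. -/
def factorProdCode : Code :=
  .cond (.snd (.snd (.snd (.var 0)))) (.const .fracOne)
    (.bind (.callRatio (.argCtx (.var 2)) (.argDepth (.var 2)) (.argRemoved (.var 2)) .nil
        (.cons (.var 0) .nil) .nil)
      (.bind (.call 12 (.cons .nil (.cons (.cons (.var 1) (.argRemoved (.var 3)))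
          (.cons (.call 10 (.cons (.var 1) (.snd (.argCtx (.var 3)))))
            (.cons .nil (.cons .nil .nil))))))
        (.bind (.callRatio (.argCtx (.var 4)) (.argDepth (.var 4))
            (.cons (.var 2) (.argRemoved (.var 4))) .nil (.fst (.var 0)) .nil)
          (.call 5 (.cons (.call 5 (.cons (.var 2) (.cons (.snd (.var 0)) (.fst (.var 0)))))
            (.call 23 (.cons (.argCtx (.var 5)) (.cons (.argDepth (.var 5))
              (.cons (.cons (.var 3) (.argRemoved (.var 5))) (.var 4))))))))))

/-- The recursive part of a program. -/
structure RatioProg (K q : ℕ) (prog : Program) : Prop extends ListProg K prog where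
  ratio : prog[21]? = some (ratioCode q)
  colorSum : prog[22]? = some colorSumCode
  factorProd : prog[23]? = some factorProdCode

/-! ### Correctness and cost of the recursive program -/

section Spec

open scoped Classical

variable {n q : ℕ}

/-- A vertex and its table entry. -/
def encVertex (attr : Fin n → Data) (v : Fin n) : Data := .cons (.unary v) (attr v)

/-- A boundary edge. -/
def encPair (attr : Fin n → Data) (p : Fin n × Fin q) : Data :=
  .cons (encVertex attr p.1) (.unary p.2)

theorem Data.unary_injective : Function.Injective Data.unary := fun a b h => by
  rw [← Data.len_unary a, h, Data.len_unary]

theorem encVertex_injective (attr : Fin n → Data) : Function.Injective (encVertex attr) :=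
  fun _ _ h => Fin.ext (Data.unary_injective (Data.cons.inj h).1)

theorem encPair_injective (attr : Fin n → Data) :
    Function.Injective (encPair (q := q) attr) := fun _ _ h =>
  Prod.ext (encVertex_injective attr (Data.cons.inj h).1)
    (Fin.ext (Data.unary_injective (Data.cons.inj h).2))

theorem Data.size_unary (m : ℕ) : (Data.unary m).size = 2 * m + 1 := by
  induction m with
  | zero => rfl
  | succ m ih =>
    have : Data.unary (m + 1) = .cons .nil (.unary m) := by
      simp [Data.unary, List.replicate_succ]
    rw [this, Data.size_cons, ih, Data.size_nil]
    ring

/-- The adjacency lists. -/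
noncomputable def encAdj (G : SimpleGraph (Fin n)) (attr : Fin n → Data) : Data :=
  .ofList ((List.finRange n).map fun v => .cons (encVertex attr v)
    (.ofList (((List.finRange n).filter fun w => decide (G.Adj v w)).map (encVertex attr))))

/-- The argument of the recursion. -/
noncomputable def ratioArg (G : SimpleGraph (Fin n)) (attr : Fin n → Data) (bp : Data) (d : ℕ)
    (R : List (Fin n)) (F : List (Fin n × Fin q)) (S : List (Fin n)) (P : List (Fin n × Fin q)) :
    Data :=
  .cons (.cons bp (encAdj G attr)) (.cons (.unary d) (.cons (.ofList (R.map (encVertex attr)))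
    (.cons (.ofList (F.map (encPair attr))) (.cons (.ofList (S.map (encVertex attr)))
      (.ofList (P.map (encPair attr)))))))

/-- Both sides are filtered from the same enumeration of the vertices, so they agree as lists. This
matters because the order of the stack determines the recursion. -/
theorem filter_high (G : SimpleGraph (Fin n)) (low : Fin n → Prop) (R : List (Fin n))
    (s : Fin n) {p : Fin n → Bool} (hp : ∀ w, p w = true ↔ w ∉ s :: R ∧ ¬ low w) :
    (((List.finRange n).filter fun w => decide (G.Adj s w)).filter p) =
      highNbrs G low R.toFinset s := by
  rw [List.filter_filter, highNbrs]
  refine List.filter_congr fun w _ => ?_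
  rw [Bool.eq_iff_iff, Bool.and_eq_true, hp, decide_eq_true_iff, decide_eq_true_iff, mem_remNbrs]
  simp only [List.mem_cons, Finset.mem_insert, List.mem_toFinset]
  tauto

theorem filter_low (G : SimpleGraph (Fin n)) (low : Fin n → Prop) (R : List (Fin n))
    (s : Fin n) {p : Fin n → Bool} (hp : ∀ w, p w = true ↔ w ∉ s :: R ∧ low w) :
    (((List.finRange n).filter fun w => decide (G.Adj s w)).filter p) =
      lowNbrs G low R.toFinset s := by
  rw [List.filter_filter, lowNbrs]
  refine List.filter_congr fun w _ => ?_
  rw [Bool.eq_iff_iff, Bool.and_eq_true, hp, decide_eq_true_iff, decide_eq_true_iff, mem_remNbrs]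
  simp only [List.mem_cons, Finset.mem_insert, List.mem_toFinset]
  tauto

theorem length_nbrs_le (G : SimpleGraph (Fin n)) (low : Fin n → Prop) (R : Finset (Fin n))
    (s : Fin n) : (highNbrs G low R s).length + (lowNbrs G low R s).length ≤ n := by
  have h : (highNbrs G low R s ++ lowNbrs G low R s).Nodup := by
    refine (highNbrs_nodup G low R s).append (lowNbrs_nodup G low R s) fun w h1 h2 => ?_
    exact (mem_highNbrs.1 h1).2 (mem_lowNbrs.1 h2).2
  simpa using h.length_le_card

/-- The list `Fl` represents the field `F` on the remaining vertices. -/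
def Represents (R : List (Fin n)) (Fl : List (Fin n × Fin q)) (F : ColorField n q) : Prop :=
  ∀ v, v ∉ R → ∀ c, Fl.count (v, c) = F v c

theorem Represents.addOne {R : List (Fin n)} {Fl : List (Fin n × Fin q)} {F : ColorField n q}
    (h : Represents R Fl F) (p : Fin n × Fin q) : Represents R (p :: Fl) (addOne F p) := by
  intro v hv c
  rw [List.count_cons, h v hv c]
  obtain ⟨w, c'⟩ := p
  simp only [_root_.addOne, beq_iff_eq, Prod.mk.injEq]
  congr 1
  exact if_congr (by constructor <;> rintro ⟨rfl, rfl⟩ <;> exact ⟨rfl, rfl⟩) rfl rfl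

theorem Represents.elim {G : SimpleGraph (Fin n)} {low : Fin n → Prop} {R : List (Fin n)}
    {Fl : List (Fin n × Fin q)} {F : ColorField n q} (h : Represents R Fl F) (s : Fin n)
    (c : Fin q) : Represents (s :: R) (colorList (highNbrs G low R.toFinset s) c ++ Fl)
      (elimField G low R.toFinset F s c) := by
  intro v hv c'
  rw [List.mem_cons, not_or] at hv
  rw [List.count_append, count_colorList (highNbrs_nodup G low _ s), h v hv.2 c', elimField,
    if_neg hv.1, add_comm]

/-- The bound for the running time of one step of the recursion. -/
def stepTime (n q k m X A : ℕ) : ℕ :=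
  q * (2 * q + 1 + 1) + 3000 * (X + 1) ^ 2 + 50 * (n * n * (m + 2 * q + 3) + 1) +
    n * n * (500 * (n * n * k + k + 2) ^ 2) +
    50 * A + (n + 2) * (50 * (n * (m + 1) + 1) + 100) + 500

/-- A program and the encoding of its data. -/
structure RatioSetup (prog : Program) (K : ℕ) (G : SimpleGraph (Fin n)) (low : Fin n → Prop)
    (q : ℕ) (b : ℝ) (ρ : Fin n → ℝ) (attr : Fin n → Data) (bp : Data) (k h m : ℕ) :
    Prop extends RatioProg K q prog where
  activity : IsFrac bp b k
  attr_low : ∀ w, low w → IsFrac (attr w) (ρ w) h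
  attr_high : ∀ w, ¬ low w → attr w = .nil
  size_le : ∀ w, (encVertex attr w).size ≤ m
  b_nonneg : 0 ≤ b
  b_le_one : b ≤ 1
  ρ_nonneg : ∀ w, 0 ≤ ρ w

/-- The number of bits per node of the recursion. -/
def nodeBits (n k h : ℕ) : ℕ := h + n * n * k + 2

theorem approxRatio_nil (G : SimpleGraph (Fin n)) (low : Fin n → Prop) (b : ℝ) (ρ : Fin n → ℝ)
    (d : ℕ) (R : Finset (Fin n)) (F : ColorField n q) : approxRatio G low b ρ d R F [] [] = 1 := by
  cases d with
  | zero => rw [approxRatio_zero, levelSum_nil]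
  | succ d => rw [approxRatio_succ, levelSum_nil]

/-- At depth 0 every ratio is 1, which is why the program may return 1 without going through the
pending edges. -/
theorem approxRatio_zero_pending (G : SimpleGraph (Fin n)) (low : Fin n → Prop) (b : ℝ)
    (ρ : Fin n → ℝ) (R : Finset (Fin n)) (F : ColorField n q) (P : List (Fin n × Fin q)) :
    approxRatio G low b ρ 0 R F [] P = 1 := by
  induction P generalizing F with
  | nil => exact approxRatio_nil G low b ρ 0 R F
  | cons p P ih =>
    rw [approxRatio_zero] at ih ⊢
    rw [levelSum_pending, ih, one_mul]

variable {prog : Program} {K : ℕ} {G : SimpleGraph (Fin n)} {low : Fin n → Prop} {b : ℝ}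
  {ρ : Fin n → ℝ} {attr : Fin n → Data} {bp : Data} {k h m : ℕ}

/-- The specification of the recursion. -/
def RatioSpec (prog : Program) (G : SimpleGraph (Fin n)) (low : Fin n → Prop) (b : ℝ)
    (ρ : Fin n → ℝ) (attr : Fin n → Data) (bp : Data) (k h m X d : ℕ) (R : Finset (Fin n))
    (S : List (Fin n)) (P : List (Fin n × Fin q)) : Prop :=
  ∀ (Rl : List (Fin n)) (Fl : List (Fin n × Fin q)) (F : ColorField n q), Rl.toFinset = R →
    Rl.Nodup → Represents Rl Fl F → Fl.length + P.length ≤ n * Rl.length → (∀ p ∈ P, low p.1) →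
    nodeBits n k h * recCost G low q d R S (P.map Prod.fst) ≤ X →
    Calls prog 21 (ratioArg G attr bp d Rl Fl S P) fun v t =>
      IsFrac v (approxRatio G low b ρ d R F S P)
        (nodeBits n k h * recCost G low q d R S (P.map Prod.fst)) ∧
      t ≤ stepTime n q k m X (encAdj G attr).size * recCost G low q d R S (P.map Prod.fst)

variable (A : RatioSetup prog K G low q b ρ attr bp k h m)

include A

theorem RatioSetup.snd_eq_nil (w : Fin n) : (encVertex attr w).snd = .nil ↔ ¬ low w := by
  refine ⟨fun hw hl => ?_, fun hw => A.attr_high w hw⟩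
  obtain ⟨nu, de, h, -⟩ := A.attr_low w hl
  simp [encVertex, h] at hw

theorem RatioSetup.size_removed_le {R : List (Fin n)} (hR : R.Nodup) :
    (Data.ofList (R.map (encVertex attr))).size ≤ n * (m + 1) + 1 := by
  have h1 : (Data.ofList (R.map (encVertex attr))).size ≤
      (R.map (encVertex attr)).length * (m + 1) + 1 :=
    Data.size_ofList_le fun a ha => by
      obtain ⟨w, -, rfl⟩ := List.mem_map.1 ha
      exact A.size_le w
  rw [List.length_map] at h1
  have h2 : R.length ≤ n := by simpa using hR.length_le_card
  have h3 : R.length * (m + 1) ≤ n * (m + 1) := Nat.mul_le_mul_right _ h2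
  omega

theorem RatioSetup.size_field_le {F : List (Fin n × Fin q)} (hF : F.length ≤ n * n) :
    (Data.ofList (F.map (encPair attr))).size ≤ n * n * (m + 2 * q + 3) + 1 := by
  have h1 : (Data.ofList (F.map (encPair attr))).size ≤
      (F.map (encPair attr)).length * (m + 2 * q + 2 + 1) + 1 :=
    Data.size_ofList_le fun a ha => by
      obtain ⟨p, -, rfl⟩ := List.mem_map.1 ha
      have h2 := A.size_le p.1
      have h3 := p.2.isLt
      rw [encPair, Data.size_cons, Data.size_unary]
      omega
  rw [List.length_map] at h1
  have h3 : F.length * (m + 2 * q + 2 + 1) ≤ n * n * (m + 2 * q + 2 + 1) :=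
    Nat.mul_le_mul_right _ hF
  rw [show m + 2 * q + 3 = m + 2 * q + 2 + 1 by ring]
  omega

/-- Each colour contributes one power of `b`, one recursive value, one product and one sum. Lengths
of fractions add under both operations, up to one extra bit for a sum, and `nodeBits` per colour
absorbs the power of `b` and this bit. -/
theorem calls_colorSum {X d : ℕ} {s : Fin n} {S : List (Fin n)} {P : List (Fin n × Fin q)}
    {Rl : List (Fin n)} {Fl : List (Fin n × Fin q)} {F : ColorField n q} (hs : s ∉ Rl)
    (ih : ∀ c, RatioSpec prog G low b ρ attr bp k h m X d (insert s Rl.toFinset)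
      (highNbrs G low Rl.toFinset s ++ S) (colorList (lowNbrs G low Rl.toFinset s) c ++ P))
    (hnodup : Rl.Nodup) (hF : Represents Rl Fl F) (hlen : Fl.length + P.length ≤ n * Rl.length)
    (hP : ∀ p ∈ P, low p.1) (cost : ℕ)
    (hcost : cost = recCost G low q d (insert s Rl.toFinset) (highNbrs G low Rl.toFinset s ++ S)
      (lowNbrs G low Rl.toFinset s ++ P.map Prod.fst)) (cs : List (Fin q))
    (hX : cs.length * (nodeBits n k h * (1 + cost)) + nodeBits n k h ≤ X) :
    Calls prog 22 (.cons (.ofList (cs.map fun c : Fin q => .unary c)) (.cons (encVertex attr s)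
      (.cons (.ofList (S.map (encVertex attr))) (ratioArg G attr bp d Rl Fl (s :: S) P))))
      fun v t => IsFrac v ((cs.map fun c => b ^ F s c * approxRatio G low b ρ d
          (insert s Rl.toFinset) (elimField G low Rl.toFinset F s c)
          (highNbrs G low Rl.toFinset s ++ S)
          (colorList (lowNbrs G low Rl.toFinset s) c ++ P)).sum)
        (cs.length * (nodeBits n k h * (1 + cost)) + 1) ∧
      t ≤ cs.length * (stepTime n q k m X (encAdj G attr).size * (1 + cost)) + 30 := by
  have hsn : (s :: Rl).Nodup := List.nodup_cons.2 ⟨hs, hnodup⟩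
  have hRn : Rl.length + 1 ≤ n := by simpa using hsn.length_le_card
  have hFn : Fl.length ≤ n * n :=
    le_trans (by omega) (Nat.mul_le_mul_left n (by omega : Rl.length ≤ n))
  induction cs with
  | nil =>
    rw [calls_iff A.colorSum]
    simp only [colorSumCode, wp_cond, wp_fst, wp_var, wp_const, List.getElem?_cons_zero,
      Option.some.injEq, exists_eq_left', Data.fst_cons, wpCond_nil, List.map_nil,
      Data.ofList_nil, List.sum_nil, List.length_nil, zero_mul, zero_add]
    exact ⟨isFrac_fracZero, by simp [Data.fracZero, Data.oneNat, Data.one]⟩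
  | cons c cs ihcs =>
    rw [List.length_cons, Nat.succ_mul] at hX
    have hcs := ihcs (by omega)
    rw [calls_iff A.colorSum]
    simp only [colorSumCode, ratioArg, Code.inner, Code.callRatio, Code.argCtx, Code.argDepth,
      Code.argRemoved, Code.argField, Code.argPending, wp_cond, wp_fst, wp_snd, wp_call,
      wp_cons, wp_bind, wp_var, List.map_cons, Data.ofList_cons, List.getElem?_cons_succ,
      List.getElem?_cons_zero, Option.some.injEq, exists_eq_left', Data.fst_cons, Data.snd_cons,
      wpCond_cons]
    refine (calls_weight A.toListProg A.activity (encPair attr) (encPair_injective attr)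
      (s, c) Fl).mono fun w t₁ ⟨hw, ht₁⟩ => ?_
    refine (calls_lookup A.toListProg (encVertex attr) _ (encVertex_injective attr)
      (List.finRange n) s (List.mem_finRange s)).mono fun N t₂ ⟨hN, ht₂⟩ => ?_
    subst hN
    refine (calls_expand A.toListProg (encVertex attr) (encVertex_injective attr) low
      A.snd_eq_nil (.unary c) (s :: Rl) _ _ _ _).mono fun e t₃ ⟨he, ht₃⟩ => ?_
    rw [filter_high G low Rl s (by simp), filter_low G low Rl s (by simp)] at he
    subst he
    have hl1 := length_nbrs_le G low Rl.toFinset s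
    have hcost' : recCost G low q d (insert s Rl.toFinset) (highNbrs G low Rl.toFinset s ++ S)
        ((colorList (lowNbrs G low Rl.toFinset s) c ++ P).map Prod.fst) = cost := by
      rw [hcost, List.map_append, colorList, List.map_map]
      congr 2
      exact List.map_id _
    have hT := ih c (s :: Rl) (colorList (highNbrs G low Rl.toFinset s) c ++ Fl)
      (elimField G low Rl.toFinset F s c) (by simp) hsn (hF.elim s c)
      -- Each elimination adds at most `n` boundary edges to the field and the pending list
      -- together, so the two lists stay below `n * n` entries.
      (by simp only [List.length_append, colorList, List.length_map, List.length_cons,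
            Nat.mul_succ]
          omega)
      (fun p hp => by
        rcases List.mem_append.1 hp with hp | hp
        · obtain ⟨w, hw, rfl⟩ := List.mem_map.1 hp
          exact (mem_lowNbrs.1 hw).2
        · exact hP p hp)
      (by rw [hcost']; rw [Nat.mul_add, Nat.mul_one] at hX; omega)
    rw [hcost'] at hT
    simp only [ratioArg, List.map_append, colorList, List.map_map] at hT
    refine hT.mono fun x t₄ ⟨hx, ht₄⟩ => ?_
    refine (calls_ratMul A.toArithProg hw hx).mono fun y t₅ ⟨hy, ht₅⟩ => ?_
    refine hcs.mono fun z t₆ ⟨hz, ht₆⟩ => ?_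
    refine (calls_ratAdd A.toArithProg hy hz).mono fun v t₇ ⟨hv, ht₇⟩ => ?_
    have hk : Fl.length * k ≤ n * n * k := Nat.mul_le_mul_right _ hFn
    have hbits : Fl.length * k + 1 + 1 ≤ nodeBits n k h := by unfold nodeBits; omega
    rw [hF s hs c] at hv
    -- The nonlinear products are made opaque so that linear arithmetic can add up lengths and
    -- times.
    have hB : nodeBits n k h * (1 + cost) = nodeBits n k h + nodeBits n k h * cost := by ring
    generalize nodeBits n k h * (1 + cost) = B at hB hX hv ht₇ ⊢
    rw [List.length_cons, Nat.succ_mul _ B, List.sum_cons]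
    refine ⟨hv.mono (by omega), ?_⟩
    have e1 := A.size_field_le hFn
    have e2 := A.size_removed_le hsn
    have e3 : Fl.length * (500 * (Fl.length * k + k + 2) ^ 2) ≤
        n * n * (500 * (n * n * k + k + 2) ^ 2) := by gcongr
    have e4 : 500 * (Fl.length * k + 1 + nodeBits n k h * cost + 1) ^ 2 ≤ 500 * (X + 1) ^ 2 :=
      Nat.mul_le_mul_left _ (Nat.pow_le_pow_left (by omega) 2)
    have e5 : 1000 * (Fl.length * k + 1 + nodeBits n k h * cost +
        (cs.length * B + 1) + 1) ^ 2 ≤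
          1000 * (X + 1) ^ 2 :=
      Nat.mul_le_mul_left _ (Nat.pow_le_pow_left (by omega) 2)
    have e6 : (((List.finRange n).filter fun w => decide (G.Adj s w)).length + 1) *
        (50 * (Data.ofList ((s :: Rl).map (encVertex attr))).size + 100) ≤
          (n + 1) * (50 * (n * (m + 1) + 1) + 100) := by
      refine Nat.mul_le_mul ?_ (by omega)
      have := List.length_filter_le (fun w => decide (G.Adj s w)) (List.finRange n)
      rw [List.length_finRange] at this
      omega
    have e7 : (n + 2) * (50 * (n * (m + 1) + 1) + 100) =
      (n + 1) * (50 * (n * (m + 1) + 1) + 100) + (50 * (n * (m + 1) + 1) + 100) := by ring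
    have hY : stepTime n q k m X (encAdj G attr).size * (1 + cost) =
      stepTime n q k m X (encAdj G attr).size +
        stepTime n q k m X (encAdj G attr).size * cost := by ring
    generalize stepTime n q k m X (encAdj G attr).size * (1 + cost) = Z at hY ht₆ ⊢
    rw [Nat.succ_mul _ Z]
    have hY' : q * (2 * q + 1 + 1) + 3000 * (X + 1) ^ 2 + 50 * (n * n * (m + 2 * q + 3) + 1) +
        n * n * (500 * (n * n * k + k + 2) ^ 2) + 50 * (encAdj G attr).size +
        (n + 2) * (50 * (n * (m + 1) + 1) + 100) + 500 =
      stepTime n q k m X (encAdj G attr).size := rfl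
    rw [← encAdj] at ht₂
    omega

theorem calls_ratio_nil (X d : ℕ) (R : Finset (Fin n)) :
    RatioSpec (q := q) prog G low b ρ attr bp k h m X d R [] [] := by
  intro Rl Fl F hR hnodup hF hlen hP hX
  have hone : 1 ≤ nodeBits n k h := by unfold nodeBits; omega
  have hstep : 500 ≤ stepTime n q k m X (encAdj G attr).size := by unfold stepTime; omega
  rw [List.map_nil, recCost_nil, approxRatio_nil, calls_iff A.ratio, Nat.mul_one, Nat.mul_one]
  simp only [ratioCode, ratioArg, Code.argPending, Code.argStack,
    wp_cond, wp_fst, wp_snd, wp_const, wp_var, List.map_nil, Data.ofList_nil,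
    List.getElem?_cons_zero, Option.some.injEq,
    exists_eq_left', Data.fst_cons, Data.snd_cons, wpCond_nil]
  refine ⟨isFrac_fracOne.mono hone, le_trans ?_ hstep⟩
  simp [Data.fracOne, Data.oneNat, Data.one]

/-- The cost splits into two explorations from the same vertex at the lower depth, for numerator and
denominator, and the remaining pending edges at the present depth. -/
theorem calls_pending {X d : ℕ} {R : Finset (Fin n)} {p : Fin n × Fin q}
    {P : List (Fin n × Fin q)}
    (ihd : ∀ w : Fin n, RatioSpec (q := q) prog G low b ρ attr bp k h m X d R [w] [])
    (ih : RatioSpec prog G low b ρ attr bp k h m X (d + 1) R [] P) :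
    RatioSpec prog G low b ρ attr bp k h m X (d + 1) R [] (p :: P) := by
  intro Rl Fl F hR hnodup hF hlen hP hX
  rw [List.map_cons, recCost_pending, edgeCost] at hX ⊢
  obtain ⟨c₁, hc₁⟩ : ∃ c, recCost G low q d R [p.1] [] = c := ⟨_, rfl⟩
  obtain ⟨c₂, hc₂⟩ : ∃ c, recCost G low q (d + 1) R [] (P.map Prod.fst) = c := ⟨_, rfl⟩
  rw [hc₁, hc₂] at hX ⊢
  have hbits : h + 2 ≤ nodeBits n k h := by unfold nodeBits; omega
  rw [show nodeBits n k h * (1 + 2 * c₁ + c₂) = nodeBits n k h + 2 * (nodeBits n k h * c₁) +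
    nodeBits n k h * c₂ by ring] at hX ⊢
  rw [List.length_cons] at hlen
  rw [calls_iff A.ratio]
  have hu : Data.unary (d + 1) = .cons .nil (.unary d) := by
    simp [Data.unary, List.replicate_succ]
  simp only [ratioCode, pendingCode, ratioArg, Code.callRatio, Code.argCtx, Code.argDepth,
    Code.argRemoved, Code.argField, Code.argPending, Code.argStack, wp_cond, wp_fst, wp_snd,
    wp_call, wp_nil, wp_cons, wp_bind, wp_var, List.map_cons, List.map_nil, Data.ofList_nil,
    Data.ofList_cons, List.getElem?_cons_succ, List.getElem?_cons_zero, Option.some.injEq,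
    exists_eq_left', Data.fst_cons, Data.snd_cons, wpCond_cons, wpCond_nil, hu]
  have hx := ihd p.1 Rl (p :: Fl) (addOne F p) hR hnodup (hF.addOne p)
    (by simp only [List.length_cons, List.length_nil]; omega) (by simp)
    (by rw [List.map_nil, hc₁]; omega)
  have hy := ihd p.1 Rl Fl F hR hnodup hF
    (by simp only [List.length_nil]; omega) (by simp)
    (by rw [List.map_nil, hc₁]; omega)
  have hz := ih Rl (p :: Fl) (addOne F p) hR hnodup (hF.addOne p)
    (by rw [List.length_cons]; omega) (fun r hr => hP r (List.mem_cons_of_mem _ hr))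
    (by rw [hc₂]; omega)
  simp only [ratioArg, List.map_cons, List.map_nil, Data.ofList_nil, Data.ofList_cons, hc₁] at hx hy
  simp only [ratioArg, List.map_cons, List.map_nil, Data.ofList_nil, Data.ofList_cons, hu, hc₂]
    at hz
  have hr : IsFrac (encPair attr p).fst.snd (ρ p.1) h := A.attr_low p.1 (hP p List.mem_cons_self)
  refine hx.mono fun x t₁ ⟨hx, ht₁⟩ => ?_
  refine hy.mono fun y t₂ ⟨hy, ht₂⟩ => ?_
  refine (calls_ratClamp A.toArithProg hr hx hy fun h0 => ?_).mono fun z t₃ ⟨hz', ht₃⟩ => ?_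
  -- An extra boundary edge cannot increase the approximate value, so a vanishing denominator has a
  -- vanishing numerator; at a removed vertex the denominator is 1.
  · rcases approxRatio_addOne_le A.b_nonneg A.b_le_one A.ρ_nonneg d R F p.1 p.2 with h1 | h1
    · exact le_antisymm (h0 ▸ h1) (approxRatio_nonneg A.b_nonneg A.ρ_nonneg _ _ _ _ _)
    · rw [approxRatio_skip _ _ h1, approxRatio_nil] at h0
      exact absurd h0 one_ne_zero
  refine hz.mono fun w t₄ ⟨hw, ht₄⟩ => ?_
  refine (calls_ratMul A.toArithProg hz' hw).mono fun v t₅ ⟨hv, ht₅⟩ => ?_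
  refine ⟨?_, ?_⟩
  · have heq : approxRatio G low b ρ (d + 1) R F [] (p :: P) =
        max (ρ p.1) (approxRatio G low b ρ d R (addOne F p) [p.1] [] /
          approxRatio G low b ρ d R F [p.1] []) *
        approxRatio G low b ρ (d + 1) R (addOne F p) [] P := by
      rw [approxRatio_succ, levelSum_pending]
    rw [heq]
    exact hv.mono (by omega)
  · have e1 : 1500 * (h + nodeBits n k h * c₁ + nodeBits n k h * c₁ + 1) ^ 2 ≤
        1500 * (X + 1) ^ 2 :=
      Nat.mul_le_mul_left _ (Nat.pow_le_pow_left (by omega) 2)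
    have e2 : 500 * (h + nodeBits n k h * c₁ + nodeBits n k h * c₁ + nodeBits n k h * c₂ + 1) ^ 2 ≤
        500 * (X + 1) ^ 2 :=
      Nat.mul_le_mul_left _ (Nat.pow_le_pow_left (by omega) 2)
    have e3 : 3000 * (X + 1) ^ 2 + 500 ≤ stepTime n q k m X (encAdj G attr).size := by
      unfold stepTime; omega
    rw [show stepTime n q k m X (encAdj G attr).size * (1 + 2 * c₁ + c₂) =
      stepTime n q k m X (encAdj G attr).size +
      2 * (stepTime n q k m X (encAdj G attr).size * c₁) +
      stepTime n q k m X (encAdj G attr).size * c₂ by ring]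
    omega

theorem calls_skip {X d : ℕ} {R : Finset (Fin n)} {s : Fin n} {S : List (Fin n)}
    {P : List (Fin n × Fin q)} (hs : s ∈ R)
    (ih : RatioSpec prog G low b ρ attr bp k h m X d R S P) :
    RatioSpec prog G low b ρ attr bp k h m X d R (s :: S) P := by
  intro Rl Fl F hR hnodup hF hlen hP hX
  rw [recCost_skip _ hs] at hX ⊢
  rw [Nat.mul_add, Nat.mul_one] at hX ⊢
  rw [approxRatio_skip _ _ hs, calls_iff A.ratio]
  simp only [ratioCode, ratioArg, Code.callRatio, Code.argCtx, Code.argDepth,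
    Code.argRemoved, Code.argField, Code.argPending, Code.argStack, wp_cond, wp_fst, wp_snd,
    wp_call, wp_cons, wp_var, List.map_cons,
    Data.ofList_cons, List.getElem?_cons_succ, List.getElem?_cons_zero, Option.some.injEq,
    exists_eq_left', Data.fst_cons, Data.snd_cons, wpCond_cons]
  refine (calls_mem A.toListProg (encVertex attr s) (Rl.map (encVertex attr))).mono
    fun e t₁ ⟨h1, ht₁⟩ => ?_
  rw [List.mem_map_of_injective (encVertex_injective attr), ← List.mem_toFinset, hR] at h1
  rcases e with _ | ⟨e1, e2⟩
  · exact absurd rfl (h1.2 hs)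
  simp only [wp_fst, wp_snd, wp_call, wp_cons, wp_var, List.getElem?_cons_succ,
    List.getElem?_cons_zero, Option.some.injEq, exists_eq_left', Data.fst_cons, Data.snd_cons,
    wpCond_cons]
  have hz := ih Rl Fl F hR hnodup hF hlen hP (by omega)
  rw [ratioArg] at hz
  refine hz.mono fun v t₂ ⟨hv, ht₂⟩ => ⟨hv.mono (Nat.le_add_left _ _), ?_⟩
  have e3 := A.size_removed_le hnodup
  have e4 : 50 * (n * (m + 1) + 1) + 500 ≤ stepTime n q k m X (encAdj G attr).size := by
    unfold stepTime
    rw [show (n + 2) * (50 * (n * (m + 1) + 1) + 100) =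
      (n + 1) * (50 * (n * (m + 1) + 1) + 100) + (50 * (n * (m + 1) + 1) + 100) by ring]
    omega
  rw [Nat.mul_add, Nat.mul_one]
  omega

theorem calls_elim {X d : ℕ} {R : Finset (Fin n)} {s : Fin n} {S : List (Fin n)}
    {P : List (Fin n × Fin q)} (hs : s ∉ R)
    (ih : ∀ c, RatioSpec prog G low b ρ attr bp k h m X d (insert s R)
      (highNbrs G low R s ++ S) (colorList (lowNbrs G low R s) c ++ P)) :
    RatioSpec prog G low b ρ attr bp k h m X d R (s :: S) P := by
  intro Rl Fl F hR hnodup hF hlen hP hX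
  subst hR
  rw [recCost_elim _ hs] at hX ⊢
  rw [approxRatio_elim _ _ hs, calls_iff A.ratio]
  obtain ⟨cost, hcost⟩ : ∃ c, c = recCost G low q d (insert s Rl.toFinset)
    (highNbrs G low Rl.toFinset s ++ S) (lowNbrs G low Rl.toFinset s ++ P.map Prod.fst) := ⟨_, rfl⟩
  rw [← hcost] at hX ⊢
  have hbits : 2 ≤ nodeBits n k h := by unfold nodeBits; omega
  rw [Nat.mul_add, Nat.mul_one, Nat.mul_left_comm] at hX ⊢
  have hS := calls_colorSum A (s := s) (S := S) (by simpa using hs) ih hnodup hF hlen hP cost hcost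
    (List.finRange q) (by rw [List.length_finRange]; omega)
  rw [List.length_finRange, ← Fin.sum_univ_def] at hS
  rw [show stepTime n q k m X (encAdj G attr).size * (1 + q * (1 + cost)) =
    stepTime n q k m X (encAdj G attr).size +
      q * (stepTime n q k m X (encAdj G attr).size * (1 + cost)) by ring]
  simp only [ratioArg, List.map_cons, Data.ofList_cons] at hS
  simp only [ratioCode, ratioArg, Code.callRatio, Code.argCtx, Code.argDepth,
    Code.argRemoved, Code.argField, Code.argPending, Code.argStack, wp_cond, wp_fst, wp_snd,
    wp_call, wp_cons, wp_var, List.map_cons,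
    Data.ofList_cons, List.getElem?_cons_succ, List.getElem?_cons_zero, Option.some.injEq,
    exists_eq_left', Data.fst_cons, Data.snd_cons, wpCond_cons]
  refine (calls_mem A.toListProg (encVertex attr s) (Rl.map (encVertex attr))).mono
    fun e t₁ ⟨h1, ht₁⟩ => ?_
  rw [List.mem_map_of_injective (encVertex_injective attr), ← List.mem_toFinset] at h1
  rcases e with _ | ⟨e1, e2⟩
  · simp only [wp_call, wp_cons, wp_var, wp_const, List.getElem?_cons_succ,
      List.getElem?_cons_zero, Option.some.injEq, exists_eq_left', wpCond_nil]
    refine hS.mono fun v t₂ ⟨hv, ht₂⟩ => ⟨hv.mono (by omega), ?_⟩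
    have e3 := A.size_removed_le hnodup
    have e5 : (Data.ofList ((List.finRange q).map fun c : Fin q => Data.unary c)).size ≤
        q * (2 * q + 1 + 1) + 1 := by
      have := Data.size_ofList_le (l := (List.finRange q).map fun c : Fin q => Data.unary c)
        (m := 2 * q + 1) fun a ha => by
          obtain ⟨c, -, rfl⟩ := List.mem_map.1 ha
          have := c.isLt
          rw [Data.size_unary]; omega
      rwa [List.length_map, List.length_finRange] at this
    have e4 : q * (2 * q + 1 + 1) + 50 * (n * (m + 1) + 1) + 500 ≤
        stepTime n q k m X (encAdj G attr).size := by
      unfold stepTime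
      rw [show (n + 2) * (50 * (n * (m + 1) + 1) + 100) =
        (n + 1) * (50 * (n * (m + 1) + 1) + 100) + (50 * (n * (m + 1) + 1) + 100) by ring]
      omega
    omega
  · exact absurd (h1.1 (by simp)) hs

/-- The outer induction is on the depth, the inner one along the exploration. The length bound `X`
is the same for all calls, which makes the time per node uniform. -/
theorem ratioSpec (X d : ℕ) (R : Finset (Fin n)) (S : List (Fin n)) (P : List (Fin n × Fin q)) :
    RatioSpec prog G low b ρ attr bp k h m X d R S P := by
  have hone : 1 ≤ nodeBits n k h := by unfold nodeBits; omega
  have hstep : 500 ≤ stepTime n q k m X (encAdj G attr).size := by unfold stepTime; omega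
  induction d generalizing R S P with
  | zero =>
    refine exploration_induction G low (motive := RatioSpec prog G low b ρ attr bp k h m X 0)
      (fun R => ?_) (fun R p P _ => ?_) (fun R s S P hs ih => calls_skip A hs ih)
      (fun R s S P hs ih => calls_elim A hs ih) R S P
    · exact calls_ratio_nil A _ _ _
    · intro Rl Fl F hR hnodup hF hlen hP hX
      have hc := one_le_recCost (G := G) (low := low) (q := q) 0 R [] ((p :: P).map Prod.fst)
      rw [approxRatio_zero_pending, calls_iff A.ratio]
      simp only [ratioCode, pendingCode, ratioArg, Code.argDepth, Code.argPending, Code.argStack,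
        wp_cond, wp_fst, wp_snd, wp_const, wp_var, List.map_cons, List.map_nil, Data.ofList_nil,
        Data.ofList_cons, List.getElem?_cons_succ, List.getElem?_cons_zero, Option.some.injEq,
        exists_eq_left', Data.fst_cons, Data.snd_cons, wpCond_cons, wpCond_nil, Data.unary,
        List.replicate_zero]
      refine ⟨isFrac_fracOne.mono (Nat.mul_pos hone hc), ?_⟩
      refine le_trans ?_ (Nat.mul_le_mul hstep hc)
      simp [Data.fracOne, Data.oneNat, Data.one]
  | succ d ihd =>
    exact exploration_induction G low (motive := RatioSpec prog G low b ρ attr bp k h m X (d + 1))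
      (fun R => calls_ratio_nil A _ _ _)
      (fun R p P ih => calls_pending A (fun w => ihd R [w] []) ih)
      (fun R s S P hs ih => calls_skip A hs ih) (fun R s S P hs ih => calls_elim A hs ih) R S P

end Spec

end Lisp

/-! ### The program: the partition function -/

namespace Lisp

/-- The main function: `T` is the table of the vertex bounds, and `e` is the code for the
activity. -/
def mainCode (T : Data) (e : Code) : Code :=
  .bind (.call 14 (.cons (.fst (.var 0)) (.cons .nil (.const T))))
    (.bind (.call 16 (.cons (.fst (.var 1)) (.cons (.var 0) (.var 0))))
      (.bind (.call 19 (.call 17 (.cons (.fst (.var 2)) (.fst (.snd (.var 2))))))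
        (.call 23 (.cons (.cons e (.var 1)) (.cons (.var 0) (.cons .nil (.var 2)))))))

/-- The program. -/
def pottsProgram (K q : ℕ) (T : Data) (e : Code) : Program :=
  [mainCode T e, addCode, fullAdderCode, mulCode, leCode, ratMulCode, ratAddCode, ratClampCode,
    eqCode, memCode, lookupCode, weightCode, expandCode, tableCode, vertsCode, selectCode,
    adjacencyCode, appendCode, halveCode, logCode K, powTwoCode, ratioCode q, colorSumCode,
    factorProdCode]

theorem ratioProg_pottsProgram (K q : ℕ) (T : Data) (e : Code) :
    RatioProg K q (pottsProgram K q T e) := by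
  constructor
  · constructor
    · constructor <;> rfl
    all_goals rfl
  all_goals rfl

/-! ### Correctness and cost of the main program -/

section Spec

open scoped Classical

variable {n q : ℕ}

/-- The bound for the running time of one vertex factor. -/
def factorTime (n q k m X A cost : ℕ) : ℕ :=
  2 * (stepTime n q k m X A * cost) + 50 * A + (n + 1) * (50 * (n * (m + 1) + 1) + 100) +
    1000 * ((n + 1) * (2 * X) + 2) ^ 2 + 500

variable {prog : Program} {K : ℕ} {G : SimpleGraph (Fin n)} {low : Fin n → Prop} {b : ℝ}
  {ρ : Fin n → ℝ} {attr : Fin n → Data} {bp : Data} {k h m : ℕ}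

theorem represents_zero (R : List (Fin n)) : Represents R [] (0 : ColorField n q) :=
  fun _ _ _ => rfl

/-- The bits and times of the vertex factors add up along the telescoping product, since a uniform
`cost` bounds both recursive calls of each factor. -/
theorem calls_factorProd (A : RatioSetup prog K G low q b ρ attr bp k h m) {d cost : ℕ}
    (hcost : ∀ R v, v ∉ R → recCost G low q d R [v] [] ≤ cost ∧
      recCost G low q d (insert v R) (highNbrs G low R v) [] ≤ cost)
    (hpos : ∀ R v, v ∉ R →
      0 < approxRatio G low b ρ d (insert v R) (0 : ColorField n q) (highNbrs G low R v) [])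
    (l Rl : List (Fin n)) (hl : l.Nodup) (hR : Rl.Nodup) (hlR : ∀ v ∈ l, v ∉ Rl) :
    Calls prog 23 (.cons (.cons bp (encAdj G attr)) (.cons (.unary d)
      (.cons (.ofList (Rl.map (encVertex attr))) (.ofList (l.map (encVertex attr)))))) fun v t =>
      IsFrac v (factorProd q G low b ρ d Rl.toFinset l)
        (l.length * (2 * (nodeBits n k h * cost)) + 1) ∧
      t ≤ l.length * factorTime n q k m (nodeBits n k h * cost) (encAdj G attr).size cost + 30 := by
  induction l generalizing Rl with
  | nil =>
    rw [calls_iff A.factorProd]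
    simp only [factorProdCode, wp_cond, wp_snd, wp_var, wp_const,
      List.getElem?_cons_zero, Option.some.injEq, exists_eq_left', Data.snd_cons,
      wpCond_nil, List.map_nil, Data.ofList_nil, List.length_nil, zero_mul, zero_add]
    exact ⟨isFrac_fracOne, by simp [Data.fracOne, Data.oneNat, Data.one]⟩
  | cons s l ih =>
    have hs := hlR s List.mem_cons_self
    have hs' : s ∉ Rl.toFinset := by simpa using hs
    have hsn : (s :: Rl).Nodup := List.nodup_cons.2 ⟨hs, hR⟩
    rw [List.nodup_cons] at hl
    have hnl : l.length + 1 ≤ n := by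
      simpa using (List.nodup_cons.2 hl).length_le_card
    obtain ⟨X, hX⟩ : ∃ X, nodeBits n k h * cost = X := ⟨_, rfl⟩
    obtain ⟨hc1, hc2⟩ := hcost Rl.toFinset s hs'
    have hX1 : nodeBits n k h * recCost G low q d Rl.toFinset [s] [] ≤ X :=
      (Nat.mul_le_mul_left _ hc1).trans hX.le
    have hX2 : nodeBits n k h * recCost G low q d (insert s Rl.toFinset)
        (highNbrs G low Rl.toFinset s) [] ≤ X := (Nat.mul_le_mul_left _ hc2).trans hX.le
    have hrec := ih (s :: Rl) hl.2 hsn fun v hv => by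
      rw [List.mem_cons, not_or]
      exact ⟨fun h => hl.1 (h ▸ hv), hlR v (List.mem_cons_of_mem _ hv)⟩
    rw [hX] at hrec ⊢
    have hx := ratioSpec (q := q) A X d Rl.toFinset [s] [] Rl [] 0 rfl hR (represents_zero Rl)
      (by simp) (by simp) hX1
    have hy := ratioSpec (q := q) A X d (insert s Rl.toFinset) (highNbrs G low Rl.toFinset s) []
      (s :: Rl) [] 0 (by simp) hsn (represents_zero _) (by simp) (by simp) hX2
    simp only [ratioArg, List.map_cons, List.map_nil, Data.ofList_nil, Data.ofList_cons] at hx hy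
    rw [calls_iff A.factorProd]
    simp only [factorProdCode, Code.callRatio, Code.argCtx, Code.argDepth,
      Code.argRemoved, wp_cond, wp_fst, wp_snd, wp_call, wp_nil,
      wp_cons, wp_bind, wp_var, List.map_cons, Data.ofList_cons, List.getElem?_cons_succ,
      List.getElem?_cons_zero, Option.some.injEq, exists_eq_left', Data.fst_cons, Data.snd_cons,
      wpCond_cons]
    refine hx.mono fun x t₁ ⟨hx, ht₁⟩ => ?_
    refine (calls_lookup A.toListProg (encVertex attr) _ (encVertex_injective attr)
      (List.finRange n) s (List.mem_finRange s)).mono fun N t₂ ⟨hN, ht₂⟩ => ?_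
    subst hN
    refine (calls_expand A.toListProg (encVertex attr) (encVertex_injective attr) low
      A.snd_eq_nil .nil (s :: Rl) _ [] [] []).mono fun e t₃ ⟨he, ht₃⟩ => ?_
    rw [filter_high G low Rl s (by simp), filter_low G low Rl s (by simp), List.append_nil] at he
    subst he
    refine hy.mono fun y t₄ ⟨hy, ht₄⟩ => ?_
    -- Inversion is the exchange of numerator and denominator, legitimate since the approximate
    -- value is positive.
    have hyinv : IsFrac (.cons y.snd y.fst) (approxRatio G low b ρ d (insert s Rl.toFinset)
        (0 : ColorField n q) (highNbrs G low Rl.toFinset s) [])⁻¹ X := by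
      have h0 := hpos Rl.toFinset s hs'
      obtain ⟨nu, de, rfl, h1, h2, h3, h4⟩ := hy
      rw [← h2] at h0
      refine ⟨de, nu, rfl, ?_, by rw [← h2, inv_div], h4.trans hX2, h3.trans hX2⟩
      rcases Nat.eq_zero_or_pos nu.toNat with h | h
      · simp [h] at h0
      · exact h
    refine (calls_ratMul A.toArithProg (hx.mono hX1) hyinv).mono fun z t₅ ⟨hz, ht₅⟩ => ?_
    refine hrec.mono fun w t₆ ⟨hw, ht₆⟩ => ?_
    refine (calls_ratMul A.toArithProg hz hw).mono fun v t₇ ⟨hv, ht₇⟩ => ?_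
    rw [List.length_cons, Nat.add_one_mul l.length, Nat.add_one_mul l.length]
    refine ⟨?_, ?_⟩
    · rw [factorProd, vertexFactor, div_eq_mul_inv]
      rw [List.toFinset_cons] at hv
      exact hv.mono (by omega)
    · have e2 := A.size_removed_le hsn
      have e4 : 500 * (X + X + 1) ^ 2 ≤ 500 * ((n + 1) * (2 * X) + 2) ^ 2 :=
        Nat.mul_le_mul_left _ (Nat.pow_le_pow_left (by rw [Nat.add_one_mul n]; omega) 2)
      have e5 : 500 * (X + X + (l.length * (2 * X) + 1) + 1) ^ 2 ≤
          500 * ((n + 1) * (2 * X) + 2) ^ 2 := by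
        refine Nat.mul_le_mul_left _ (Nat.pow_le_pow_left ?_ 2)
        have : l.length * (2 * X) ≤ n * (2 * X) := Nat.mul_le_mul_right _ (by omega)
        rw [Nat.add_one_mul n]
        omega
      have e6 : (((List.finRange n).filter fun w => decide (G.Adj s w)).length + 1) *
          (50 * (Data.ofList ((s :: Rl).map (encVertex attr))).size + 100) ≤
            (n + 1) * (50 * (n * (m + 1) + 1) + 100) := by
        refine Nat.mul_le_mul ?_ (by omega)
        have := List.length_filter_le (fun w => decide (G.Adj s w)) (List.finRange n)
        rw [List.length_finRange] at this
        omega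
      have e7 := Nat.mul_le_mul_left (stepTime n q k m X (encAdj G attr).size) hc1
      have e8 := Nat.mul_le_mul_left (stepTime n q k m X (encAdj G attr).size) hc2
      rw [← encAdj] at ht₂
      have hY : 2 * (stepTime n q k m X (encAdj G attr).size * cost) + 50 * (encAdj G attr).size +
          (n + 1) * (50 * (n * (m + 1) + 1) + 100) + 1000 * ((n + 1) * (2 * X) + 2) ^ 2 + 500 =
        factorTime n q k m X (encAdj G attr).size cost := rfl
      omega

theorem count_row (G : SimpleGraph (Fin n)) (v : Fin n) :
    ((List.finRange n).map fun j => decide (G.Adj v j)).count true = vdeg G v := by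
  rw [List.count_eq_countP, List.countP_map, List.countP_eq_length_filter, vdeg,
    ← SimpleGraph.card_neighborFinset_eq_degree, ← List.toFinset_card_of_nodup
      ((List.nodup_finRange n).filter _)]
  congr 1
  ext w
  simp

/-- The bound for the running time of the main function. -/
def mainTime (K n N q k m X A cost tb sT : ℕ) : ℕ :=
  sT + (n + 1) * (30 * (n + 1) + 100) + (n + 1) * (50 * (n + 1) + 100) + 20 * (n + 1) +
    (100 + 2 * K) * (2 * (n + N)) + tb + n * factorTime n q k m X A cost + 300

/-- The activity code is evaluated last before the product, so it sees the input as variable 3 below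
the depth, the adjacency lists and the vertex list. The unary tolerance is appended to the rows of
the matrix to form a list of length `n + N`, from which the depth is computed. -/
theorem outputs_main (K : ℕ) (T : Data) (e : Code) (N kin tb cost : ℕ) (a : Data)
    (hbp : ∀ x y z, WP (pottsProgram K q T e)
      [x, y, z, .ofList [.ofGraph G, .unary N, .unary kin, a]] e fun v t => IsFrac v b k ∧ t ≤ tb)
    (hA : ∀ bp, IsFrac bp b k → RatioSetup (pottsProgram K q T e) K G low q b ρ
      (fun v => ((Data.snd)^[vdeg G v] T).fst) bp k h m)
    (hcost : ∀ R v, v ∉ R → recCost G low q (K * Nat.size (n + N)) R [v] [] ≤ cost ∧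
      recCost G low q (K * Nat.size (n + N)) (insert v R) (highNbrs G low R v) [] ≤ cost)
    (hpos : ∀ R v, v ∉ R → 0 < approxRatio G low b ρ (K * Nat.size (n + N)) (insert v R)
      (0 : ColorField n q) (highNbrs G low R v) []) :
    ∃ num den t, Outputs (pottsProgram K q T e)
      (.ofList [.ofGraph G, .unary N, .unary kin, a]) (.cons num den) t ∧
      t ≤ mainTime K n N q k m (nodeBits n k h * cost) (n * (m + n * (m + 1) + 3) + 1) cost tb
        T.size ∧
      0 < den.toNat ∧ (num.toNat : ℝ) / den.toNat =
        factorProd q G low b ρ (K * Nat.size (n + N)) ∅ (List.finRange n) := by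
  have B := ratioProg_pottsProgram K q T e
  suffices hmain : WP (pottsProgram K q T e) [.ofList [.ofGraph G, .unary N, .unary kin, a]]
      (.call 0 (.var 0)) fun v t =>
        IsFrac v (factorProd q G low b ρ (K * Nat.size (n + N)) ∅ (List.finRange n))
          (n * (2 * (nodeBits n k h * cost)) + 1) ∧
        t ≤ mainTime K n N q k m (nodeBits n k h * cost) (n * (m + n * (m + 1) + 3) + 1) cost tb
          T.size by
    obtain ⟨v, t, h1, ⟨nu, de, rfl, h2, h3, -⟩, h4⟩ := hmain
    exact ⟨nu, de, t, h1, h4, h2, h3⟩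
  rw [wp_call, wp_var]
  refine ⟨_, rfl, ?_⟩
  rw [calls_iff (body := mainCode T e) rfl]
  set attr : Fin n → Data := fun v => ((Data.snd)^[vdeg G v] T).fst with hattr
  have hG : Data.ofGraph G = .ofList ((List.finRange n).map fun v =>
      .ofList ((List.finRange n).map fun w => Data.ofBool (decide (G.Adj v w)))) := rfl
  simp only [mainCode, wp_bind, wp_call, wp_cons, wp_fst, wp_snd, wp_var, wp_nil, wp_const,
    Data.ofList_cons, List.getElem?_cons_succ, List.getElem?_cons_zero, Option.some.injEq,
    exists_eq_left', Data.fst_cons, Data.snd_cons]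
  have hverts := calls_verts B.toListProg
    (fun v : Fin n => (List.finRange n).map fun w => decide (G.Adj v w)) Fin.val n T
    (List.finRange n) (by simp) 0 (by simp [List.range_eq_range'])
  simp only [List.map_map, count_row] at hverts
  rw [hG]
  refine hverts.mono fun VS t₁ ⟨hVS, ht₁⟩ => ?_
  have hVS' : VS = .ofList ((List.finRange n).map (encVertex attr)) := hVS
  subst hVS'
  refine (calls_adjacency B.toListProg (encVertex attr) (fun v w => decide (G.Adj v w))
    (List.finRange n) (List.finRange n)).mono fun adj t₂ ⟨hadj, ht₂⟩ => ?_
  have hadj' : adj = encAdj G attr := hadj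
  subst hadj'
  refine (calls_append B.toListProg _ (List.replicate N .nil)).mono fun l t₃ ⟨hl, ht₃⟩ => ?_
  subst hl
  refine (calls_log B.toListProg _).mono fun D t₄ ⟨hD, ht₄⟩ => ?_
  rw [Data.len_ofList, List.length_append, List.length_map, List.length_finRange,
    List.length_replicate] at hD ht₄
  subst hD
  rw [← hG]
  refine (hbp _ _ _).mono fun bp t₅ ⟨hb, ht₅⟩ => ?_
  have A := hA bp hb
  have hsize : (encAdj G attr).size ≤ n * (m + n * (m + 1) + 3) + 1 := by
    refine (Data.size_ofList_le (m := m + n * (m + 1) + 2) fun d hd => ?_).trans ?_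
    · obtain ⟨v, -, rfl⟩ := List.mem_map.1 hd
      have h1 := A.size_le v
      have h2 := A.size_removed_le ((List.nodup_finRange n).filter fun w => decide (G.Adj v w))
      rw [Data.size_cons]
      omega
    · rw [List.length_map, List.length_finRange]
  have hF := calls_factorProd A hcost hpos (List.finRange n) [] (List.nodup_finRange n)
    List.nodup_nil (by simp)
  rw [List.toFinset_nil, List.length_finRange, List.map_nil, Data.ofList_nil] at hF
  refine hF.mono fun v t₆ ⟨hv, ht₆⟩ => ⟨hv, ?_⟩
  rw [List.length_finRange] at ht₁ ht₂
  rw [List.length_map, List.length_finRange] at ht₃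
  have hmono : factorTime n q k m (nodeBits n k h * cost) (encAdj G attr).size cost ≤
      factorTime n q k m (nodeBits n k h * cost) (n * (m + n * (m + 1) + 3) + 1) cost := by
    unfold factorTime stepTime
    gcongr
  have hmono' := Nat.mul_le_mul_left n hmono
  unfold mainTime
  omega

end Spec

end Lisp

/-! ### Estimates for the parameters -/

section Numerics

theorem two_pow_size_le {s : ℕ} (hs : 1 ≤ s) : 2 ^ Nat.size s ≤ 2 * s := by
  obtain ⟨m, hm⟩ : ∃ m, Nat.size s = m + 1 :=
    Nat.exists_eq_succ_of_ne_zero (Nat.pos_iff_ne_zero.1 (Nat.size_pos.2 hs))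
  have h : 2 ^ m ≤ s := Nat.lt_size.1 (by omega)
  rw [hm, pow_succ]
  omega

theorem log_le_size {n s : ℕ} (h : n ≤ s) : Real.log n ≤ Nat.size s := by
  rcases Nat.eq_zero_or_pos n with rfl | hn
  · simp
  have h1 : (n : ℝ) ≤ 2 ^ Nat.size s := by exact_mod_cast h.trans (Nat.lt_size_self s).le
  calc Real.log n ≤ Real.log (2 ^ Nat.size s) :=
        Real.log_le_log (by exact_mod_cast hn) h1
    _ = Nat.size s * Real.log 2 := Real.log_pow _ _
    _ ≤ Nat.size s * 1 :=
        mul_le_mul_of_nonneg_left (by linarith [Real.log_two_lt_d9]) (Nat.cast_nonneg _)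
    _ = Nat.size s := mul_one _

/-- Since `2 ^ Nat.size s ≥ s`, making `γ ^ K` smaller than a high power of `1 / 2` beats every
fixed power of `s`. The extra powers absorb the constant and leave one factor `1 / s`. -/
theorem exists_depth_factor {γ : ℝ} (h0 : 0 < γ) (h1 : γ < 1) (A : ℝ) (c : ℕ) :
    ∃ K : ℕ, ∀ s : ℕ, 1 ≤ s → A * (s : ℝ) ^ c * γ ^ (K * Nat.size s) ≤ 1 / (4 * s) := by
  obtain ⟨m, hm⟩ := pow_unbounded_of_one_lt (|A| * 4) (one_lt_two : (1 : ℝ) < 2)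
  obtain ⟨K, hK⟩ := exists_pow_lt_of_lt_one (by positivity : (0 : ℝ) < (1 / 2) ^ (m + c + 1)) h1
  refine ⟨K, fun s hs => ?_⟩
  set L := Nat.size s
  have hs' : (0 : ℝ) < s := by exact_mod_cast hs
  have hsr : (s : ℝ) ≤ 2 ^ L := by exact_mod_cast (Nat.lt_size_self s).le
  set r : ℝ := 2 ^ L with hr
  have hr0 : 0 < r := by positivity
  have hL : 1 ≤ L := Nat.size_pos.2 hs
  have h2 : γ ^ (K * L) ≤ r⁻¹ ^ (m + c + 1) := by
    calc γ ^ (K * L) = (γ ^ K) ^ L := pow_mul _ _ _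
      _ ≤ ((1 / 2) ^ (m + c + 1)) ^ L := pow_le_pow_left₀ (by positivity) hK.le _
      _ = r⁻¹ ^ (m + c + 1) := by rw [← pow_mul, mul_comm, pow_mul, one_div, inv_pow]
  have h3 : |A| * 4 ≤ r ^ m := hm.le.trans (pow_le_pow_left₀ (by norm_num)
    (by rw [hr]; exact le_self_pow₀ (by norm_num) (by omega)) m)
  calc A * (s : ℝ) ^ c * γ ^ (K * L) ≤ |A| * r ^ c * r⁻¹ ^ (m + c + 1) := by
        gcongr
        exact le_abs_self A
    _ = (|A| * 4 / r ^ m) * (1 / (4 * r)) := by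
        rw [pow_add, pow_add, inv_pow, inv_pow, pow_one]
        field_simp
    _ ≤ 1 * (1 / (4 * s)) := by
        refine mul_le_mul ((div_le_one (by positivity)).2 h3) ?_ (by positivity) zero_le_one
        gcongr
    _ = 1 / (4 * s) := one_mul _

/-- A constant raised to a logarithm is a power. This turns bounds exponential in the depth or the
block size into polynomials. -/
theorem exists_pow_size_le (x : ℝ) (hx : 0 ≤ x) :
    ∃ e : ℕ, ∀ K s : ℕ, 1 ≤ s → x ^ (K * Nat.size s) ≤ (2 * s : ℝ) ^ (e * K) := by
  obtain ⟨e, he⟩ := pow_unbounded_of_one_lt x (one_lt_two : (1 : ℝ) < 2)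
  refine ⟨e, fun K s hs => ?_⟩
  calc x ^ (K * Nat.size s) ≤ (2 ^ e) ^ (K * Nat.size s) := pow_le_pow_left₀ hx he.le _
    _ = (2 ^ Nat.size s) ^ (e * K) := by rw [← pow_mul, ← pow_mul]; congr 1; ring
    _ ≤ (2 * s) ^ (e * K) :=
        pow_le_pow_left₀ (by positivity) (by exact_mod_cast two_pow_size_le hs) _

end Numerics

/-! ### The contraction function and the choice of truncations -/

section Delta

variable {q : ℕ} {β : ℝ}

theorem lt_of_low (hβ1 : β < 1) {d : ℕ} (hd : (d : ℝ) < ((q : ℝ) - 1) / (1 - β) - 2) :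
    2 * (1 - β) < (q : ℝ) - 1 - (1 - β) * d := by
  have h : (d : ℝ) + 2 < ((q : ℝ) - 1) / (1 - β) := by linarith
  rw [lt_div_iff₀ (by linarith)] at h
  linarith

theorem pottsDelta_of_low {d : ℕ} (hd : (d : ℝ) < ((q : ℝ) - 1) / (1 - β) - 2) :
    pottsDelta q β d = 2 * (1 - β) / ((q : ℝ) - 1 - (1 - β) * d) := by
  rw [pottsDelta, if_pos hd.le]

/-- The threshold of `pottsDelta` is not strict while low degree is strict; at the boundary the
formula gives 1, so both conventions agree. -/
theorem pottsDelta_of_not_low (hβ1 : β < 1) {d : ℕ}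
    (hd : ¬ (d : ℝ) < ((q : ℝ) - 1) / (1 - β) - 2) : pottsDelta q β d = 1 := by
  rw [pottsDelta]
  split_ifs with h
  · have h1 : (d : ℝ) = ((q : ℝ) - 1) / (1 - β) - 2 := le_antisymm h (not_lt.1 hd)
    have h2 : (1 - β) ≠ 0 := by linarith
    have h3 : (q : ℝ) - 1 - (1 - β) * d = 2 * (1 - β) := by
      rw [h1]; field_simp; ring
    rw [h3, div_self]
    simpa using h2
  · rfl

/-- The minimum of the contraction function. -/
noncomputable def minDelta (q : ℕ) (β : ℝ) : ℝ := 2 * (1 - β) / ((q : ℝ) - 1)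

theorem minDelta_pos (hq : 3 ≤ q) (hβ1 : β < 1) : 0 < minDelta q β := by
  have : (3 : ℝ) ≤ q := by exact_mod_cast hq
  exact div_pos (by linarith) (by linarith)

theorem minDelta_le (hq : 3 ≤ q) (hβ0 : 0 ≤ β) (hβ1 : β < 1) (d : ℕ) :
    minDelta q β ≤ pottsDelta q β d := by
  have hq' : (3 : ℝ) ≤ q := by exact_mod_cast hq
  by_cases hd : (d : ℝ) < ((q : ℝ) - 1) / (1 - β) - 2
  · have h := lt_of_low hβ1 hd
    rw [pottsDelta_of_low hd, minDelta]
    have : 0 ≤ (1 - β) * d := mul_nonneg (by linarith) (Nat.cast_nonneg d)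
    exact div_le_div_of_nonneg_left (by linarith) (by linarith) (by linarith)
  · rw [pottsDelta_of_not_low hβ1 hd, minDelta, div_le_one (by linarith)]
    linarith

theorem pottsDelta_pos (hq : 3 ≤ q) (hβ0 : 0 ≤ β) (hβ1 : β < 1) (d : ℕ) :
    0 < pottsDelta q β d := (minDelta_pos hq hβ1).trans_le (minDelta_le hq hβ0 hβ1 d)

/-- With `D = q - 1 - (1 - β) d`, contraction asks for `1 - r ≤ (1 - β) / D`, whereas the marginal
bound, with one edge kept in reserve, only needs `1 - r ≥ (1 - β) / (D + 2 - β)`. The gap leaves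
room for a rational `r` and for a strict second inequality, which survives small changes of `β`. Low
degree means `D > 2 (1 - β)`, hence `r > 1 / 2`. -/
theorem exists_truncation (hβ1 : β < 1) (d : ℕ) : ∃ r : ℚ, 1 / 2 ≤ (r : ℝ) ∧ (r : ℝ) ≤ 1 ∧
    ((d : ℝ) < ((q : ℝ) - 1) / (1 - β) - 2 → 2 * (1 - (r : ℝ)) ≤ pottsDelta q β d ∧
      1 - β < (1 - r) * (q - (1 - β) * (d - 1))) := by
  by_cases hd : (d : ℝ) < ((q : ℝ) - 1) / (1 - β) - 2
  · have h := lt_of_low hβ1 hd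
    set D := (q : ℝ) - 1 - (1 - β) * d with hD
    have hβ : 0 < 1 - β := by linarith
    have hD0 : 0 < D := by linarith
    have hD1 : 0 < D + 2 - β := by linarith
    have hlt : (1 - β) / (D + 2 - β) < (1 - β) / D :=
      div_lt_div_of_pos_left hβ hD0 (by linarith)
    have hpos : 0 < (1 - β) / (D + 2 - β) := div_pos hβ hD1
    have hhalf : (1 - β) / D < 1 / 2 := by
      rw [div_lt_div_iff₀ hD0 (by norm_num)]; linarith
    obtain ⟨r, hr1, hr2⟩ := exists_rat_btwn (sub_lt_sub_left hlt 1)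
    refine ⟨r, by linarith, by linarith, fun _ => ⟨?_, ?_⟩⟩
    · rw [pottsDelta_of_low hd, mul_div_assoc]
      linarith
    · have h2 : (1 - β) / (D + 2 - β) < 1 - r := by linarith
      rw [div_lt_iff₀ hD1] at h2
      have h3 : (q : ℝ) - (1 - β) * (d - 1) = D + 2 - β := by rw [hD]; ring
      rwa [h3]
  · exact ⟨1, by norm_num, by norm_num, fun h => absurd h hd⟩

end Delta

/-! ### Encodings of numbers and the table of truncations -/

namespace Lisp

theorem Data.toNat_binary (m : ℕ) : (Data.binary m).toNat = m := by
  induction m using Nat.binaryRec' with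
  | zero => simp [Data.binary]
  | bit b m h ih =>
    rw [Data.binary, Nat.bits_append_bit m b h, List.map_cons, Data.ofList_cons,
      Data.toNat_cons]
    rw [Data.binary] at ih
    rw [ih, Nat.bit_val]
    cases b <;> simp [Data.ofBool]

theorem Data.len_binary (m : ℕ) : (Data.binary m).len = Nat.size m := by
  rw [Data.binary, Data.len_ofList, List.length_map, Nat.size_eq_bits_len]

theorem Data.len_le_size (d : Data) : d.len ≤ d.size := by
  induction d with
  | nil => simp
  | cons a b _ ih => rw [Data.len_cons, Data.size_cons]; have := a.one_le_size; omega

theorem exists_isFrac (r : ℚ) (hr : 0 ≤ r) : ∃ v : Data, IsFrac v r v.size := by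
  refine ⟨.cons (.binary r.num.toNat) (.binary r.den), _, _, rfl, ?_, ?_, ?_, ?_⟩
  · rw [Data.toNat_binary]; exact r.pos
  · rw [Data.toNat_binary, Data.toNat_binary]
    have h1 : ((r.num.toNat : ℕ) : ℝ) = (r.num : ℝ) := by
      have := Int.toNat_of_nonneg (Rat.num_nonneg.2 hr)
      exact_mod_cast this
    rw [h1]
    exact (Rat.cast_def r).symm
  · refine (Data.len_le_size _).trans ?_
    rw [Data.size_cons]; omega
  · refine (Data.len_le_size _).trans ?_
    rw [Data.size_cons]; omega

/-- An entry of a table. -/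
def Data.entry (T : Data) (d : ℕ) : Data := ((Data.snd)^[d] T).fst

theorem Data.entry_ofList (l : List Data) (d : ℕ) :
    (Data.ofList l).entry d = l.getD d .nil := by
  induction l generalizing d with
  | nil =>
    have : (Data.snd)^[d] .nil = .nil := Function.iterate_fixed rfl d
    simp [Data.entry, this]
  | cons a l ih =>
    cases d with
    | zero => simp [Data.entry]
    | succ d =>
      have := ih d
      simpa [Data.entry] using this

theorem Data.size_snd_le (T : Data) : T.snd.size ≤ T.size := by
  cases T with
  | nil => simp
  | cons a b => rw [Data.snd_cons, Data.size_cons]; omega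

theorem Data.size_entry_le (T : Data) (d : ℕ) : (T.entry d).size ≤ T.size := by
  induction d generalizing T with
  | zero =>
    cases T with
    | nil => simp [Data.entry]
    | cons a b =>
      simp only [Data.entry, Function.iterate_zero, id_eq, Data.fst_cons, Data.size_cons]
      omega
  | succ d ih => exact (ih T.snd).trans T.size_snd_le

/-- The table of the truncations. -/
theorem exists_table (q : ℕ) {β : ℝ} (hβ1 : β < 1) :
    ∃ (T : Data) (ρ : ℕ → ℝ) (η : ℝ), 0 < η ∧ (∀ d, 1 / 2 ≤ ρ d ∧ ρ d ≤ 1) ∧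
      (∀ d : ℕ, (d : ℝ) < ((q : ℝ) - 1) / (1 - β) - 2 → IsFrac (T.entry d) (ρ d) T.size ∧
        2 * (1 - ρ d) ≤ pottsDelta q β d ∧
        ∀ b, |b - β| < η → 1 - b ≤ (1 - ρ d) * (q - (1 - b) * (d - 1))) ∧
      ∀ d : ℕ, ¬ (d : ℝ) < ((q : ℝ) - 1) / (1 - β) - 2 → T.entry d = .nil := by
  choose r hr1 hr2 hr3 using exists_truncation (q := q) hβ1
  have hr0 : ∀ d, 0 ≤ r d := fun d => by
    have : (0 : ℝ) ≤ r d := by linarith [hr1 d]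
    exact_mod_cast this
  choose f hf using fun d => exists_isFrac (r d) (hr0 d)
  set D := ⌈((q : ℝ) - 1) / (1 - β) - 2⌉₊ with hD
  -- Only finitely many degrees are low, so continuity in `b` gives one neighbourhood of `β` that
  -- works for all of them.
  have hη : ∃ η > 0, ∀ b, |b - β| < η → ∀ d ∈ Finset.range D,
      1 - b < (1 - r d) * (q - (1 - b) * (d - 1)) := by
    have : ∀ᶠ b : ℝ in nhds β, ∀ d ∈ Finset.range D,
        1 - b < (1 - r d) * (q - (1 - b) * (d - 1)) := by
      rw [Filter.eventually_all_finset]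
      intro d hd
      have h := (hr3 d (Nat.lt_ceil.1 (Finset.mem_range.1 hd))).2
      exact ContinuousAt.eventually_lt (f := fun b : ℝ => 1 - b)
        (g := fun b : ℝ => (1 - (r d : ℝ)) * (q - (1 - b) * (d - 1)))
        (by fun_prop) (by fun_prop) h
    obtain ⟨η, h1, h2⟩ := Metric.eventually_nhds_iff.1 this
    exact ⟨η, h1, fun b hb => h2 (by rwa [Real.dist_eq])⟩
  obtain ⟨η, hη0, hη⟩ := hη
  have hentry : ∀ d, (Data.ofList ((List.range D).map f)).entry d =
      if d < D then f d else .nil := fun d => by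
    rw [Data.entry_ofList]
    split_ifs with h <;> simp [h]
  refine ⟨.ofList ((List.range D).map f), fun d => r d, η, hη0, fun d => ⟨hr1 d, hr2 d⟩,
    fun d hd => ?_, fun d hd => ?_⟩
  · have hlt : d < D := Nat.lt_ceil.2 hd
    refine ⟨?_, (hr3 d hd).1, fun b hb => (hη b hb d (Finset.mem_range.2 hlt)).le⟩
    have := (Data.ofList ((List.range D).map f)).size_entry_le d
    rw [hentry, if_pos hlt] at this ⊢
    exact (hf d).mono this
  · rw [hentry, if_neg fun h => hd (Nat.lt_ceil.1 h)]

end Lisp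

/-! ### Graphs with a contraction function and local sparsity -/

section Sparse

open scoped Classical

variable {n q : ℕ} {β : ℝ} {G : SimpleGraph (Fin n)} {γ : ℝ} {c s : ℕ}

/-- The weight of the vertices. -/
noncomputable def vertexDelta (q : ℕ) (β : ℝ) (G : SimpleGraph (Fin n)) (w : Fin n) : ℝ :=
  pottsDelta q β (vdeg G w)

/-- The bound for the sums over self-avoiding walks, with a number `s` in place of `|V|`. -/
def SawBound (q : ℕ) (β : ℝ) (G : SimpleGraph (Fin n)) (γ : ℝ) (c s : ℕ) : Prop :=
  ∀ (v : Fin n) (l : ℕ), 1 ≤ l → sawSum G (pottsDelta q β) v l ≤ (s : ℝ) ^ c * γ ^ l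

theorem avoidTail_le (h0 : 0 < γ) (h1 : γ < 1) (h : SawBound q β G γ c s) {d : ℕ} (hd : 1 ≤ d)
    (v : Fin n) : avoidTail G (vertexDelta q β G) d ∅ v ≤ (s : ℝ) ^ c * (γ ^ d / (1 - γ)) := by
  unfold avoidTail
  calc _ ≤ ∑ l ∈ Finset.Ico d ((∅ : Finset (Fin n))ᶜ.card + 1), (s : ℝ) ^ c * γ ^ l := by
        refine Finset.sum_le_sum fun l hl => ?_
        have : avoidSum G (vertexDelta q β G) l ∅ v = sawSum G (pottsDelta q β) v l :=
          avoidSum_empty_eq_sawSum (pottsDelta q β) l v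
        rw [this]
        exact h v l (hd.trans (Finset.mem_Ico.1 hl).1)
    _ = (s : ℝ) ^ c * ∑ l ∈ Finset.Ico d ((∅ : Finset (Fin n))ᶜ.card + 1), γ ^ l :=
        (Finset.mul_sum _ _ _).symm
    _ ≤ _ := mul_le_mul_of_nonneg_left (geom_sum_Ico_le_of_lt_one h0.le h1) (by positivity)

theorem avoidTail_zero_le (h0 : 0 < γ) (h1 : γ < 1) (h : SawBound q β G γ c s) (hs : 1 ≤ s)
    (v : Fin n) : avoidTail G (vertexDelta q β G) 0 ∅ v ≤ 2 / (1 - γ) * (s : ℝ) ^ c := by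
  have h2 := avoidTail_le h0 h1 h le_rfl v
  have h3 : avoidTail G (vertexDelta q β G) 0 ∅ v =
      1 + avoidTail G (vertexDelta q β G) 1 ∅ v := by
    unfold avoidTail
    rw [Finset.sum_eq_sum_Ico_succ_bot (by omega)]
    rfl
  have h4 : (1 : ℝ) ≤ (s : ℝ) ^ c := one_le_pow₀ (by exact_mod_cast hs)
  have h5 : 0 < 1 - γ := by linarith
  have h6 : 1 ≤ 1 / (1 - γ) := by rw [le_div_iff₀ h5]; linarith
  have h7 : γ ^ 1 / (1 - γ) ≤ 1 / (1 - γ) := by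
    rw [pow_one]; exact div_le_div_of_nonneg_right h1.le h5.le
  rw [h3]
  calc 1 + avoidTail G (vertexDelta q β G) 1 ∅ v ≤
        1 / (1 - γ) * (s : ℝ) ^ c + (s : ℝ) ^ c * (1 / (1 - γ)) := by
        refine add_le_add ?_ (h2.trans (mul_le_mul_of_nonneg_left h7 (by positivity)))
        nlinarith
    _ = _ := by ring

theorem pow_countP_le_prod {α : Type*} (l : List α) (p : α → Prop) (δ : α → ℝ) {a : ℝ}
    (ha : 0 ≤ a) (h1 : ∀ x ∈ l, p x → a ≤ δ x) (h2 : ∀ x ∈ l, ¬ p x → 1 ≤ δ x) :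
    a ^ (l.countP fun x => p x) ≤ (l.map δ).prod := by
  induction l with
  | nil => simp
  | cons x l ih =>
    have hi := ih (fun y hy => h1 y (List.mem_cons_of_mem _ hy))
      fun y hy => h2 y (List.mem_cons_of_mem _ hy)
    have h0 : 0 ≤ a ^ (l.countP fun x => p x) := pow_nonneg ha _
    rw [List.map_cons, List.prod_cons]
    by_cases hx : p x
    · rw [List.countP_cons_of_pos (by simpa using hx), pow_succ']
      exact mul_le_mul (h1 x List.mem_cons_self hx) hi h0 (ha.trans (h1 x List.mem_cons_self hx))
    · rw [List.countP_cons_of_neg (by simpa using hx)]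
      have := h2 x List.mem_cons_self hx
      nlinarith

/-- High-degree vertices have `δ = 1`, so a path with at most `m` low-degree vertices after its
start weighs at least `minDelta ^ m`. The contraction bound decays exponentially in the length;
comparing logarithms bounds the length. -/
theorem path_length_le (hq : 3 ≤ q) (hβ0 : 0 ≤ β) (hβ1 : β < 1) (h0 : 0 < γ) (h1 : γ < 1)
    (h : SawBound q β G γ c s) (hs : 1 ≤ s) {u v : Fin n} (p : G.Walk u v) (hp : p.IsPath)
    (hl : 1 ≤ p.length) {m : ℕ}
    (hm : (p.support.tail.countP fun w => IsLowDegree q β G w) ≤ m) :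
    (p.length : ℝ) * (-Real.log γ) ≤ c * Nat.size s + m * (-Real.log (minDelta q β)) := by
  have hδ := minDelta_pos hq hβ1
  have hδ1 : minDelta q β ≤ 1 := by
    have hq' : (3 : ℝ) ≤ q := by exact_mod_cast hq
    rw [minDelta, div_le_one (by linarith)]; linarith
  have h2 : minDelta q β ^ m ≤ (s : ℝ) ^ c * γ ^ p.length := by
    calc minDelta q β ^ m ≤ minDelta q β ^ (p.support.tail.countP fun w => IsLowDegree q β G w) :=
          pow_le_pow_of_le_one hδ.le hδ1 hm
      _ ≤ walkWeight (fun w => pottsDelta q β (vdeg G w)) p :=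
          pow_countP_le_prod _ (IsLowDegree q β G) _ hδ.le
            (fun w _ _ => minDelta_le hq hβ0 hβ1 _)
            fun w _ hw => (pottsDelta_of_not_low hβ1 hw).ge
      _ ≤ sawSum G (pottsDelta q β) u p.length :=
          walkWeight_le_sawSum _ (fun d => (pottsDelta_pos hq hβ0 hβ1 d).le) p hp
      _ ≤ _ := h u p.length hl
  have hs0 : (0 : ℝ) < s := by exact_mod_cast hs
  have h3 := Real.log_le_log (by positivity) h2
  rw [Real.log_mul (by positivity) (by positivity), Real.log_pow, Real.log_pow, Real.log_pow] at h3
  have h4 : (c : ℝ) * Real.log s ≤ c * Nat.size s :=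
    mul_le_mul_of_nonneg_left (log_le_size le_rfl) (Nat.cast_nonneg c)
  linarith

/-- The bound of local sparsity. -/
def BlockSparse (q : ℕ) (β : ℝ) (G : SimpleGraph (Fin n)) (C : ℝ) : Prop :=
  ∀ (u v : Fin n) (P : G.Walk u v), P.IsPath → 1 ≤ P.length →
    ((permissiveBlock q β G {w | w ∈ P.support}).ncard : ℝ) ≤ C * (P.length + Real.log n)

/-- Local sparsity speaks of paths with an edge. A single vertex is enlarged to an edge if it has a
neighbour, and otherwise is its own block. -/
theorem ncard_block_le {C : ℝ} (hC : 0 < C) (h : BlockSparse q β G C) {u v : Fin n}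
    (p : G.Walk u v) (hp : p.IsPath) :
    ((permissiveBlock q β G {w | w ∈ p.support}).ncard : ℝ) ≤
      1 + C * (1 + p.length + Real.log n) := by
  have hlog : 0 ≤ Real.log n := Real.log_natCast_nonneg n
  rcases Nat.eq_zero_or_pos p.length with h0 | h0
  · cases p with
    | cons _ _ => simp at h0
    | nil =>
      by_cases hadj : ∃ w, G.Adj u w
      · obtain ⟨w, hw⟩ := hadj
        have h2 := h u w (.cons hw .nil) (by simp [hw.ne]) (by simp)
        have h3 : (permissiveBlock q β G
              {x | x ∈ (SimpleGraph.Walk.nil : G.Walk u u).support}).ncard ≤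
            (permissiveBlock q β G {x | x ∈ (SimpleGraph.Walk.cons hw .nil).support}).ncard := by
          refine Set.ncard_le_ncard (permissiveBlock_mono fun x hx => ?_) (Set.toFinite _)
          simp only [SimpleGraph.Walk.support_nil, List.mem_singleton, Set.mem_ofPred_eq] at hx
          simp [hx]
        have h3' : ((permissiveBlock q β G
            {x | x ∈ (SimpleGraph.Walk.nil : G.Walk u u).support}).ncard : ℝ) ≤
            (permissiveBlock q β G {x | x ∈ (SimpleGraph.Walk.cons hw .nil).support}).ncard := by
          exact_mod_cast h3
        simp only [SimpleGraph.Walk.length_cons, SimpleGraph.Walk.length_nil] at h2 ⊢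
        push_cast at h2 ⊢
        nlinarith
      · have h2 : permissiveBlock q β G {x | x ∈ (SimpleGraph.Walk.nil : G.Walk u u).support} ⊆
            {u} := by
          refine (permissiveBlock_isLeast q β G _).2 ⟨fun x hx => by simpa using hx, ?_⟩
          rintro x - ⟨w, rfl, hxw⟩
          exact absurd ⟨x, hxw.symm⟩ hadj
        have h3 := Set.ncard_le_ncard h2 (Set.toFinite _)
        rw [Set.ncard_singleton] at h3
        have h3' : ((permissiveBlock q β G
          {x | x ∈ (SimpleGraph.Walk.nil : G.Walk u u).support}).ncard : ℝ) ≤ 1 := by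
            exact_mod_cast h3
        have : 0 ≤ C * (1 + ((SimpleGraph.Walk.nil : G.Walk u u).length : ℝ) + Real.log n) := by
          positivity
        linarith
  · have := h u v p hp h0
    nlinarith

/-- Logarithmically many low-degree vertices mean a path of logarithmic length, and then local
sparsity gives a block of logarithmic size. -/
theorem exists_blockBound (hq : 3 ≤ q) (hβ0 : 0 ≤ β) (hβ1 : β < 1) (h0 : 0 < γ) (h1 : γ < 1)
    (c : ℕ) {C : ℝ} (hC : 0 < C) (K : ℕ) :
    ∃ c' : ℕ, ∀ (n s : ℕ) (G : SimpleGraph (Fin n)), n ≤ s → 1 ≤ s → SawBound q β G γ c s →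
      BlockSparse q β G C → ∀ v, BlockBound G q β v (K * Nat.size s) (c' * Nat.size s) := by
  have hg : 0 < -Real.log γ := by linarith [Real.log_neg h0 h1]
  have hδ1 : minDelta q β ≤ 1 := by
    have hq' : (3 : ℝ) ≤ q := by exact_mod_cast hq
    rw [minDelta, div_le_one (by linarith)]; linarith
  have hd : 0 ≤ -Real.log (minDelta q β) := by
    linarith [Real.log_nonpos (minDelta_pos hq hβ1).le hδ1]
  set a := (c + K * (-Real.log (minDelta q β))) / (-Real.log γ) with ha
  refine ⟨⌈1 + C * (2 + a)⌉₊, fun n s G hns hs h hB v w p hp hm => ?_⟩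
  have hL : (1 : ℝ) ≤ Nat.size s := by exact_mod_cast Nat.size_pos.2 hs
  have hlen : (p.length : ℝ) ≤ a * Nat.size s := by
    rcases Nat.eq_zero_or_pos p.length with hl | hl
    · rw [hl, Nat.cast_zero]; positivity
    · have h2 := path_length_le hq hβ0 hβ1 h0 h1 h hs p hp hl hm
      rw [ha, div_mul_eq_mul_div, le_div_iff₀ hg]
      push_cast at h2
      linarith
  have h3 := ncard_block_le hC hB p hp
  have h4 := log_le_size hns
  have h5 : ((permissiveBlock q β G {w | w ∈ p.support}).ncard : ℝ) ≤
      (1 + C * (2 + a)) * Nat.size s := by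
    refine h3.trans ?_
    have : C * (1 + p.length + Real.log n) ≤ C * (Nat.size s + a * Nat.size s + Nat.size s) :=
      mul_le_mul_of_nonneg_left (by linarith) hC.le
    linarith
  have h6 : (1 + C * (2 + a)) * Nat.size s ≤ ⌈1 + C * (2 + a)⌉₊ * (Nat.size s : ℝ) :=
    mul_le_mul_of_nonneg_right (Nat.le_ceil _) (by linarith)
  exact_mod_cast h5.trans h6

theorem exists_cost_bound (hq : 3 ≤ q) (hβ0 : 0 ≤ β) (hβ1 : β < 1) (h0 : 0 < γ) (h1 : γ < 1)
    (c : ℕ) {C : ℝ} (hC : 0 < C) (K : ℕ) :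
    ∃ c' e : ℕ, ∀ (n s : ℕ) (G : SimpleGraph (Fin n)), n ≤ s → 1 ≤ s → SawBound q β G γ c s →
      BlockSparse q β G C → ∀ (R : Finset (Fin n)) (v : Fin n), v ∉ R →
      recCost G (IsLowDegree q β G) q (K * Nat.size s) R [v] [] ≤ c' * (2 * s) ^ e ∧
      recCost G (IsLowDegree q β G) q (K * Nat.size s) (insert v R)
        (highNbrs G (IsLowDegree q β G) R v) [] ≤ c' * (2 * s) ^ e := by
  obtain ⟨M, hM⟩ := exists_blockBound hq hβ0 hβ1 h0 h1 c hC K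
  -- The inverse of the minimum of `δ` compensates for one low-degree vertex; 5 is the least weight
  -- that the node count permits.
  set κ := max 5 (minDelta q β)⁻¹ with hκ
  have hκ0 : 0 ≤ κ := le_trans (by norm_num) (le_max_left _ _)
  obtain ⟨e₁, he₁⟩ := exists_pow_size_le (8 * q) (by positivity)
  obtain ⟨e₂, he₂⟩ := exists_pow_size_le κ hκ0
  refine ⟨⌈4 * κ / (1 - γ)⌉₊, e₁ * M + e₂ * K + c, fun n s G hns hs h hB R v hv => ?_⟩
  have hδ := minDelta_pos hq hβ1
  have hroot := recCost_root_le (G := G) (q := q) (β := β) (δ := vertexDelta q β G) (κ := κ)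
    (fun w => (pottsDelta_pos hq hβ0 hβ1 _).le) (fun w hw => pottsDelta_of_not_low hβ1 hw)
    (le_max_left _ _)
    (fun w => by
      calc (1 : ℝ) = (minDelta q β)⁻¹ * minDelta q β := (inv_mul_cancel₀ hδ.ne').symm
        _ ≤ κ * vertexDelta q β G w :=
          mul_le_mul (le_max_right _ _) (minDelta_le hq hβ0 hβ1 _) hδ.le hκ0)
    (by omega) (hM n s G hns hs h hB v) hv
  have h5 : 0 < 1 - γ := by linarith
  have hs' : (1 : ℝ) ≤ s := by exact_mod_cast hs
  have hbound : (8 * (q : ℝ)) ^ (M * Nat.size s) *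
      (2 * stackWeight G (vertexDelta q β G) κ (K * Nat.size s) ∅ v) ≤
      ((⌈4 * κ / (1 - γ)⌉₊ * (2 * s) ^ (e₁ * M + e₂ * K + c) : ℕ) : ℝ) := by
    have h2 := he₁ M s hs
    have h3 := he₂ K s hs
    have h4 := avoidTail_zero_le h0 h1 h hs v
    have h6 : (s : ℝ) ^ c ≤ (2 * s : ℝ) ^ c := pow_le_pow_left₀ (by linarith) (by linarith) c
    have h7 : 0 ≤ avoidTail G (vertexDelta q β G) 0 ∅ v :=
      avoidTail_nonneg (fun w => (pottsDelta_pos hq hβ0 hβ1 _).le) _ _ _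
    unfold stackWeight
    push_cast
    calc (8 * (q : ℝ)) ^ (M * Nat.size s) * (2 * (κ ^ (K * Nat.size s + 1) *
          avoidTail G (vertexDelta q β G) 0 ∅ v)) ≤
        (2 * s) ^ (e₁ * M) * (2 * ((2 * s) ^ (e₂ * K) * κ * (2 / (1 - γ) * (2 * s) ^ c))) := by
          rw [pow_succ]
          gcongr
          exact h4.trans (mul_le_mul_of_nonneg_left h6 (by positivity))
      _ = (4 * κ / (1 - γ)) * (2 * s) ^ (e₁ * M + e₂ * K + c) := by
          rw [pow_add, pow_add]; ring
      _ ≤ _ := mul_le_mul_of_nonneg_right (Nat.le_ceil _) (by positivity)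
  exact ⟨by exact_mod_cast hroot.1.trans hbound, by exact_mod_cast hroot.2.trans hbound⟩

end Sparse

/-! ### The approximation of the activity -/

section Activity

open scoped Classical

theorem RelClose.pow {E x y : ℝ} (h : RelClose E x y) (hx : 0 ≤ x) (hy : 0 ≤ y) (m : ℕ) :
    RelClose (m * E) (x ^ m) (y ^ m) := by
  have h1 := pow_le_pow_left₀ hx h.1 m
  have h2 := pow_le_pow_left₀ hy h.2 m
  rw [mul_pow, ← Real.exp_nat_mul] at h1 h2
  exact ⟨h1, h2⟩

variable {n q : ℕ}

theorem monoEdges_le (G : SimpleGraph (Fin n)) (σ : Fin n → Fin q) : monoEdges G σ ≤ n * n := by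
  unfold monoEdges
  refine (Set.ncard_le_ncard (Set.subset_univ _) (Set.toFinite _)).trans ?_
  rw [Set.ncard_univ, Nat.card_eq_fintype_card]
  refine (Fintype.card_le_of_surjective (fun p : Fin n × Fin n => s(p.1, p.2)) ?_).trans (by simp)
  intro e
  induction e with
  | h x y => exact ⟨(x, y), rfl⟩

theorem pottsZ_close (G : SimpleGraph (Fin n)) {b β E : ℝ} (hb : 0 ≤ b) (hβ : 0 ≤ β)
    (hE : 0 ≤ E) (h : RelClose E b β) :
    RelClose (n * n * E) (pottsZ G q b) (pottsZ G q β) := by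
  unfold pottsZ
  refine RelClose.sum _ fun σ _ => ?_
  refine (h.pow hb hβ _).mono ?_ (pow_nonneg hb _) (pow_nonneg hβ _)
  refine mul_le_mul_of_nonneg_right ?_ hE
  exact_mod_cast monoEdges_le G σ

theorem relClose_of_abs_sub_le {b β u : ℝ} (hβ : 0 < β) (hu : u ≤ 1 / 2)
    (h : |b - β| ≤ u * β) : RelClose (2 * u) b β := by
  obtain ⟨h1, h2⟩ := abs_le.1 h
  have hu0 : 0 ≤ u := by
    by_contra hcon
    nlinarith [abs_nonneg (b - β)]
  have h3 := Real.add_one_le_exp (2 * u)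
  constructor
  · nlinarith
  · have h4 : (1 - u) * β ≤ b := by linarith
    -- This is equivalent to `2 * u ^ 2 ≤ u`, hence the restriction `u ≤ 1 / 2`.
    have h5 : 1 ≤ (2 * u + 1) * (1 - u) := by nlinarith
    calc β = 1 * β := (one_mul β).symm
      _ ≤ (2 * u + 1) * (1 - u) * β := mul_le_mul_of_nonneg_right h5 hβ.le
      _ = (2 * u + 1) * ((1 - u) * β) := by ring
      _ ≤ (2 * u + 1) * b := mul_le_mul_of_nonneg_left h4 (by linarith)
      _ ≤ Real.exp (2 * u) * b :=
        mul_le_mul_of_nonneg_right h3 (le_trans (mul_nonneg (by linarith) hβ.le) h4)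

theorem pottsZ_nonneg (G : SimpleGraph (Fin n)) {b : ℝ} (hb : 0 ≤ b) : 0 ≤ pottsZ G q b :=
  Finset.sum_nonneg fun _ _ => pow_nonneg hb _

theorem pottsZ_pos (G : SimpleGraph (Fin n)) {b : ℝ} (hb : 0 < b) (hq : 0 < q) :
    0 < pottsZ G q b := by
  unfold pottsZ
  refine Finset.sum_pos (fun _ _ => pow_pos hb _) ?_
  exact ⟨fun _ => ⟨0, hq⟩, @Finset.mem_univ _ (_) _⟩

theorem pottsZ_zero_pos (G : SimpleGraph (Fin n)) (h : G.Colorable q) : 0 < pottsZ G q 0 := by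
  obtain ⟨C⟩ := h
  unfold pottsZ
  refine Finset.sum_pos' (fun _ _ => pow_nonneg le_rfl _) ?_
  refine ⟨C, @Finset.mem_univ _ (_) _, ?_⟩
  have : monoEdges G (C : Fin n → Fin q) = 0 := by
    unfold monoEdges
    rw [Set.ncard_eq_zero (Set.toFinite _), Set.eq_empty_iff_forall_notMem]
    rintro e ⟨h1, h2⟩
    induction e with
    | h x y => exact C.valid h1 (by simpa using h2)
  rw [pottsWeight, this, pow_zero]
  exact one_pos

end Activity

/-! ### Polynomial bounds -/

section PolyBounded

/-- The function `f` is bounded by a polynomial. -/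
def PolyBounded (f : ℕ → ℕ) : Prop := ∃ p : Polynomial ℕ, ∀ s, f s ≤ p.eval s

theorem PolyBounded.const (c : ℕ) : PolyBounded fun _ => c := ⟨.C c, fun s => by simp⟩

theorem PolyBounded.id : PolyBounded fun s => s := ⟨.X, fun s => by simp⟩

theorem PolyBounded.add {f g : ℕ → ℕ} (hf : PolyBounded f) (hg : PolyBounded g) :
    PolyBounded fun s => f s + g s := by
  obtain ⟨p, hp⟩ := hf
  obtain ⟨r, hr⟩ := hg
  exact ⟨p + r, fun s => by rw [Polynomial.eval_add]; exact add_le_add (hp s) (hr s)⟩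

theorem PolyBounded.mul {f g : ℕ → ℕ} (hf : PolyBounded f) (hg : PolyBounded g) :
    PolyBounded fun s => f s * g s := by
  obtain ⟨p, hp⟩ := hf
  obtain ⟨r, hr⟩ := hg
  exact ⟨p * r, fun s => by rw [Polynomial.eval_mul]; exact Nat.mul_le_mul (hp s) (hr s)⟩

theorem PolyBounded.pow {f : ℕ → ℕ} (hf : PolyBounded f) (e : ℕ) :
    PolyBounded fun s => f s ^ e := by
  obtain ⟨p, hp⟩ := hf
  exact ⟨p ^ e, fun s => by rw [Polynomial.eval_pow]; exact Nat.pow_le_pow_left (hp s) e⟩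

namespace Lisp

variable {k m X A cost tb : ℕ → ℕ}

theorem polyBounded_stepTime (q : ℕ) (hk : PolyBounded k) (hm : PolyBounded m)
    (hX : PolyBounded X) (hA : PolyBounded A) :
    PolyBounded fun s => stepTime s q (k s) (m s) (X s) (A s) := by
  unfold stepTime
  repeat' first
    | with_reducible assumption
    | with_reducible apply PolyBounded.add
    | with_reducible apply PolyBounded.mul
    | with_reducible exact PolyBounded.const _
    | with_reducible exact PolyBounded.id
    | with_reducible apply PolyBounded.pow

theorem polyBounded_factorTime (q : ℕ) (hk : PolyBounded k) (hm : PolyBounded m)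
    (hX : PolyBounded X) (hA : PolyBounded A) (hc : PolyBounded cost) :
    PolyBounded fun s => factorTime s q (k s) (m s) (X s) (A s) (cost s) := by
  have := polyBounded_stepTime q hk hm hX hA
  unfold factorTime
  repeat' first
    | with_reducible assumption
    | with_reducible apply PolyBounded.add
    | with_reducible apply PolyBounded.mul
    | with_reducible exact PolyBounded.const _
    | with_reducible exact PolyBounded.id
    | with_reducible apply PolyBounded.pow

theorem polyBounded_mainTime (K q sT : ℕ) (hk : PolyBounded k) (hm : PolyBounded m)
    (hX : PolyBounded X) (hA : PolyBounded A) (hc : PolyBounded cost) (ht : PolyBounded tb) :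
    PolyBounded fun s => mainTime K s s q (k s) (m s) (X s) (A s) (cost s) (tb s) sT := by
  have := polyBounded_factorTime q hk hm hX hA hc
  unfold mainTime
  repeat' first
    | with_reducible assumption
    | with_reducible apply PolyBounded.add
    | with_reducible apply PolyBounded.mul
    | with_reducible exact PolyBounded.const _
    | with_reducible exact PolyBounded.id

theorem mainTime_mono {K n N q k m X A cost tb sT s m' X' A' : ℕ} (hn : n ≤ s) (hN : N ≤ s)
    (hm : m ≤ m') (hX : X ≤ X') (hA : A ≤ A') :
    mainTime K n N q k m X A cost tb sT ≤ mainTime K s s q k m' X' A' cost tb sT := by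
  unfold mainTime factorTime stepTime
  gcongr

end Lisp

end PolyBounded

/-! ### The algorithm -/

section Algorithm

open scoped Classical

/-- The code for the activity, in the environment of the main function. -/
noncomputable def activityCode (β : ℝ) : Lisp.Code :=
  if β = 0 then .const .fracZero
  else .cons (.fst (.snd (.snd (.snd (.var 3))))) (.call 20 (.fst (.snd (.snd (.var 3)))))

/-- The activity that the algorithm uses. -/
noncomputable def approxActivity (β : ℝ) (a k : ℕ) : ℝ := if β = 0 then 0 else a / 2 ^ k

theorem wp_activityCode {K q : ℕ} {T : Lisp.Data} {β : ℝ} {a k : ℕ} (ha : a ≤ 2 ^ k)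
    (x y z G N : Lisp.Data) :
    Lisp.WP (Lisp.pottsProgram K q T (activityCode β))
      [x, y, z, .ofList [G, N, .unary k, .binary a]] (activityCode β)
      fun v t => Lisp.IsFrac v (approxActivity β a k) (k + 1) ∧ t ≤ 20 * (k + 1) + 50 := by
  have B := (Lisp.ratioProg_pottsProgram K q T (activityCode β)).toListProg
  by_cases hβ : β = 0
  · rw [show activityCode β = .const .fracZero from if_pos hβ,
      show approxActivity β a k = 0 from if_pos hβ, Lisp.wp_const]
    refine ⟨Lisp.isFrac_fracZero.mono (by omega), ?_⟩
    simp only [Lisp.Data.fracZero, Lisp.Data.oneNat, Lisp.Data.one, Lisp.Data.size_cons,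
      Lisp.Data.size_nil]
    omega
  · have h2 : activityCode β = .cons (.fst (.snd (.snd (.snd (.var 3)))))
        (.call 20 (.fst (.snd (.snd (.var 3))))) := if_neg hβ
    rw [show approxActivity β a k = a / 2 ^ k from if_neg hβ]
    generalize Lisp.pottsProgram K q T (activityCode β) = prog at B
    rw [h2]
    simp only [Lisp.wp_cons, Lisp.wp_fst, Lisp.wp_snd, Lisp.wp_var, Lisp.wp_call,
      Lisp.Data.ofList_cons, List.getElem?_cons_succ, List.getElem?_cons_zero, Option.some.injEq,
      exists_eq_left', Lisp.Data.fst_cons, Lisp.Data.snd_cons]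
    refine (Lisp.calls_powTwo B k).mono fun v t ⟨h3, h4, h5⟩ => ⟨⟨_, _, rfl, ?_, ?_, ?_, ?_⟩, ?_⟩
    · rw [h3]; positivity
    · rw [h3, Lisp.Data.toNat_binary]; push_cast; rfl
    · rw [Lisp.Data.len_binary, Nat.size_le, pow_succ]
      have : 0 < 2 ^ k := by positivity
      omega
    · omega
    · omega

variable {n q : ℕ} {β : ℝ}

/-- The constant `log 2` comes from `ρ ≥ 1 / 2`, and dividing it by the minimum of `δ` makes the
depth 0 error at most `c₁ * δ`. The weights `δ` belong to `β`, while the marginal bounds hold for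
the activity `b` in use. -/
theorem decayData (hq : 3 ≤ q) (hβ0 : 0 ≤ β) (hβ1 : β < 1) (G : SimpleGraph (Fin n))
    {ρ : ℕ → ℝ} {b : ℝ} (hb0 : 0 ≤ b) (hb1 : b ≤ 1) (hρ : ∀ d, 1 / 2 ≤ ρ d ∧ ρ d ≤ 1)
    (hlow : ∀ d : ℕ, (d : ℝ) < ((q : ℝ) - 1) / (1 - β) - 2 → 2 * (1 - ρ d) ≤ pottsDelta q β d ∧
      1 - b ≤ (1 - ρ d) * (q - (1 - b) * (d - 1))) :
    DecayData G (IsLowDegree q β G) q b (fun v => ρ (vdeg G v)) (vertexDelta q β G) (Real.log 2)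
      (Real.log 2 / minDelta q β) where
  b_nonneg := hb0
  b_le_one := hb1
  q_pos := by omega
  ρ_nonneg w := le_trans (by norm_num) (hρ _).1
  ρ_le_one w _ := (hρ _).2
  exp_le_ρ w _ := by
    rw [Real.exp_neg, Real.exp_log two_pos, inv_eq_one_div]
    exact (hρ _).1
  c₀_nonneg := Real.log_nonneg one_le_two
  c₁_nonneg := div_nonneg (Real.log_nonneg one_le_two) (minDelta_pos hq hβ1).le
  marginal w hw := (hlow _ hw).2
  δ_nonneg w := (pottsDelta_pos hq hβ0 hβ1 _).le
  contraction w hw := (hlow _ hw).1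
  δ_high w hw := pottsDelta_of_not_low hβ1 hw
  c₀_le w _ := by
    rw [div_mul_eq_mul_div, le_div_iff₀ (minDelta_pos hq hβ1)]
    exact mul_le_mul_of_nonneg_left (minDelta_le hq hβ0 hβ1 _) (Real.log_nonneg one_le_two)

/-- Each of the at most `s` vertex factors contributes a tail of walk sums, bounded by a geometric
series; this accounts for the exponent `c + 1`. -/
theorem factorProd_relClose {G : SimpleGraph (Fin n)} {b γ c₀ c₁ : ℝ}
    {ρ : Fin n → ℝ} {c s d : ℕ}
    (D : DecayData G (IsLowDegree q β G) q b ρ (vertexDelta q β G) c₀ c₁)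
    (h0 : 0 < γ) (h1 : γ < 1) (h : SawBound q β G γ c s) (hns : n ≤ s)
    (hd : 2 * c₁ / (1 - γ) * (s : ℝ) ^ (c + 1) * γ ^ d ≤ 1 / (4 * s)) (hZ : 0 < pottsZ G q b) :
    RelClose (1 / (4 * s)) (factorProd q G (IsLowDegree q β G) b ρ d ∅ (List.finRange n))
      (pottsZ G q b) ∧ 0 ≤ factorProd q G (IsLowDegree q β G) b ρ d ∅ (List.finRange n) := by
  rw [← fieldZ_empty_zero] at hZ ⊢
  have h2 := factorProd_close D d (List.finRange n) ∅ (List.nodup_finRange n) (by simp) hZ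
  have hnonneg : 0 ≤ factorProd q G (IsLowDegree q β G) b ρ d ∅ (List.finRange n) := by
    by_contra hcon
    have := mul_neg_of_pos_of_neg (Real.exp_pos ((List.finRange n).map fun v =>
      2 * (c₁ * avoidTail G (vertexDelta q β G) (d + 1) ∅ v)).sum) (not_le.1 hcon)
    linarith [h2.2]
  refine ⟨h2.mono (le_trans ?_ hd) hnonneg hZ.le, hnonneg⟩
  have h3 : ((List.finRange n).map fun v =>
      2 * (c₁ * avoidTail G (vertexDelta q β G) (d + 1) ∅ v)).sum ≤
      ((List.finRange n).map fun v => 2 * (c₁ * avoidTail G (vertexDelta q β G) (d + 1) ∅ v)).length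
        • (2 * (c₁ * ((s : ℝ) ^ c * (γ ^ (d + 1) / (1 - γ))))) := by
    refine List.sum_le_card_nsmul _ _ fun x hx => ?_
    obtain ⟨v, -, rfl⟩ := List.mem_map.1 hx
    exact mul_le_mul_of_nonneg_left (mul_le_mul_of_nonneg_left
      (avoidTail_le h0 h1 h (by omega) v) D.c₁_nonneg) two_pos.le
  rw [List.length_map, List.length_finRange, nsmul_eq_mul] at h3
  have h5 : 0 < 1 - γ := by linarith
  have hc := D.c₁_nonneg
  refine h3.trans ?_
  calc (n : ℝ) * (2 * (c₁ * ((s : ℝ) ^ c * (γ ^ (d + 1) / (1 - γ))))) ≤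
        s * (2 * (c₁ * ((s : ℝ) ^ c * (γ ^ d / (1 - γ))))) := by
          have : γ ^ (d + 1) ≤ γ ^ d := pow_le_pow_of_le_one h0.le h1.le (Nat.le_succ d)
          gcongr
    _ = _ := by rw [pow_succ]; ring

theorem within_of_relClose {x z ε : ℝ} {N s : ℕ} (hε : 0 < ε) (hN : N = ⌈1 / ε⌉₊) (hNs : N ≤ s)
    (hz : 0 ≤ z) (h : RelClose (1 / (2 * s)) x z) :
    (1 - ε) * z ≤ x ∧ x ≤ (1 + ε) * z := by
  have h1 : 1 / ε ≤ s := by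
    refine (Nat.le_ceil _).trans ?_
    rw [← hN]; exact_mod_cast hNs
  have hs : (0 : ℝ) < s := lt_of_lt_of_le (by positivity) h1
  have hs1 : (1 : ℝ) ≤ s := by
    have : 0 < s := by exact_mod_cast hs
    exact_mod_cast this
  set E : ℝ := 1 / (2 * s) with hE
  have h2 : 2 * E ≤ ε := by
    rw [div_le_iff₀ hε] at h1
    rw [hE, mul_one_div, div_le_iff₀ (by positivity)]
    linarith
  have hE0 : 0 ≤ E := by positivity
  have hE1 : E ≤ 1 := by
    rw [hE, div_le_one (by positivity)]; linarith
  -- Valid since `E ≤ 1`; and `2 * E = 1 / s ≤ ε` because `s ≥ N ≥ 1 / ε`.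
  have h3 : Real.exp E ≤ 1 + 2 * E := by
    have := Real.abs_exp_sub_one_le (x := E) (by rwa [abs_of_nonneg hE0])
    rw [abs_of_nonneg hE0] at this
    linarith [le_abs_self (Real.exp E - 1)]
  constructor
  · have h4 : Real.exp (-E) * z ≤ x := by
      rw [Real.exp_neg, inv_mul_le_iff₀ (Real.exp_pos E)]
      exact h.2
    refine le_trans (mul_le_mul_of_nonneg_right ?_ hz) h4
    linarith [Real.add_one_le_exp (-E)]
  · exact h.1.trans (mul_le_mul_of_nonneg_right (h3.trans (by linarith)) hz)

/-- A relative error `u` of the activity is amplified at most `n ^ 2` times. The `3 * s` bits make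
`u` at most `1 / (8 * s ^ 3)`, and `k₀` absorbs the dependence on `β`, `1 - β` and `η`. For `β = 0`
no relative approximation by a positive number exists, so the activity is set to 0 exactly. -/
theorem exists_precision (hβ0 : 0 ≤ β) (hβ1 : β < 1) {η : ℝ} (hη : 0 < η) :
    ∃ k₀ : ℕ, ∀ s k a : ℕ, 1 ≤ s → k = 3 * s + k₀ → |(a : ℝ) - β * 2 ^ k| ≤ 1 →
      a ≤ 2 ^ k ∧ 0 ≤ approxActivity β a k ∧ approxActivity β a k ≤ 1 ∧
      |approxActivity β a k - β| < η ∧ (β ≠ 0 → 0 < approxActivity β a k) ∧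
      ∀ (n : ℕ) (G : SimpleGraph (Fin n)), n ≤ s →
        RelClose (1 / (4 * s)) (pottsZ G q (approxActivity β a k)) (pottsZ G q β) := by
  have hβ1' : 0 < 1 - β := by linarith
  obtain ⟨k₀, hk₀⟩ := pow_unbounded_of_one_lt (8 / β + 1 / η + 1 / (1 - β))
    (one_lt_two : (1 : ℝ) < 2)
  refine ⟨k₀, fun s k a hs hk ha => ?_⟩
  have hs' : (1 : ℝ) ≤ s := by exact_mod_cast hs
  have hβ8 : 0 ≤ 8 / β := by positivity
  have hη1 : 0 < 1 / η := by positivity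
  have hβ2 : 0 < 1 / (1 - β) := by positivity
  have hpk : (s : ℝ) ^ 3 * 2 ^ k₀ ≤ 2 ^ k := by
    rw [hk, pow_add, mul_comm 3 s, pow_mul]
    have h1 : (s : ℝ) ≤ 2 ^ s := by exact_mod_cast Nat.lt_two_pow_self.le
    gcongr
  have hs3 : (1 : ℝ) ≤ (s : ℝ) ^ 3 := one_le_pow₀ hs'
  have hk₀' : (2 : ℝ) ^ k₀ ≤ 2 ^ k := le_trans (by nlinarith [pow_pos (two_pos (α := ℝ)) k₀]) hpk
  have hp : (0 : ℝ) < 2 ^ k := by positivity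
  have hdiff : |(a : ℝ) / 2 ^ k - β| ≤ 1 / 2 ^ k := by
    rw [show (a : ℝ) / 2 ^ k - β = ((a : ℝ) - β * 2 ^ k) / 2 ^ k by field_simp, abs_div,
      abs_of_pos hp]
    gcongr
  have hle1 : 1 / 2 ^ k ≤ 1 - β := by
    rw [div_le_iff₀ hp, mul_comm, ← div_le_iff₀ hβ1']; linarith
  have hlt : 1 / 2 ^ k < η := by
    rw [div_lt_iff₀ hp, mul_comm, ← div_lt_iff₀ hη]; linarith
  have hb1 : (a : ℝ) / 2 ^ k ≤ 1 := by linarith [(abs_le.1 hdiff).2]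
  have ha' : a ≤ 2 ^ k := by
    rw [div_le_one hp] at hb1
    exact_mod_cast hb1
  by_cases hβ : β = 0
  · subst hβ
    have h2 : approxActivity 0 a k = 0 := if_pos rfl
    rw [h2]
    refine ⟨ha', le_rfl, zero_le_one, by simpa using hη, fun h => absurd rfl h, fun n G _ => ?_⟩
    exact RelClose.refl (by positivity) (pottsZ_nonneg G le_rfl)
  · have h2 : approxActivity β a k = a / 2 ^ k := if_neg hβ
    have hβpos : 0 < β := lt_of_le_of_ne hβ0 (Ne.symm hβ)
    rw [h2]
    have hu : 1 / 2 ^ k = 1 / (2 ^ k * β) * β := by field_simp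
    have h8 : 8 * (s : ℝ) ^ 3 ≤ 2 ^ k * β := by
      have h3 : 8 ≤ 2 ^ k₀ * β := by
        rw [← div_le_iff₀ hβpos]; linarith
      calc 8 * (s : ℝ) ^ 3 ≤ (2 ^ k₀ * β) * (s : ℝ) ^ 3 := by gcongr
        _ = (s : ℝ) ^ 3 * 2 ^ k₀ * β := by ring
        _ ≤ _ := mul_le_mul_of_nonneg_right hpk hβ0
    have hsmall : 1 / (2 ^ k * β) ≤ 1 / (8 * (s : ℝ) ^ 3) :=
      one_div_le_one_div_of_le (by positivity) h8
    have hhalf : 1 / (2 ^ k * β) ≤ 1 / 2 :=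
      one_div_le_one_div_of_le two_pos (by linarith)
    have hclose := relClose_of_abs_sub_le hβpos hhalf (hu ▸ hdiff)
    have hpos : 0 < (a : ℝ) / 2 ^ k := by
      have h4 : 1 / 2 ^ k ≤ β / 2 := by
        rw [hu]; nlinarith
      linarith [(abs_le.1 hdiff).1]
    refine ⟨ha', hpos.le, hb1, hdiff.trans_lt hlt, fun _ => hpos, fun n G hn => ?_⟩
    have hn' : (n : ℝ) ≤ s := by exact_mod_cast hn
    refine (pottsZ_close G hpos.le hβ0 (by positivity) hclose).mono ?_
      (pottsZ_nonneg G hpos.le) (pottsZ_nonneg G hβ0)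
    calc (n : ℝ) * n * (2 * (1 / (2 ^ k * β))) ≤ s * s * (2 * (1 / (8 * (s : ℝ) ^ 3))) := by
          gcongr
      _ = 1 / (4 * s) := by field_simp; norm_num

end Algorithm

/-! ### The approximation algorithm for sparse families -/

section Sparse

open scoped Classical

variable {n q : ℕ} {β : ℝ}

theorem ratioSetup {prog : Lisp.Program} {K k : ℕ} {T bp : Lisp.Data} (G : SimpleGraph (Fin n))
    (B : Lisp.RatioProg K q prog) {ρ : ℕ → ℝ} {b : ℝ} (hb0 : 0 ≤ b) (hb1 : b ≤ 1)
    (hρ : ∀ d, 1 / 2 ≤ ρ d)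
    (hlow : ∀ d : ℕ, (d : ℝ) < ((q : ℝ) - 1) / (1 - β) - 2 →
      Lisp.IsFrac (T.entry d) (ρ d) T.size)
    (hhigh : ∀ d : ℕ, ¬ (d : ℝ) < ((q : ℝ) - 1) / (1 - β) - 2 → T.entry d = .nil)
    (hbp : Lisp.IsFrac bp b k) :
    Lisp.RatioSetup prog K G (IsLowDegree q β G) q b (fun v => ρ (vdeg G v))
      (fun v => T.entry (vdeg G v)) bp k T.size (2 * n + T.size + 2) where
  toRatioProg := B
  activity := hbp
  attr_low w hw := hlow _ hw
  attr_high w hw := hhigh _ hw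
  size_le w := by
    rw [Lisp.encVertex, Lisp.Data.size_cons, Lisp.Data.size_unary]
    have := T.size_entry_le (vdeg G w)
    have := w.2
    omega
  b_nonneg := hb0
  b_le_one := hb1
  ρ_nonneg w := le_trans (by norm_num) (hρ _)

/-- The bound for the running time. -/
def totalTime (K q T c e k₀ s : ℕ) : ℕ :=
  Lisp.mainTime K s s q (3 * s + k₀ + 1) (2 * s + T + 2)
    (Lisp.nodeBits s (3 * s + k₀ + 1) T * (c * (2 * s) ^ e))
    (s * ((2 * s + T + 2) + s * ((2 * s + T + 2) + 1) + 3) + 1)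
    (c * (2 * s) ^ e) (20 * (3 * s + k₀ + 1) + 50) T

theorem polyBounded_totalTime (K q T c e k₀ : ℕ) : PolyBounded (totalTime K q T c e k₀) := by
  unfold totalTime
  have hk : PolyBounded fun s => 3 * s + k₀ + 1 :=
    (((PolyBounded.const 3).mul .id).add (.const k₀)).add (.const 1)
  have hm : PolyBounded fun s => 2 * s + T + 2 :=
    (((PolyBounded.const 2).mul .id).add (.const T)).add (.const 2)
  have hc : PolyBounded fun s => c * (2 * s) ^ e :=
    (PolyBounded.const c).mul (((PolyBounded.const 2).mul .id).pow e)
  refine Lisp.polyBounded_mainTime K q T hk hm ?_ ?_ hc ?_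
  · exact (((PolyBounded.const T).add ((PolyBounded.id.mul .id).mul hk)).add (.const 2)).mul hc
  · exact (PolyBounded.id.mul ((hm.add (PolyBounded.id.mul (hm.add (.const 1)))).add
      (.const 3))).add (.const 1)
  · exact ((PolyBounded.const 20).mul hk).add (.const 50)

theorem hasFPTAS_of_sparse (hq : 3 ≤ q) (hβ0 : 0 ≤ β) (hβ1 : β < 1) {𝒢 : GraphFamily}
    (hcontr : IsContractionFunction (pottsDelta q β) 𝒢)
    (hcol : β = 0 → ∀ (n : ℕ) (G : SimpleGraph (Fin n)), G ∈ 𝒢 n → G.Colorable q)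
    (hsparse : LocallySparse q β 𝒢) : HasFPTAS q β 𝒢 := by
  obtain ⟨C, γ, hC, h0, h1, hsaw⟩ := hcontr
  obtain ⟨C', hC', hblock⟩ := hsparse
  -- The real exponent is rounded up, and `n` is replaced by any larger `s`, so that a single
  -- parameter controls size and accuracy.
  set c := ⌈C⌉₊ with hc
  have hsaw' : ∀ (n s : ℕ) (G : SimpleGraph (Fin n)), G ∈ 𝒢 n → n ≤ s →
      SawBound q β G γ c s := by
    intro n s G hG hns v l hl
    refine (hsaw n G hG v l hl).le.trans (mul_le_mul_of_nonneg_right ?_ (by positivity))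
    have hn : (1 : ℝ) ≤ n := by exact_mod_cast v.pos
    have hn' : (n : ℝ) ≤ s := by exact_mod_cast hns
    calc (n : ℝ) ^ C ≤ (n : ℝ) ^ (c : ℝ) := Real.rpow_le_rpow_of_exponent_le hn (Nat.le_ceil C)
      _ = (n : ℝ) ^ c := Real.rpow_natCast _ _
      _ ≤ (s : ℝ) ^ c := by gcongr
  obtain ⟨T, ρ, η, hη, hρ, hlow, hhigh⟩ := Lisp.exists_table q hβ1
  obtain ⟨K, hK⟩ := exists_depth_factor h0 h1
    (2 * (Real.log 2 / minDelta q β) / (1 - γ)) (c + 1)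
  obtain ⟨c', e, hcost⟩ := exists_cost_bound hq hβ0 hβ1 h0 h1 c hC' K
  obtain ⟨k₀, hk₀⟩ := exists_precision (q := q) hβ0 hβ1 hη
  obtain ⟨time, htime⟩ := polyBounded_totalTime K q T.size c' e k₀
  refine ⟨Lisp.pottsProgram K q T (activityCode β), 3 * Polynomial.X + Polynomial.C k₀, time,
    fun n G hG ε hε N k hN hk a ha => ?_⟩
  set s := n + N with hs
  have hk' : k = 3 * s + k₀ := by simpa using hk
  -- This makes the parameter `s` positive even for the graph without vertices.
  have hN1 : 1 ≤ N := by
    rw [hN]; exact Nat.one_le_ceil_iff.2 (by positivity)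
  have hs1 : 1 ≤ s := by omega
  have hns : n ≤ s := by omega
  obtain ⟨ha', hb0, hb1, hbη, hbpos, hclose⟩ := hk₀ s k a hs1 hk' ha
  set b := approxActivity β a k with hb
  -- The partition function is automatically positive for `β ≠ 0`; only for `β = 0` is colourability
  -- needed.
  have hZb : 0 < pottsZ G q b := by
    by_cases hβ : β = 0
    · have : b = 0 := if_pos hβ
      rw [this]
      exact pottsZ_zero_pos G (hcol hβ n G hG)
    · exact pottsZ_pos G (hbpos hβ) (by omega)
  have D := decayData hq hβ0 hβ1 G hb0 hb1 hρ fun d hd =>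
    ⟨(hlow d hd).2.1, (hlow d hd).2.2 b hbη⟩
  have hS := hsaw' n s G hG hns
  obtain ⟨num, den, t, h2, h3, h4, h5⟩ := Lisp.outputs_main (G := G) (low := IsLowDegree q β G)
    (ρ := fun v => ρ (vdeg G v)) (k := k + 1) (h := T.size) (m := 2 * n + T.size + 2) K T
    (activityCode β) N k (20 * (k + 1) + 50) (c' * (2 * s) ^ e) (.binary a)
    (fun x y z => wp_activityCode ha' x y z _ _)
    (fun bp hbp => ratioSetup G (Lisp.ratioProg_pottsProgram K q T _) hb0 hb1
      (fun d => (hρ d).1) (fun d hd => (hlow d hd).1) hhigh hbp)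
    (hcost n s G hns hs1 hS (hblock n G hG))
    (fun R v hv => (vertexFactor_close D _ hv (fieldZ_pos_of_subset G hb0 hb1 D.q_pos
      (Finset.empty_subset R) (by rwa [fieldZ_empty_zero]))).1)
  refine ⟨num, den, t, h2, ?_, h4, ?_⟩
  · refine h3.trans (le_trans ?_ (htime s))
    unfold totalTime
    rw [hk']
    unfold Lisp.nodeBits
    refine Lisp.mainTime_mono hns (by omega) (by omega) ?_ ?_ <;> gcongr
  · obtain ⟨h6, h7⟩ := factorProd_relClose D h0 h1 hS hns (hK s hs1) hZb
    rw [← h5] at h6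
    refine within_of_relClose (s := s) hε hN (by omega) (pottsZ_nonneg G hβ0) ?_
    -- The tolerance is shared equally between the truncated recursion and the approximation of the
    -- activity.
    have h8 := h6.trans (hclose n G hns)
    have h9 : 1 / (4 * (s : ℝ)) + 1 / (4 * s) = 1 / (2 * s) := by
      rw [← two_mul, mul_one_div, show (4 : ℝ) * s = 2 * (2 * s) by ring, div_mul_eq_div_div]
      norm_num
    rwa [h9] at h8

end Sparse

/-! ### Graphs of bounded degree -/

section MaxDegree

variable {n q : ℕ} {β : ℝ}

/-- Greedy colouring: at each new vertex its neighbours block fewer than `q` colours. -/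
theorem colorable_of_degree_lt {G : SimpleGraph (Fin n)} (h : ∀ v, vdeg G v < q) :
    G.Colorable q := by
  classical
  have key : ∀ S : Finset (Fin n), ∃ f : Fin n → Fin q,
      ∀ u ∈ S, ∀ v ∈ S, G.Adj u v → f u ≠ f v := by
    intro S
    induction S using Finset.induction_on with
    | empty =>
      by_cases hn : Nonempty (Fin n)
      · exact ⟨fun v => ⟨0, Nat.zero_lt_of_lt (h v)⟩, by simp⟩
      · exact ⟨fun v => (hn ⟨v⟩).elim, by simp⟩
    | insert w S hw ih =>
      obtain ⟨f, hf⟩ := ih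
      obtain ⟨c, hc⟩ : ∃ c, c ∉ (G.neighborFinset w).image f := by
        by_contra hcon
        push Not at hcon
        have h1 := Finset.card_le_card (fun c _ => hcon c : Finset.univ ⊆ _)
        have h2 := Finset.card_image_le (s := G.neighborFinset w) (f := f)
        rw [Finset.card_univ, Fintype.card_fin] at h1
        rw [SimpleGraph.card_neighborFinset_eq_degree] at h2
        have h3 := h w
        have h4 : vdeg G w = G.degree w := by
          unfold vdeg; congr!
        omega
      have hc' : ∀ v, G.Adj w v → c ≠ f v := fun v hv hcv =>
        hc (Finset.mem_image.2 ⟨v, by simpa using hv, hcv.symm⟩)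
      refine ⟨Function.update f w c, fun u hu v hv huv => ?_⟩
      by_cases hu' : u = w
      · subst hu'
        rw [Function.update_self, Function.update_of_ne huv.ne']
        exact hc' v huv
      · by_cases hv' : v = w
        · subst hv'
          rw [Function.update_self, Function.update_of_ne huv.ne]
          exact (hc' u huv.symm).symm
        · rw [Function.update_of_ne hu', Function.update_of_ne hv']
          exact hf u ((Finset.mem_insert.1 hu).resolve_left hu') v
            ((Finset.mem_insert.1 hv).resolve_left hv') huv
  obtain ⟨f, hf⟩ := key Finset.univ
  exact ⟨.mk f fun {u v} huv => hf u (Finset.mem_univ _) v (Finset.mem_univ _) huv⟩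

theorem card_remNbrs_le (G : SimpleGraph (Fin n)) (R : Finset (Fin n)) (v : Fin n) :
    (remNbrs G R v).card ≤ vdeg G v := by
  classical
  unfold vdeg
  rw [← SimpleGraph.card_neighborFinset_eq_degree]
  refine Finset.card_le_card fun w hw => ?_
  rw [SimpleGraph.mem_neighborFinset]
  exact (mem_remNbrs.1 hw).1

theorem avoidSum_le_pow {G : SimpleGraph (Fin n)} {δ : Fin n → ℝ} {x : ℝ} {Δ : ℕ}
    (h0 : ∀ w, 0 ≤ δ w) (hδ : ∀ w, δ w ≤ x) (hx : 0 ≤ x) (hΔ : ∀ v, vdeg G v ≤ Δ) (l : ℕ)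
    (R : Finset (Fin n)) (v : Fin n) : avoidSum G δ l R v ≤ (Δ * x) ^ l := by
  induction l generalizing R v with
  | zero => simp [avoidSum]
  | succ l ih =>
    rw [avoidSum]
    have hle : ∀ w ∈ remNbrs G (insert v R) v,
        δ w * avoidSum G δ l (insert v R) w ≤ x * (Δ * x) ^ l := fun w _ =>
      mul_le_mul (hδ w) (ih _ w) (avoidSum_nonneg h0 _ _ _) hx
    refine (Finset.sum_le_card_nsmul _ _ _ hle).trans ?_
    rw [nsmul_eq_mul, pow_succ, mul_comm _ ((Δ : ℝ) * x), mul_assoc]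
    have : ((remNbrs G (insert v R) v).card : ℝ) ≤ Δ := by
      exact_mod_cast (card_remNbrs_le G _ v).trans (hΔ v)
    gcongr

variable {Δ : ℕ}

theorem delta_lt_of_lt (hβ1 : β < 1) (h : 3 * (1 - β) * (Δ : ℝ) + 1 < q) :
    3 * (Δ : ℝ) < ((q : ℝ) - 1) / (1 - β) := by
  rw [lt_div_iff₀ (by linarith)]
  linarith

theorem isLowDegree_of_lt (hβ1 : β < 1) (h : 3 * (1 - β) * (Δ : ℝ) + 1 < q) (hΔ : 1 ≤ Δ)
    {d : ℕ} (hd : d ≤ Δ) : (d : ℝ) < ((q : ℝ) - 1) / (1 - β) - 2 := by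
  have h1 := delta_lt_of_lt hβ1 h
  have h2 : (1 : ℝ) ≤ Δ := by exact_mod_cast hΔ
  have h3 : (d : ℝ) ≤ Δ := by exact_mod_cast hd
  linarith

theorem isContractionFunction_maxDegreeFamily (hq : 3 ≤ q) (hβ0 : 0 ≤ β) (hβ1 : β < 1)
    (h : 3 * (1 - β) * (Δ : ℝ) + 1 < q) :
    IsContractionFunction (pottsDelta q β) (maxDegreeFamily Δ) := by
  have hb : 0 < 1 - β := by linarith
  set x : ℝ := 2 * (1 - β) / ((q : ℝ) - 1 - (1 - β) * Δ) with hx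
  have hΔ0 : (0 : ℝ) ≤ Δ := Nat.cast_nonneg _
  have hden : 2 * (1 - β) * Δ < (q : ℝ) - 1 - (1 - β) * Δ := by nlinarith
  have hden0 : 0 < (q : ℝ) - 1 - (1 - β) * Δ := lt_of_le_of_lt (by positivity) hden
  have hx0 : 0 < x := by positivity
  have hΔx : Δ * x < 1 := by
    rw [hx, mul_div_assoc', div_lt_one hden0]
    linarith
  have hΔx0 : 0 ≤ Δ * x := by positivity
  -- The midpoint between `Δ * x` and 1 gives the strict inequality, and it is positive also for `Δ
  -- = 0`.
  refine ⟨1, (Δ * x + 1) / 2, one_pos, by linarith, by linarith, fun n G hG v l hl => ?_⟩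
  have hn : (1 : ℝ) ≤ n := by exact_mod_cast v.pos
  have hδ : sawSum G (pottsDelta q β) v l ≤ (Δ * x) ^ l := by
    rw [← avoidSum_empty_eq_sawSum]
    -- For `Δ = 0` a vertex may fail to have low degree, for example if `q = 3` and `β = 0`, but
    -- then there are no walks of positive length.
    rcases Nat.eq_zero_or_pos Δ with hΔ | hΔ
    · obtain ⟨l, rfl⟩ : ∃ l', l = l' + 1 := ⟨l - 1, by omega⟩
      have h2 : remNbrs G (insert v ∅) v = ∅ := by
        have := (card_remNbrs_le G (insert v ∅) v).trans (hG v)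
        rw [← Finset.card_eq_zero]
        omega
      rw [avoidSum, h2, Finset.sum_empty]
      positivity
    · refine avoidSum_le_pow (fun w => (pottsDelta_pos hq hβ0 hβ1 _).le) (fun w => ?_) hx0.le hG
        l ∅ v
      rw [pottsDelta_of_low (isLowDegree_of_lt hβ1 h hΔ (hG w)), hx]
      have h3 : (vdeg G w : ℝ) ≤ Δ := by exact_mod_cast hG w
      gcongr
  refine hδ.trans_lt ?_
  rw [Real.rpow_one]
  calc (Δ * x) ^ l < ((Δ * x + 1) / 2) ^ l :=
        pow_lt_pow_left₀ (by linarith) hΔx0 (by omega)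
    _ = 1 * ((Δ * x + 1) / 2) ^ l := (one_mul _).symm
    _ ≤ n * ((Δ * x + 1) / 2) ^ l := by gcongr

/-- A path with an edge forces `Δ ≥ 1`. Then all vertices have low degree, so every set of vertices
is a permissive block. -/
theorem locallySparse_maxDegreeFamily (hβ1 : β < 1) (h : 3 * (1 - β) * (Δ : ℝ) + 1 < q) :
    LocallySparse q β (maxDegreeFamily Δ) := by
  refine ⟨2, two_pos, fun n G hG u v P hP hl => ?_⟩
  have hΔ : 1 ≤ Δ := by
    cases P with
    | nil => simp at hl
    | @cons _ w _ hadj _ =>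
      refine le_trans ?_ (hG u)
      classical
      unfold vdeg
      exact (SimpleGraph.degree_pos_iff_exists_adj _ _).2 ⟨w, hadj⟩
  have hblock : permissiveBlock q β G {w | w ∈ P.support} ⊆ {w | w ∈ P.support} :=
    (permissiveBlock_isLeast q β G _).2
      ⟨subset_rfl, fun w _ _ => isLowDegree_of_lt hβ1 h hΔ (hG w)⟩
  have h2 := Set.ncard_le_ncard hblock (Set.toFinite _)
  have h3 : {w | w ∈ P.support}.ncard ≤ P.length + 1 := by
    classical
    rw [← P.length_support, ← List.coe_toFinset, Set.ncard_coe_finset]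
    exact List.toFinset_card_le _
  have h4 : (((permissiveBlock q β G {w | w ∈ P.support}).ncard : ℕ) : ℝ) ≤ P.length + 1 := by
    exact_mod_cast h2.trans h3
  have h5 : (1 : ℝ) ≤ P.length := by exact_mod_cast hl
  have h6 := Real.log_natCast_nonneg n
  linarith

theorem hasFPTAS_maxDegreeFamily (hq : 3 ≤ q) (hβ0 : 0 ≤ β) (hβ1 : β < 1)
    (h : 3 * (1 - β) * (Δ : ℝ) + 1 < q) : HasFPTAS q β (maxDegreeFamily Δ) := by
  refine hasFPTAS_of_sparse hq hβ0 hβ1 (isContractionFunction_maxDegreeFamily hq hβ0 hβ1 h) ?_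
    (locallySparse_maxDegreeFamily hβ1 h)
  rintro rfl n G hG
  refine colorable_of_degree_lt fun v => ?_
  have h1 : (Δ : ℝ) < q := by
    have : (0 : ℝ) ≤ Δ := Nat.cast_nonneg _
    linarith
  have h2 : Δ < q := by exact_mod_cast h1
  exact (hG v).trans_lt h2

end MaxDegree
theorem theorem2 (q : ℕ) (hq : 3 ≤ q) (β : ℝ) (hβ0 : 0 ≤ β) (hβ1 : β < 1) :
    (∀ 𝒢 : GraphFamily,
      IsContractionFunction (pottsDelta q β) 𝒢 →
      (β = 0 → ∀ (n : ℕ) (G : SimpleGraph (Fin n)), G ∈ 𝒢 n → G.Colorable q) →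
      LocallySparse q β 𝒢 →
      HasFPTAS q β 𝒢) ∧
    (∀ Δ : ℕ, 3 * (1 - β) * (Δ : ℝ) + 1 < (q : ℝ) → HasFPTAS q β (maxDegreeFamily Δ)) :=
  ⟨fun _ hcontr hcol hsparse => hasFPTAS_of_sparse hq hβ0 hβ1 hcontr hcol hsparse,
    fun _ h => hasFPTAS_maxDegreeFamily hq hβ0 hβ1 h⟩
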